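/- **Setting.** Let $\mathcal C$ be an abelian category and let $X\colon\mathcal C\to\mathcal C$ be an additive exact functor which preserves injective objects and is locally nilpotent (for every $M\in\mathcal C$ there is $n$ with $X^n(M)=0$). The category $\mathcal C^{T(X)}$ of modules over the free monad $T(X)=\bigoplus_{i\ge 0}X^i$ is identified with the category of pairs $\mathsf M=(M,h_{\mathsf M})$ with $M\in\mathcal C$ and $h_{\mathsf M}\colon X(M)\to M$. The functor $f_!\colon\mathcal C\to\mathcal C^{T(X)}$, $f_!(M)=(\bigoplus_{i\ge0}X^i(M),\text{inclusion})$, is left adjoint to the forgetful functor. $\operatorname{Mono}(X)$ is the full subcategory of those $\mathsf M$ for which $h_{\mathsf M}$ is a monomorphism; it contains all $f_!(M)$, it is an exact category whose conflations are the short exact sequences of $\mathcal C^{T(X)}$ with all terms in $\operatorname{Mono}(X)$, and "injective object of $\operatorname{Mono}(X)$" refers to this exact structure. For an abelian or exact category $\mathcal A$ let $\overline{\mathcal A}$ be the quotient of $\mathcal A$ by the ideal of morphisms which factor through an injective object. $X$ induces an endofunctor of $\overline{\mathcal C}$, again denoted $X$, and $\overline{\mathcal C}{}^{T(X)}$ is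 the category of pairs $(M,h)$ with $M\in\overline{\mathcal C}$ and $h\colon X(M)\to M$ in $\overline{\mathcal C}$. An epivalence is a full and dense functor which reflects isomorphisms. An injective envelope is a left minimal monomorphism into an injective object. $\mathcal C$ *has injective envelopes* if every object has one, and it *has maximal injective summands* if every object $M$ is isomorphic to $M'\oplus I$ with $I$ injective and $M'$ without nonzero injective summands. For $\mathsf M=(M,h_{\mathsf M})\in\mathcal C^{T(X)}$ choose an injective envelope $j\colon\ker h_{\mathsf M}\to J$ and an extension $e\colon X(M)\to J$ of $j$. Then $\operatorname{Mimo}\mathsf M$ is the pushout of $\iota_M-f_!(h_{\mathsf M})\colon f_!(X(M))\to f_!(M)$ along $f_!(e)\colon f_!(X(M))\to f_!(J)$, where $\iota_M$ is the morphism which corresponds by adjunction to the inclusion $X(M)\to\bigoplus_{i\ge 0}X^i(M)$. **Theorem.** (1) Assume that $\mathcal C$ has injective envelopes and maximal injective summands. (a) $I\mapsto f_!(I)$ induces a bijection from the isomorphism classes of indecomposable injective objects of $\mathcal C$ onto the isomorphism classes of indecomposable injective objects of $\operatorname{Mono}(X)$. (b) Every $\mathsf M\in\overline{\mathcal C}{}^{T(X)}$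 is isomorphic in $\overline{\mathcal C}{}^{T(X)}$ to the image of some $\widehat{\mathsf M}\in\mathcal C^{T(X)}$ whose underlying object of $\mathcal C$ has no nonzero injective summands. The choices in the construction of $\operatorname{Mimo}\widehat{\mathsf M}$ can always be made, the pushout exists, and it lies in $\operatorname{Mono}(X)$. Up to isomorphism, $\operatorname{Mimo}\widehat{\mathsf M}$ depends only on the isomorphism class of $\mathsf M$ in $\overline{\mathcal C}{}^{T(X)}$, and not on the choices of $\widehat{\mathsf M}$, $j$ and $e$. (c) The canonical functor $\operatorname{Mono}(X)\to\overline{\mathcal C}{}^{T(X)}$ factors through an epivalence $\overline{\operatorname{Mono}}(X)\to\overline{\mathcal C}{}^{T(X)}$. The map $\mathsf M\mapsto\operatorname{Mimo}\widehat{\mathsf M}$ is a bijection from the isomorphism classes of indecomposable objects of $\overline{\mathcal C}{}^{T(X)}$ onto the isomorphism classes of non-injective indecomposable objects of $\operatorname{Mono}(X)$, and it is inverse to the map induced by $\operatorname{Mono}(X)\to\overline{\operatorname{Mono}}(X)\to\overline{\mathcal C}{}^{T(X)}$. (2) Let $Q$ be a finite acyclic quiver and $\mathcal B$ an abelian category with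 injective envelopes and maximal injective summands. Let $\operatorname{mono}(Q,\mathcal B)$ be the category of the representations $(B_i,B_\alpha)$ of $Q$ in $\mathcal B$ for which $B_{i,\mathrm{in}}=(B_\alpha)_\alpha\colon\bigoplus_{t(\alpha)=i}B_{s(\alpha)}\to B_i$ is a monomorphism for every vertex $i$, with the exact structure inherited from $\operatorname{rep}(Q,\mathcal B)$. Then the analogues of (a), (b) and (c) hold with $\operatorname{rep}(Q,\mathcal B)$, $\operatorname{rep}(Q,\overline{\mathcal B})$, $\operatorname{mono}(Q,\mathcal B)$ in place of $\mathcal C^{T(X)}$, $\overline{\mathcal C}{}^{T(X)}$, $\operatorname{Mono}(X)$. Here the bijection in (a) is $(I,i)\mapsto f_!(I(i))$, defined on the pairs of an isomorphism class of indecomposable injectives $I$ of $\mathcal B$ and a vertex $i$, with $f_!(I(i))_k=\bigoplus_{p\colon i\to k}I$ (sum over paths) and with arrows acting by $p\mapsto\alpha p$. The lift $\widehat{\mathsf M}$ is required to have no nonzero injective summands at any vertex. Finally $$(\operatorname{Mimo}B)_i=B_i\oplus\bigoplus_{p,\;t(p)=i}J_{s(p)},$$ where $j_i\colon\ker B_{i,\mathrm{in}}\to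 J_i$ are injective envelopes and $e_i$ are extensions of $j_i$ to $\bigoplus_{t(\alpha)=i}B_{s(\alpha)}$; an arrow $\beta\colon i\to k$ acts on $B_i$ by $B_\beta$ together with the restriction of $e_k$ to the summand indexed by $\beta$, which maps to the summand $J_k$ of the trivial path, and it acts as the identity from the summand indexed by $p$ to the summand indexed by $\beta p$. (3) Let $\Lambda$ be an Artin algebra. Then the category $\operatorname{Mod}\Lambda$ of right $\Lambda$-modules and the category $\operatorname{mod}\Lambda$ of finitely generated right $\Lambda$-modules have injective envelopes and maximal injective summands. In particular, (2) holds for $\mathcal B=\operatorname{Mod}\Lambda$ and for $\mathcal B=\operatorname{mod}\Lambda$ and every finite acyclic quiver $Q$. -/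

import Mathlib

open CategoryTheory CategoryTheory.Limits

universe v u v' u'

namespace Mimo

set_option linter.unusedVariables false

noncomputable section

section Coproducts
variable {A : Type u} [Category.{v} A] [Preadditive A]

/-- The powers of an endofunctor. -/
def power (X : A ⥤ A) : ℕ → (A ⥤ A)
  | 0 => 𝟭 A
  | n + 1 => power X n ⋙ X

/-- For each object `M` some power `X^n(M)` is zero. -/
class IsLocallyNilpotent (X : A ⥤ A) : Prop where
  exists_isZero (M : A) : ∃ n : ℕ, IsZero ((power X n).obj M)

lemma isZero_power_of_le (X : A ⥤ A) [X.Additive] (M : A) {n : ℕ}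
    (h : IsZero ((power X n).obj M)) : ∀ m, n ≤ m → IsZero ((power X m).obj M) := by
  intro m hm
  induction m, hm using Nat.le_induction with
  | base => exact h
  | succ m _ ih => exact X.map_isZero ih

/-- A cofan over a sequence of objects which vanishes from some index on is a coproduct as soon as
it has projections which satisfy the equations of a biproduct. -/
lemma isColimit_of_projections {f : ℕ → A} {n : ℕ} (hf : ∀ i, n ≤ i → IsZero (f i))
    {P : A} (ι : ∀ i, f i ⟶ P) (π : ∀ i, P ⟶ f i) (h₁ : ∀ i, ι i ≫ π i = 𝟙 _)
    (h₂ : ∀ i j, i ≠ j → ι i ≫ π j = 0)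
    (h₃ : ∑ i ∈ Finset.range n, π i ≫ ι i = 𝟙 P) :
    Nonempty (IsColimit (Cofan.mk P ι)) := by
  refine ⟨Cofan.IsColimit.mk _ (fun s => ∑ i ∈ Finset.range n, π i ≫ s.inj i) ?_ ?_⟩
  · intro s j
    by_cases hj : j < n
    · change ι j ≫ _ = _
      rw [Preadditive.comp_sum, Finset.sum_eq_single j]
      · rw [← Category.assoc, h₁, Category.id_comp]
      · intro b _ hb
        rw [← Category.assoc, h₂ _ _ hb.symm, zero_comp]
      · simp [hj]
    · exact (hf j (not_lt.1 hj)).eq_of_src _ _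
  · intro s m hm
    have hm' : ∀ i, ι i ≫ m = s.inj i := hm
    change m = _
    calc m = (∑ i ∈ Finset.range n, π i ≫ ι i) ≫ m := by rw [h₃, Category.id_comp]
      _ = _ := by simp only [Preadditive.sum_comp, Category.assoc, hm']

lemma exists_projections {f : ℕ → A} {n : ℕ} (hf : ∀ i, n ≤ i → IsZero (f i))
    {c : Cofan f} (hc : IsColimit c) :
    ∃ π : ∀ i, c.pt ⟶ f i, (∀ i, c.inj i ≫ π i = 𝟙 _) ∧ (∀ i j, i ≠ j → c.inj i ≫ π j = 0) ∧
      ∑ i ∈ Finset.range n, π i ≫ c.inj i = 𝟙 c.pt := by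
  classical
  let π : ∀ j, c.pt ⟶ f j := fun j =>
    Cofan.IsColimit.desc hc (fun i => if h : i = j then eqToHom (by rw [h]) else 0)
  have h₁ : ∀ i, c.inj i ≫ π i = 𝟙 _ := fun i => by simp [π]
  have h₂ : ∀ i j, i ≠ j → c.inj i ≫ π j = 0 := fun i j hij => by simp [π, hij]
  refine ⟨π, h₁, h₂, Cofan.IsColimit.hom_ext hc _ _ fun j => ?_⟩
  by_cases hj : j < n
  · rw [Preadditive.comp_sum, Finset.sum_eq_single j]
    · rw [← Category.assoc, h₁, Category.id_comp, Category.comp_id]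
    · intro b _ hb
      rw [← Category.assoc, h₂ _ _ hb.symm, zero_comp]
    · simp [hj]
  · exact (hf j (not_lt.1 hj)).eq_of_src _ _

variable [HasFiniteCoproducts A] (X : A ⥤ A) [X.Additive] [IsLocallyNilpotent X]

instance hasCoproduct_power (M : A) : HasCoproduct fun i : ℕ => (power X i).obj M := by
  have := HasFiniteBiproducts.of_hasFiniteCoproducts (C := A)
  obtain ⟨n, hn⟩ := IsLocallyNilpotent.exists_isZero (X := X) M
  have hf := isZero_power_of_le X M hn
  let g : Fin n → A := fun i => (power X i).obj M
  have := isColimit_of_projections (f := fun i : ℕ => (power X i).obj M) hf (P := ⨁ g)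
    (fun i => if h : i < n then biproduct.ι g ⟨i, h⟩ else 0)
    (fun i => if h : i < n then biproduct.π g ⟨i, h⟩ else 0) ?_ ?_ ?_
  · obtain ⟨h⟩ := this
    exact HasColimit.mk ⟨_, h⟩
  · intro i
    by_cases h : i < n
    · simp [h, g]
    · exact (hf i (not_lt.1 h)).eq_of_src _ _
  · intro i j hij
    by_cases h : i < n <;> by_cases h' : j < n <;> simp only [h, h', dif_pos, dif_neg, 
      not_false_eq_true, zero_comp, comp_zero]
    exact biproduct.ι_π_ne g (by simpa using hij)
  · rw [Finset.sum_range, ← biproduct.total (f := g)]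
    exact Finset.sum_congr rfl fun i _ => by simp

instance preservesCoproduct_power (M : A) :
    PreservesColimit (Discrete.functor fun i : ℕ => (power X i).obj M) X := by
  obtain ⟨n, hn⟩ := IsLocallyNilpotent.exists_isZero (X := X) M
  have hf := isZero_power_of_le X M hn
  refine preservesColimit_of_preserves_colimit_cocone
    (coproductIsCoproduct fun i : ℕ => (power X i).obj M) (Nonempty.some ?_)
  obtain ⟨π, h₁, h₂, h₃⟩ := exists_projections hf
    (coproductIsCoproduct fun i : ℕ => (power X i).obj M)
  refine (isColimit_of_projections (n := n) (fun i hi => X.map_isZero (hf i hi)) _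
      (fun i => X.map (π i)) ?_ ?_ ?_).map (isColimitMapCoconeCofanMkEquiv X _ _).symm
  · intro i
    rw [← X.map_comp]
    exact (congrArg X.map (h₁ i)).trans (X.map_id _)
  · intro i j hij
    rw [← X.map_comp]
    exact (congrArg X.map (h₂ i j hij)).trans (by simp)
  · simp only [← X.map_comp, ← X.map_sum]
    exact (congrArg X.map h₃).trans (X.map_id _)

/-- The object `⨁_{i ≥ 0} X^i(M)`. -/
abbrev freeCarrier (M : A) : A := ∐ fun i : ℕ => (power X i).obj M

/-- The inclusion of the summand `X^i(M)`. -/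
abbrev freeι (M : A) (i : ℕ) : (power X i).obj M ⟶ freeCarrier X M :=
  Sigma.ι (fun i : ℕ => (power X i).obj M) i

/-- `X(⨁_{i ≥ 0} X^i(M))` is the coproduct of the objects `X^{i+1}(M)`. -/
def isColimitMapFreeι (M : A) : IsColimit (Cofan.mk (X.obj (freeCarrier X M))
    fun i => X.map (freeι X M i)) :=
  isColimitOfHasCoproductOfPreservesColimit X fun i : ℕ => (power X i).obj M

/-- The canonical inclusion `X(⨁_{i ≥ 0} X^i(M)) = ⨁_{i ≥ 1} X^i(M) ⟶ ⨁_{i ≥ 0} X^i(M)`. -/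
def freeStr (M : A) : X.obj (freeCarrier X M) ⟶ freeCarrier X M :=
  Cofan.IsColimit.desc (isColimitMapFreeι X M) fun i => freeι X M (i + 1)

@[simp]
lemma map_freeι_freeStr (M : A) (i : ℕ) :
    X.map (freeι X M i) ≫ freeStr X M = freeι X M (i + 1) :=
  Cofan.IsColimit.fac (isColimitMapFreeι X M) _ i

@[simp]
lemma map_freeι_freeStr_assoc (M : A) (i : ℕ) {N : A} (k : freeCarrier X M ⟶ N) :
    X.map (freeι X M i) ≫ freeStr X M ≫ k = freeι X M (i + 1) ≫ k :=
  (Category.assoc _ _ _).symm.trans (congrArg (fun t => t ≫ k) (map_freeι_freeStr X M i))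

variable {X} in
lemma map_free_hom_ext {M N : A} {g g' : X.obj (freeCarrier X M) ⟶ N}
    (h : ∀ i, X.map (freeι X M i) ≫ g = X.map (freeι X M i) ≫ g') : g = g' :=
  Cofan.IsColimit.hom_ext (isColimitMapFreeι X M) _ _ h

/-! The category `C^{T(X)}` of modules over the free monad `T(X)` is realised as the category
`Endofunctor.Algebra X` of pairs of an object `M` and a morphism `h_M : X(M) ⟶ M`; that this is the
Eilenberg-Moore category of `T(X)` is proved in `isEquivalence_comparison`. -/

/-- `f_!(M)`, the free `X`-algebra on `M`. -/
abbrev freeAlgebra (M : A) : Endofunctor.Algebra X := ⟨freeCarrier X M, freeStr X M⟩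

variable {X}

/-- The component on `X^i(M)` of the algebra morphism `f_!(M) ⟶ N` which extends `g`. -/
def extendComp {M : A} (N : Endofunctor.Algebra X) (g : M ⟶ N.a) :
    ∀ i : ℕ, (power X i).obj M ⟶ N.a
  | 0 => g
  | i + 1 => X.map (extendComp N g i) ≫ N.str

/-- The algebra morphism `f_!(M) ⟶ N` which extends `g`. -/
def extend {M : A} (N : Endofunctor.Algebra X) (g : M ⟶ N.a) : freeAlgebra X M ⟶ N where
  f := Sigma.desc (extendComp N g)
  h := map_free_hom_ext fun i => by
    rw [← Functor.map_comp_assoc, Sigma.ι_desc, map_freeι_freeStr_assoc]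
    exact (Sigma.ι_desc (extendComp N g) (i + 1)).symm

lemma freeι_extend {M : A} (N : Endofunctor.Algebra X) (g : M ⟶ N.a) (i : ℕ) :
    freeι X M i ≫ (extend N g).f = extendComp N g i :=
  Sigma.ι_desc _ _

lemma freeι_hom {M : A} {N : Endofunctor.Algebra X} (φ : freeAlgebra X M ⟶ N) :
    ∀ i, freeι X M i ≫ φ.f = extendComp N (freeι X M 0 ≫ φ.f) i
  | 0 => rfl
  | i + 1 => by
    have h₁ : X.map (freeι X M i ≫ φ.f) ≫ N.str = extendComp N (freeι X M 0 ≫ φ.f) (i + 1) := by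
      rw [freeι_hom φ i]; rfl
    rw [← h₁, Functor.map_comp, Category.assoc, φ.h]
    exact (map_freeι_freeStr_assoc X M i φ.f).symm

variable (X)

/-- Morphisms of algebras `f_!(M) ⟶ N` are the morphisms `M ⟶ N` of underlying objects. -/
def freeHomEquiv (M : A) (N : Endofunctor.Algebra X) : (freeAlgebra X M ⟶ N) ≃ (M ⟶ N.a) where
  toFun φ := freeι X M 0 ≫ φ.f
  invFun g := extend N g
  left_inv φ := by
    refine Endofunctor.Algebra.ext (Sigma.hom_ext _ _ fun i => ?_)
    exact (freeι_extend N _ i).trans (freeι_hom φ i).symm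
  right_inv g := freeι_extend N g 0

/-- The functor `f_!`, left adjoint to the forgetful functor `f^*`; on the summand `X^i(M)` the
morphism `f_!(g)` is `X^i(g)`, see `power_map_free`. -/
def free : A ⥤ Endofunctor.Algebra X :=
  Adjunction.leftAdjointOfEquiv (G := Endofunctor.Algebra.forget X) (freeHomEquiv X)
    fun _ _ _ _ _ => (Category.assoc _ _ _).symm

/-- The adjunction between `f_!` and the forgetful functor. -/
def freeAdj : free X ⊣ Endofunctor.Algebra.forget X :=
  Adjunction.adjunctionOfEquivLeft _ _

lemma free_obj (M : A) : (free X).obj M = freeAlgebra X M := rfl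

lemma power_map_free (M N : A) (g : M ⟶ N) (i : ℕ) :
    freeι X M i ≫ ((free X).map g).f = (power X i).map g ≫ freeι X N i := by
  change freeι X M i ≫ (extend (freeAlgebra X N) (g ≫ freeι X N 0 ≫ 𝟙 _)).f = _
  rw [freeι_extend]
  induction i with
  | zero => exact congrArg (g ≫ ·) (Category.comp_id _)
  | succ i ih =>
    have h₁ : X.map ((power X i).map g ≫ freeι X N i) ≫ freeStr X N =
        X.map ((power X i).map g) ≫ freeι X N (i + 1) := by
      rw [Functor.map_comp, Category.assoc, map_freeι_freeStr]
    rw [extendComp, ih]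
    exact h₁

lemma freeι_one_map_comp {M N P : A} (g : M ⟶ N) (k : freeCarrier X N ⟶ P) :
    freeι X M 1 ≫ ((free X).map g).f ≫ k = X.map g ≫ freeι X N 1 ≫ k :=
  (Category.assoc _ _ _).symm.trans
    ((congrArg (· ≫ k) (power_map_free X M N g 1)).trans (Category.assoc _ _ _))

/-- The free monad `T(X)`, with underlying functor `M ↦ ⨁_{i ≥ 0} X^i(M)`. -/
def freeMonad : Monad A := (freeAdj X).toMonad

lemma freeAdj_counit_app (N : Endofunctor.Algebra X) :
    (freeAdj X).counit.app N = extend N (𝟙 N.a) := rfl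

/-- The algebras over the free monad on `X` are the algebras over the endofunctor `X`. -/
theorem isEquivalence_comparison : (Monad.comparison (freeAdj X)).IsEquivalence := by
  have hcomp (N : Endofunctor.Algebra X) : freeι X N.a 1 ≫ ((freeAdj X).counit.app N).f = N.str := by
    rw [freeAdj_counit_app]
    refine (freeι_extend N (𝟙 N.a) 1).trans ?_
    exact (congrArg (· ≫ N.str) (X.map_id _)).trans (Category.id_comp _)
  have hfull : (Monad.comparison (freeAdj X)).Full := ⟨fun {M N} φ => by
    refine ⟨⟨φ.f, ?_⟩, rfl⟩
    have h : ((free X).map φ.f).f ≫ ((freeAdj X).counit.app N).f =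
        ((freeAdj X).counit.app M).f ≫ φ.f := φ.h
    have h₁ : freeι X M.a 1 ≫ ((free X).map φ.f).f ≫ ((freeAdj X).counit.app N).f =
        X.map φ.f ≫ N.str :=
      (freeι_one_map_comp X φ.f _).trans (congrArg (X.map φ.f ≫ ·) (hcomp N))
    exact h₁.symm.trans ((congrArg (freeι X M.a 1 ≫ ·) h).trans
      ((Category.assoc _ _ _).symm.trans (congrArg (· ≫ φ.f) (hcomp M))))⟩
  have hess : (Monad.comparison (freeAdj X)).EssSurj := ⟨fun M => by
    let a : freeCarrier X M.A ⟶ M.A := M.a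
    let N : Endofunctor.Algebra X := ⟨M.A, freeι X M.A 1 ≫ a⟩
    have h₀ : freeι X M.A 0 ≫ a = 𝟙 _ := by
      have h : freeι X M.A 0 ≫ 𝟙 _ = (freeAdj X).unit.app M.A := rfl
      rw [Category.comp_id] at h
      rw [h]
      exact M.unit
    have h₁ : freeStr X M.A ≫ a = X.map a ≫ freeι X M.A 1 ≫ a := by
      have h : ((freeAdj X).counit.app (freeAlgebra X M.A)).f ≫ a = ((free X).map a).f ≫ a :=
        M.assoc
      exact (congrArg (· ≫ a) (hcomp (freeAlgebra X M.A))).symm.trans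
        ((Category.assoc _ _ _).trans ((congrArg (freeι X _ 1 ≫ ·) h).trans (freeι_one_map_comp X a a)))
    have h₂ : ∀ i, extendComp N (𝟙 M.A) i = freeι X M.A i ≫ a := by
      intro i
      induction i with
      | zero => exact h₀.symm
      | succ i ih =>
        rw [extendComp, ih]
        have h₃ : X.map (freeι X M.A i) ≫ freeStr X M.A ≫ a = freeι X M.A (i + 1) ≫ a :=
          map_freeι_freeStr_assoc X M.A i a
        rw [← h₃, h₁, ← Functor.map_comp_assoc]
        rfl
    have h₄ : ((freeAdj X).counit.app N).f = a :=
      Sigma.hom_ext _ _ fun i => (freeι_extend N _ i).trans (h₂ i)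
    refine ⟨N, ⟨Monad.Algebra.isoMk (Iso.refl _) ?_⟩⟩
    refine (congrArg (· ≫ M.a) ((freeAdj X).toMonad.map_id _)).trans ?_
    refine (Category.id_comp _).trans (Eq.trans ?_ (Category.comp_id _).symm)
    exact h₄.symm⟩
  exact { }

/-- The structure map of `f_!(M)`, regarded as a morphism `f_!(X(M)) ⟶ f_!(M)`: on generators it is
the inclusion of the summand `X(M)`. -/
def freeIncl (M : A) : (free X).obj (X.obj M) ⟶ (free X).obj M :=
  (freeHomEquiv X _ _).symm (freeι X M 1)

instance mono_freeStr (M : A) : Mono (freeStr X M) := by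
  have : freeStr X M ≫ Sigma.desc (fun i : ℕ => match i with
      | 0 => 0
      | i + 1 => X.map (freeι X M i)) = 𝟙 _ :=
    map_free_hom_ext fun i => by
      rw [map_freeι_freeStr_assoc, Category.comp_id]
      exact Sigma.ι_desc _ (i + 1)
  exact mono_of_mono_fac this

end Coproducts

section IsoClasses

/-- The collection of isomorphism classes of objects. -/
abbrev IsoClasses (A : Type u) [Category.{v} A] : Type u := Quotient (isIsomorphicSetoid A)

/-- The isomorphism class of an object. -/
abbrev isoClass {A : Type u} [Category.{v} A] (M : A) : IsoClasses A := Quotient.mk _ M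

/-- The map on isomorphism classes induced by a functor. -/
def isoMap {A : Type u} [Category.{v} A] {B : Type u'} [Category.{v'} B] (F : A ⥤ B) :
    IsoClasses A → IsoClasses B :=
  Quotient.map F.obj fun _ _ ⟨e⟩ => ⟨F.mapIso e⟩

/-- An object of an additive category is indecomposable if it is nonzero and in any direct sum
decomposition one of the two summands is zero. (In an additive category a diagram `Y ⟶ M ⟵ Z` is a
coproduct if and only if it is part of a biproduct, see `isIndecomposable_iff`.) -/
def IsIndecomposable {A : Type u} [Category.{v} A] (M : A) : Prop :=
  ¬ IsZero M ∧ ∀ (Y Z : A) (i : Y ⟶ M) (j : Z ⟶ M),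
    Nonempty (IsColimit (BinaryCofan.mk i j)) → IsZero Y ∨ IsZero Z

/-- The isomorphism classes of the objects with property `P`. -/
def classes {A : Type u} [Category.{v} A] (P : A → Prop) : Set (IsoClasses A) :=
  {c | ∃ M, P M ∧ isoClass M = c}

theorem isIndecomposable_iff {A : Type u} [Category.{v} A] [Preadditive A]
    [HasBinaryBiproducts A] (M : A) : IsIndecomposable M ↔ Indecomposable M := by
  refine and_congr_right fun _ => ⟨fun h Y Z e => ?_, fun h Y Z i j ⟨hc⟩ => ?_⟩
  · refine h Y Z (biprod.inl ≫ e.inv) (biprod.inr ≫ e.inv) ⟨?_⟩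
    refine IsColimit.ofIsoColimit (BinaryBiproduct.isColimit Y Z) (BinaryCofan.ext e.symm ?_ ?_)
    · rfl
    · rfl
  · exact h Y Z (hc.coconePointUniqueUpToIso (BinaryBiproduct.isColimit Y Z))

/-- An epivalence is a full and dense functor which reflects isomorphisms. -/
structure IsEpivalence {A : Type u} [Category.{v} A] {B : Type u'} [Category.{v'} B]
    (F : A ⥤ B) : Prop where
  full : F.Full
  dense : F.EssSurj
  reflects : F.ReflectsIsomorphisms

end IsoClasses

section StableCategories
variable {A : Type u} [Category.{v} A] [Preadditive A]

/-- Two parallel morphisms are identified if their difference factors through an object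
with property `P`. -/
def stableRel (P : ObjectProperty A) : HomRel A := fun M N f g =>
  ∃ J, P J ∧ ∃ (u : M ⟶ J) (v : J ⟶ N), u ≫ v = f - g

/-- The quotient by the ideal of the morphisms which factor through an object with property `P`. -/
abbrev StableQuotient (P : ObjectProperty A) := CategoryTheory.Quotient (stableRel P)

/-- The quotient functor. -/
abbrev toStable (P : ObjectProperty A) : A ⥤ StableQuotient P := Quotient.functor (stableRel P)

/-- A conflation: `f` is a kernel of `g` and `g` is a cokernel of `f`. -/
structure IsConflation {L M N : A} (f : L ⟶ M) (g : M ⟶ N) : Prop where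
  w : f ≫ g = 0
  isKernel : Nonempty (IsLimit (KernelFork.ofι f w))
  isCokernel : Nonempty (IsColimit (CokernelCofork.ofπ g w))

/-- Let `P` define an extension-closed full subcategory of an abelian category. Its exact structure
consists of the conflations with all three terms in the subcategory. An object is
injective for this exact structure if morphisms into it extend along inflations. -/
def IsExactInjective (P : ObjectProperty A) (N : P.FullSubcategory) : Prop :=
  ∀ ⦃L M K : A⦄, P L → P M → P K → ∀ (f : L ⟶ M) (g : M ⟶ K), IsConflation f g →
    ∀ u : L ⟶ N.obj, ∃ v : M ⟶ N.obj, f ≫ v = u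

/-- Let `Mono` be the exact subcategory defined by `P`, let `K : Mono ⥤ D` be a functor, and let
`R M N` mean that `N` is a result of a construction applied to `M` which involves choices.

The property says that `K` factors through an epivalence `E` from the injectively stable category of
`Mono` to `D`, and that the isomorphism class of `N` depends only on that of `M` whenever `R M N`, so that
`R` defines a map `mimo` on isomorphism classes. It restricts to a bijection from the indecomposable
objects of `D` onto the indecomposable objects of `Mono` which are not injective, and this bijection is
inverse to the map induced by `Mono ⥤ (Mono modulo injectives)` followed by the epivalence `E`. -/
def IsInverseOfEpivalence (P : ObjectProperty A) {D : Type u'} [Category.{v'} D]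
    (K : P.FullSubcategory ⥤ D) (R : D → P.FullSubcategory → Prop) : Prop :=
  ∃ (E : StableQuotient (IsExactInjective P) ⥤ D)
    (mimo : IsoClasses D → IsoClasses P.FullSubcategory),
    toStable (IsExactInjective P) ⋙ E = K ∧ IsEpivalence E ∧
    (∀ M N, R M N → mimo (isoClass M) = isoClass N) ∧
    Set.BijOn mimo (classes IsIndecomposable)
      (classes fun N => IsIndecomposable N ∧ ¬ IsExactInjective P N) ∧
    Set.InvOn (isoMap (toStable (IsExactInjective P) ⋙ E)) mimo (classes IsIndecomposable)
      (classes fun N => IsIndecomposable N ∧ ¬ IsExactInjective P N)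

end StableCategories

section Injectives
variable (C : Type u) [Category.{v} C]

/-- The injective objects. -/
def injectives : ObjectProperty C := fun J => Injective J

variable {C} in
/-- An injective envelope is a left minimal monomorphism into an injective object. -/
structure IsInjectiveEnvelope {M I : C} (i : M ⟶ I) : Prop where
  mono : Mono i
  injective : Injective I
  minimal : ∀ g : I ⟶ I, i ≫ g = i → IsIso g

/-- Any object has an injective envelope. -/
def HasInjectiveEnvelopes : Prop := ∀ M : C, ∃ (I : C) (i : M ⟶ I), IsInjectiveEnvelope i

variable {C} in
/-- The object `M` has no nonzero injective summands. -/
def HasNoInjectiveSummand [Preadditive C] [HasBinaryBiproducts C] (M : C) : Prop :=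
  ∀ I N : C, Injective I → Nonempty (M ≅ N ⊞ I) → IsZero I

/-- Any object is the direct sum of an injective object and an object without nonzero injective
summands. -/
def HasMaximalInjectiveSummands [Preadditive C] [HasBinaryBiproducts C] : Prop :=
  ∀ M : C, ∃ M' I : C, Nonempty (M ≅ M' ⊞ I) ∧ Injective I ∧ HasNoInjectiveSummand M'

variable [Preadditive C] [HasFiniteCoproducts C]

/-- The injectively stable category `C̄`. -/
abbrev Stable := StableQuotient (injectives C)

variable {C}

lemma stable_add ⦃M N : C⦄ (f₁ f₂ g₁ g₂ : M ⟶ N)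
    (h₁ : stableRel (injectives C) f₁ f₂) (h₂ : stableRel (injectives C) g₁ g₂) :
    stableRel (injectives C) (f₁ + g₁) (f₂ + g₂) := by
  have := HasBinaryBiproducts.of_hasBinaryCoproducts (C := C)
  obtain ⟨J, hJ, u, v, h⟩ := h₁
  obtain ⟨J', hJ', u', v', h'⟩ := h₂
  have : Injective J := hJ
  have : Injective J' := hJ'
  exact ⟨J ⊞ J', (inferInstance : Injective (J ⊞ J')), biprod.lift u u', biprod.desc v v', by
    rw [biprod.lift_desc, h, h']; abel⟩

instance : Congruence (stableRel (injectives C)) where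
  comp_left := by
    rintro M N L f g g' ⟨J, hJ, u, v, h⟩
    exact ⟨J, hJ, f ≫ u, v, by rw [Category.assoc, h, Preadditive.comp_sub]⟩
  comp_right := by
    rintro M N L f f' g ⟨J, hJ, u, v, h⟩
    exact ⟨J, hJ, u, v ≫ g, by rw [← Category.assoc, h, Preadditive.sub_comp]⟩
  equivalence :=
    { refl := fun f => by
        have := HasFiniteBiproducts.of_hasFiniteCoproducts (C := C)
        have := hasZeroObject_of_hasFiniteBiproducts C
        exact ⟨⊥_ C, Injective.of_iso HasZeroObject.zeroIsoInitial inferInstance, 0, 0, by simp⟩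
      symm := by
        rintro f g ⟨J, hJ, u, v, h⟩
        exact ⟨J, hJ, -u, v, by rw [Preadditive.neg_comp, h, neg_sub]⟩
      trans := by
        rintro f g k ⟨J, hJ, u, v, h⟩ ⟨J', hJ', u', v', h'⟩
        have : Injective J := hJ
        have : Injective J' := hJ'
        have := HasBinaryBiproducts.of_hasBinaryCoproducts (C := C)
        exact ⟨J ⊞ J', (inferInstance : Injective (J ⊞ J')), biprod.lift u u', biprod.desc v v',
          by rw [biprod.lift_desc, h, h']; abel⟩ }

instance : Preadditive (Stable C) := Quotient.preadditive _ stable_add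

instance : (toStable (injectives C)).Additive := Quotient.functor_additive _ stable_add

instance : HasFiniteCoproducts (Stable C) where
  out n := by
    have := HasFiniteBiproducts.of_hasFiniteCoproducts (C := C)
    have := preservesCoproductsOfShape_of_preservesBiproductsOfShape (toStable (injectives C))
      (J := Fin n)
    have h (F : Fin n → Stable C) : HasCoproduct F := ⟨⟨_,
      isColimitOfHasCoproductOfPreservesColimit (toStable (injectives C)) fun i => (F i).as⟩⟩
    exact ⟨fun _ => hasColimit_of_iso Discrete.natIsoFunctor⟩

variable (X : C ⥤ C) [X.Additive] [X.PreservesInjectiveObjects]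

/-- The endofunctor of the injectively stable category induced by `X`. -/
def stableFunctor : Stable C ⥤ Stable C :=
  CategoryTheory.Quotient.lift _ (X ⋙ toStable (injectives C)) fun M N f g ⟨J, hJ, u, v, h⟩ =>
    CategoryTheory.Quotient.sound _ ⟨X.obj J, X.injective_obj_of_injective hJ,
      X.map u, X.map v, by rw [← X.map_comp, h, X.map_sub]⟩

instance : (stableFunctor X).Additive where
  map_add {M N} := by
    rintro ⟨f⟩ ⟨g⟩
    exact congrArg (toStable (injectives C)).map (X.map_add (f := f) (g := g))

instance [IsLocallyNilpotent X] : IsLocallyNilpotent (stableFunctor X) where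
  exists_isZero M := by
    obtain ⟨n, hn⟩ := IsLocallyNilpotent.exists_isZero (X := X) M.as
    have h : ∀ n, (power (stableFunctor X) n).obj M =
        (toStable (injectives C)).obj ((power X n).obj M.as) := by
      intro n
      induction n with
      | zero => rfl
      | succ n ih => exact congrArg (stableFunctor X).obj ih
    exact ⟨n, by rw [h]; exact Functor.map_isZero _ hn⟩

/-- The canonical functor from the category of `X`-algebras in `C` to the category of
algebras in the injectively stable category. -/
def toStableAlgebra : Endofunctor.Algebra X ⥤ Endofunctor.Algebra (stableFunctor X) where
  obj M := ⟨(toStable (injectives C)).obj M.a, (toStable (injectives C)).map M.str⟩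
  map {M N} φ :=
    { f := (toStable (injectives C)).map φ.f
      h := (congrArg (toStable (injectives C)).map φ.h : _) }

end Injectives

section Mono
variable {C : Type u} [Category.{v} C] [Abelian C] (X : C ⥤ C) [X.Additive]

/-- The monomorphism category `Mono(X)` is the full subcategory of the algebras with monic
structure map. -/
def monoAlgebras : ObjectProperty (Endofunctor.Algebra X) := fun M => Mono M.str

/-- The canonical functor `Mono(X) ⟶ C̄^{T(X)}`. -/
def monoToStable [X.PreservesInjectiveObjects] :
    (monoAlgebras X).FullSubcategory ⥤ Endofunctor.Algebra (stableFunctor X) :=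
  (monoAlgebras X).ι ⋙ toStableAlgebra X

variable [IsLocallyNilpotent X]

/-- The functor `f_!` with values in `Mono(X)`. -/
def freeMono : C ⥤ (monoAlgebras X).FullSubcategory :=
  (monoAlgebras X).lift (free X) fun M => mono_freeStr X M

variable {X}

/-- The choices in the Mimo-construction of `M`: an injective envelope `j` of the kernel of the
structure map of `M`, and an extension `e` of `j` to `X(M)`. -/
structure MimoChoice (M : Endofunctor.Algebra X) where
  J : C
  j : kernel M.str ⟶ J
  isInjectiveEnvelope : IsInjectiveEnvelope j
  e : X.obj M.a ⟶ J
  fac : kernel.ι M.str ≫ e = j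

/-- `N` is the result of the Mimo-construction of `M`, that is, the pushout of
`ι_M - f_!(h_M) : f_!(X(M)) ⟶ f_!(M)` along `f_!(e) : f_!(X(M)) ⟶ f_!(J)`. -/
def MimoChoice.IsMimo {M : Endofunctor.Algebra X} (c : MimoChoice M)
    (N : Endofunctor.Algebra X) : Prop :=
  ∃ (r : (free X).obj M.a ⟶ N) (s : (free X).obj c.J ⟶ N),
    IsPushout (freeIncl X M.a - (free X).map M.str) ((free X).map c.e) r s

/-- A lift of `M` to an algebra in `C` whose underlying object has no injective summands. -/
def IsReducedLift [X.PreservesInjectiveObjects] (M : Endofunctor.Algebra (stableFunctor X))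
    (L : Endofunctor.Algebra X) : Prop :=
  HasNoInjectiveSummand L.a ∧ Nonempty ((toStableAlgebra X).obj L ≅ M)

variable (X) in
/-- The two bijections which describe the indecomposable objects of `Mono(X)`. -/
structure IndecomposablesOfMono [X.PreservesInjectiveObjects] : Prop where
  /-- `I ↦ f_!(I)` is a bijection on isomorphism classes of indecomposable injectives. -/
  injective_bijection : Set.BijOn (isoMap (freeMono X))
    (classes fun I => IsIndecomposable I ∧ Injective I)
    (classes fun N => IsIndecomposable N ∧ IsExactInjective (monoAlgebras X) N)
  exists_lift : ∀ M, ∃ L : Endofunctor.Algebra X, IsReducedLift M L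
  nonempty_choice : ∀ L : Endofunctor.Algebra X, Nonempty (MimoChoice L)
  exists_mimo : ∀ {L : Endofunctor.Algebra X} (c : MimoChoice L), ∃ N, c.IsMimo N
  mimo_mem : ∀ {L : Endofunctor.Algebra X} (c : MimoChoice L) (N), c.IsMimo N → monoAlgebras X N
  /-- Choosing a lift without injective summands and applying the Mimo-construction is inverse to
  the bijection induced by the epivalence, and is independent of all choices. -/
  mimo_bijection : IsInverseOfEpivalence (monoAlgebras X) (monoToStable X) fun M N =>
    ∃ L, IsReducedLift M L ∧ ∃ c : MimoChoice L, c.IsMimo N.obj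

end Mono

section Quivers

/-- A finite acyclic quiver: there are finitely many vertices and arrows, and any path from a
vertex to itself is trivial. -/
class FiniteAcyclic (Q : Type u) [Quiver.{v} Q] : Prop where
  finite_vertices : Finite Q
  finite_arrows (i j : Q) : Finite (i ⟶ j)
  length_eq_zero (i : Q) (p : Quiver.Path i i) : p.length = 0

variable {Q : Type u} [Quiver.{v} Q] [FiniteAcyclic Q]

instance finite_arrows (i : Q) : Finite (Σ k : Q, (k ⟶ i)) := by
  have := FiniteAcyclic.finite_vertices (Q := Q)
  have := FiniteAcyclic.finite_arrows (Q := Q)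
  infer_instance

instance finite_paths (i j : Q) : Finite (Quiver.Path i j) := by
  have := FiniteAcyclic.finite_vertices (Q := Q)
  let r : Q → Q → Prop := fun i j => ∃ p : Quiver.Path i j, 0 < p.length
  have : IsTrans Q r := ⟨fun _ _ _ ⟨p, hp⟩ ⟨q, hq⟩ => ⟨p.comp q, by
    rw [Quiver.Path.length_comp]; omega⟩⟩
  have : Std.Irrefl r := ⟨fun i ⟨p, hp⟩ => hp.ne' (FiniteAcyclic.length_eq_zero i p)⟩
  have hr : WellFounded r := Finite.wellFounded_of_trans_of_irrefl r
  induction j using hr.induction with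
  | _ j ih =>
    have (a : Σ k : Q, (k ⟶ j)) : Finite (Quiver.Path i a.1) :=
      ih a.1 ⟨a.2.toPath, by simp [Quiver.Hom.toPath]⟩
    let g : Quiver.Path i j → Option (Σ a : (Σ k : Q, (k ⟶ j)), Quiver.Path i a.1) := fun p =>
      match p with
      | .nil => none
      | .cons q a => some ⟨⟨_, a⟩, q⟩
    refine Finite.of_injective g fun p q hpq => ?_
    cases p with
    | nil => cases q with
      | nil => rfl
      | cons q b => simp [g] at hpq
    | cons p a => cases q with
      | nil => simp [g] at hpq
      | cons q b =>
        simp only [g, Option.some.injEq, Sigma.mk.injEq] at hpq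
        obtain ⟨⟨rfl, hab⟩, hpq⟩ := hpq
        rw [eq_of_heq hab, eq_of_heq hpq]

instance finite_paths_to (j : Q) : Finite (Σ i : Q, Quiver.Path i j) := by
  have := FiniteAcyclic.finite_vertices (Q := Q)
  infer_instance

variable {B : Type u'} [Category.{v'} B]

/-- The object of a representation at a vertex. -/
abbrev vertex (F : Paths Q ⥤ B) (i : Q) : B := F.obj ((Paths.of Q).obj i)

/-- The morphism of a representation at an arrow. -/
abbrev arr (F : Paths Q ⥤ B) {i j : Q} (α : i ⟶ j) : vertex F i ⟶ vertex F j := F.map ((Paths.of Q).map α)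

section
variable [HasFiniteCoproducts B]

/-- `⨁_{α : k → i} F_k`, the sum over all arrows with target `i`. -/
abbrev source (F : Paths Q ⥤ B) (i : Q) : B := ∐ fun a : (Σ k : Q, (k ⟶ i)) => vertex F a.1

/-- The morphism `F_{i,in}` from the sum over all arrows with target `i` to `F_i`. -/
def into (F : Paths Q ⥤ B) (i : Q) : source F i ⟶ vertex F i := Sigma.desc fun a => arr F a.2

variable (Q B) in
/-- The monomorphism category `mono(Q, B)`. -/
def monoReps : ObjectProperty (Paths Q ⥤ B) := fun F => ∀ i : Q, Mono (into F i)

/-- The direct sum of the copies of `J` indexed by the paths from `i` to `k`. -/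
abbrev copies (i k : Q) (J : B) : B := ∐ fun _ : Quiver.Path i k => J

/-- The inclusion of the copy indexed by `p`. -/
abbrev copiesι {i k : Q} (J : B) (p : Quiver.Path i k) : J ⟶ copies i k J :=
  Sigma.ι (fun _ : Quiver.Path i k => J) p

/-- The morphism which maps the copy of `J` indexed by `p` identically to the copy indexed by
the extended path `p.comp q`. -/
def copiesMap (i : Q) (J : B) {k l : Q} (q : Quiver.Path k l) : copies i k J ⟶ copies i l J :=
  Limits.Sigma.desc fun p => copiesι J (p.comp q)

lemma ι_copiesMap (i : Q) (J : B) {k l : Q} (q : Quiver.Path k l) (p : Quiver.Path i k) :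
    copiesι J p ≫ copiesMap i J q = copiesι J (p.comp q) :=
  Sigma.ι_desc _ _

/-- The morphism induced by `g` on each copy. -/
def copiesMapHom (i k : Q) {J J' : B} (g : J ⟶ J') : copies i k J ⟶ copies i k J' :=
  Limits.Sigma.map fun _ => g

lemma ι_copiesMapHom {i k : Q} {J J' : B} (g : J ⟶ J') (p : Quiver.Path i k) :
    copiesι J p ≫ copiesMapHom i k g = g ≫ copiesι J' p :=
  Sigma.ι_map _ _

lemma copies_hom_ext {i k : Q} {J M : B} {f g : copies i k J ⟶ M}
    (h : ∀ p : Quiver.Path i k, copiesι J p ≫ f = copiesι J p ≫ g) : f = g :=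
  Sigma.hom_ext _ _ h

lemma copiesMap_nil (i k : Q) (J : B) : copiesMap i J (Quiver.Path.nil (a := k)) = 𝟙 _ :=
  copies_hom_ext fun p => by rw [ι_copiesMap, Category.comp_id, Quiver.Path.comp_nil]

lemma copiesMap_comp (i : Q) (J : B) {k l m : Q} (q : Quiver.Path k l) (q' : Quiver.Path l m) :
    copiesMap i J (q.comp q') = copiesMap i J q ≫ copiesMap i J q' :=
  copies_hom_ext fun p => by
    rw [ι_copiesMap, ← Category.assoc, ι_copiesMap, ι_copiesMap, Quiver.Path.comp_assoc]

lemma copiesMap_naturality (i : Q) {J J' : B} (g : J ⟶ J') {k l : Q} (q : Quiver.Path k l) :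
    copiesMap i J q ≫ copiesMapHom i l g = copiesMapHom i k g ≫ copiesMap i J' q :=
  copies_hom_ext fun p => by
    rw [← Category.assoc, ← Category.assoc, ι_copiesMap, ι_copiesMapHom, ι_copiesMapHom,
      Category.assoc, ι_copiesMap]

lemma copiesMapHom_comp (i k : Q) {J J' J'' : B} (g : J ⟶ J') (g' : J' ⟶ J'') :
    copiesMapHom i k (g ≫ g') = copiesMapHom i k g ≫ copiesMapHom i k g' :=
  copies_hom_ext fun p => by
    rw [ι_copiesMapHom, ← Category.assoc (copiesι _ p), ι_copiesMapHom, Category.assoc,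
      Category.assoc, ι_copiesMapHom]

/-- The functor which maps `J` to the representation `f_!(J(i))`. -/
def freeRep (i : Q) : B ⥤ (Paths Q ⥤ B) where
  obj J :=
    { obj := fun k => copies (Q := Q) i k J
      map := fun {k l} q => copiesMap (Q := Q) i J q
      map_id := fun k => copiesMap_nil (Q := Q) i k J
      map_comp := fun {k l m} q q' => copiesMap_comp (Q := Q) i J q q' }
  map {J J'} g :=
    { app := fun k => copiesMapHom (Q := Q) i k g
      naturality := fun k l q => copiesMap_naturality (Q := Q) i g q }
  map_id J := NatTrans.ext (funext fun k => copies_hom_ext (Q := Q) fun p =>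
    (ι_copiesMapHom (Q := Q) _ p).trans ((Category.id_comp _).trans (Category.comp_id _).symm))
  map_comp g g' := NatTrans.ext (funext fun k => copiesMapHom_comp (Q := Q) i k g g')

lemma freeRep_mem [Preadditive B] (i : Q) (J : B) : monoReps Q B ((freeRep i).obj J) := by
  intro l
  let ρ : copies i l J ⟶ source ((freeRep i).obj J) l := Limits.Sigma.desc fun p =>
    match p with
    | .nil => 0
    | .cons q α => copiesι J q ≫
        Sigma.ι (fun a : (Σ k : Q, (k ⟶ l)) => vertex ((freeRep i).obj J) a.1) ⟨_, α⟩
  have h (a : Σ k : Q, (k ⟶ l)) : copiesMap i J a.2.toPath ≫ ρ =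
      Sigma.ι (fun a : (Σ k : Q, (k ⟶ l)) => vertex ((freeRep i).obj J) a.1) a :=
    copies_hom_ext fun p => by
      rw [← Category.assoc, ι_copiesMap]
      exact Sigma.ι_desc _ _
  have : into ((freeRep i).obj J) l ≫ ρ = 𝟙 _ :=
    Sigma.hom_ext _ _ fun a => (Category.assoc _ _ _).symm.trans
      ((congrArg (· ≫ ρ) (Sigma.ι_desc (fun a : (Σ k : Q, (k ⟶ l)) =>
        arr ((freeRep i).obj J) a.2) a)).trans ((h a).trans (Category.comp_id _).symm))
  exact mono_of_mono_fac this

/-- The functor `J ↦ f_!(J(i))` with values in `mono(Q, B)`. -/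
def freeMonoRep [Preadditive B] (i : Q) : B ⥤ (monoReps Q B).FullSubcategory :=
  (monoReps Q B).lift (freeRep i) (freeRep_mem i)

end

section
variable [Abelian B]

/-- The choices in the Mimo-construction of a representation `F`: for each vertex an
injective envelope `j` of the kernel of `F_{i,in}`, and an extension `e` of `j`. -/
structure RepMimoChoice (F : Paths Q ⥤ B) where
  J : Q → B
  j : ∀ i, kernel (into F i) ⟶ J i
  isInjectiveEnvelope : ∀ i, IsInjectiveEnvelope (j i)
  e : ∀ i, source F i ⟶ J i
  fac : ∀ i, kernel.ι (into F i) ≫ e i = j i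

namespace RepMimoChoice
variable {F : Paths Q ⥤ B} (c : RepMimoChoice F)

/-- The sum of the objects `J_{s(p)}` over the paths `p` with target `i`. -/
abbrev pathSum (i : Q) : B := ∐ fun p : (Σ k : Q, Quiver.Path k i) => c.J p.1

/-- The inclusion of the summand indexed by the path `p`. -/
abbrev pathι {k i : Q} (p : Quiver.Path k i) : c.J k ⟶ c.pathSum i :=
  Sigma.ι (fun p : (Σ k : Q, Quiver.Path k i) => c.J p.1) ⟨k, p⟩

/-- The representation `Mimo F`. At the vertex `i` it is `F_i ⊕ ⨁_{p, t(p) = i} J_{s(p)}`. At an arrow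
`β : i → k` it is induced by `F_β`, by the restriction of `e_k` to the summand `F_i` indexed by `β`,
followed by the inclusion of the summand `J_k` indexed by the trivial path, and by the identities from
the summand indexed by `p` to the summand indexed by the extended path `p.cons β`. -/
def mimo : Paths Q ⥤ B := Paths.lift
  { obj := fun i => vertex F i ⊞ c.pathSum i
    map := fun {i k} β => biprod.desc
      (arr F β ≫ biprod.inl +
        (Sigma.ι (fun a : (Σ l : Q, (l ⟶ k)) => vertex F a.1) ⟨i, β⟩ ≫ c.e k ≫
          c.pathι Quiver.Path.nil) ≫ biprod.inr)
      (Limits.Sigma.desc (fun p => c.pathι (p.2.cons β)) ≫ biprod.inr) }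

end RepMimoChoice

variable (Q B)

/-- The canonical functor `rep(Q, B) ⟶ rep(Q, B̄)`. -/
def toStableReps : (Paths Q ⥤ B) ⥤ (Paths Q ⥤ Stable B) :=
  (Functor.whiskeringRight (Paths Q) B (Stable B)).obj (toStable (injectives B))

/-- The canonical functor `mono(Q, B) ⟶ rep(Q, B̄)`. -/
def monoToStableReps : (monoReps Q B).FullSubcategory ⥤ (Paths Q ⥤ Stable B) :=
  (monoReps Q B).ι ⋙ toStableReps Q B

variable {Q B}

/-- A lift of `M` to a representation in `B` all of whose objects have no
injective summands. -/
def IsReducedRepLift (M : Paths Q ⥤ Stable B) (L : Paths Q ⥤ B) : Prop :=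
  (∀ i : Q, HasNoInjectiveSummand (vertex L i)) ∧ Nonempty ((toStableReps Q B).obj L ≅ M)

variable (Q B) in
/-- The two bijections which describe the indecomposable objects of `mono(Q, B)`. -/
structure IndecomposablesOfMonoReps : Prop where
  /-- `(I, i) ↦ f_!(I(i))` is a bijection from pairs of an indecomposable injective object of `B` and
  a vertex to the indecomposable injectives of `mono(Q, B)`. -/
  injective_bijection : Set.BijOn (fun x : IsoClasses B × Q => isoMap (freeMonoRep x.2) x.1)
    ((classes fun I => IsIndecomposable I ∧ Injective I) ×ˢ Set.univ)
    (classes fun N => IsIndecomposable N ∧ IsExactInjective (monoReps Q B) N)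
  exists_lift : ∀ M, ∃ L : Paths Q ⥤ B, IsReducedRepLift M L
  nonempty_choice : ∀ L : Paths Q ⥤ B, Nonempty (RepMimoChoice L)
  mimo_mem : ∀ {L : Paths Q ⥤ B} (c : RepMimoChoice L), monoReps Q B c.mimo
  /-- Choosing a lift without injective summands and applying the Mimo-construction is inverse to
  the bijection induced by the epivalence, and is independent of all choices. -/
  mimo_bijection : IsInverseOfEpivalence (monoReps Q B) (monoToStableReps Q B) fun M N =>
    ∃ L, IsReducedRepLift M L ∧ ∃ c : RepMimoChoice L, Nonempty (c.mimo ≅ N.obj)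

end

end Quivers

section ArtinAlgebras

/-- An Artin algebra is right noetherian. -/
lemma isNoetherianRing_op (k : Type u) [CommRing k] [IsArtinianRing k] (Λ : Type u') [Ring Λ]
    [Algebra k Λ] [Module.Finite k Λ] : IsNoetherianRing Λᵐᵒᵖ :=
  isNoetherian_of_tower k (inferInstance : IsNoetherian k Λᵐᵒᵖ)

end ArtinAlgebras
end
end Mimo

/-! A formal part is separated from the study of Mono(X). Let K be the functor from Mono(X) to the
algebras over the stable category. It is full, and although its kernel ideal need not consist of
morphisms through exact injectives, any composite of two morphisms in the kernel does factor through
one. That suffices: if K(φ) is invertible with lifted inverse ψ and n = 1 - φψ, then n² vanishes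
modulo injectives, and ψ(1 + n) is a right inverse of φ there. Call an object reduced if it has no
nonzero exact injective retract. Endomorphisms of a reduced object which factor through injectives
lie in the radical, so K reflects isomorphisms between reduced objects. If every object of the
target comes from a reduced object, that object is unique up to isomorphism, and indecomposables
correspond to the non-injective indecomposables. `IsStablyEpivalent` lists what is needed, and
`IsStablyEpivalent.isInverseOfEpivalence` draws the conclusion.

The concrete part rests on f_!(M) = M ⊕ X(f_!(M)) and on nilpotence. Nilpotence gives two Nakayama
lemmas, `epi_of_generates` and `mono_of_ker_le`, so morphisms can be tested modulo the images of the
structure maps. Hence the exact injectives are the f_!(I) with I injective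
(`HasInjectiveEnvelopes.exists_iso_free`). Morphisms into f_!(J) are extended degree by degree, with
prescribed failure to respect the structure maps (`IsRelativelyExtendable.exists_extension`). This
one construction yields the injectivity of f_!(J), the fullness of K and the factorization of
composites.

The pushout defining Mimo is L ⊕ f_!(J) with a triangular structure map whose off-diagonal entry is
e (`isPushout_mimoAlgebra`). The structure map is monic because h and e are jointly monic. The
projection to L is stably invertible because f_!(J) is injective in C. The object is reduced because
L has no injective summands and j is left minimal (`HasInjectiveEnvelopes.isReduced_extension`).

Representations of Q are algebras over the arrow functor on families of objects; its n-th power is a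
sum over paths of length n, hence it is nilpotent. Injectivity and reducedness in mono(Q, B) are
transported along this equivalence, whereas assertions about rep(Q, B̄) are checked vertex by
vertex. Over an Artin algebra, injective envelopes come from Zorn's lemma and stay finitely
generated by the socle filtration. Maximal injective summands exist because, over a noetherian ring,
unions of chains of injective submodules are injective. -/

open scoped ZeroObject

namespace Mimo

noncomputable section

/-! ### Decompositions, idempotents and invertibility of 1 - ab -/

section Preadditive
variable {A : Type u} [Category.{v} A] [Preadditive A]

/-- In a preadditive category a binary coproduct is the same as a diagram with projections. -/
theorem nonempty_isColimit_binaryCofan_iff {Y Z M : A} {i : Y ⟶ M} {j : Z ⟶ M} :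
    Nonempty (IsColimit (BinaryCofan.mk i j)) ↔ ∃ (p : M ⟶ Y) (q : M ⟶ Z),
      i ≫ p = 𝟙 Y ∧ i ≫ q = 0 ∧ j ≫ p = 0 ∧ j ≫ q = 𝟙 Z ∧ p ≫ i + q ≫ j = 𝟙 M := by
  constructor
  · rintro ⟨h⟩
    obtain ⟨p, hp₁, hp₂⟩ := BinaryCofan.IsColimit.desc' h (𝟙 Y) 0
    obtain ⟨q, hq₁, hq₂⟩ := BinaryCofan.IsColimit.desc' h 0 (𝟙 Z)
    change M ⟶ Y at p
    change M ⟶ Z at q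
    replace hp₁ : i ≫ p = 𝟙 Y := hp₁
    replace hp₂ : j ≫ p = 0 := hp₂
    replace hq₁ : i ≫ q = 0 := hq₁
    replace hq₂ : j ≫ q = 𝟙 Z := hq₂
    refine ⟨p, q, hp₁, hq₁, hp₂, hq₂, BinaryCofan.IsColimit.hom_ext h ?_ ?_⟩
    · change i ≫ (p ≫ i + q ≫ j) = i ≫ 𝟙 M
      rw [Preadditive.comp_add, reassoc_of% hp₁, reassoc_of% hq₁]
      simp
    · change j ≫ (p ≫ i + q ≫ j) = j ≫ 𝟙 M
      rw [Preadditive.comp_add, reassoc_of% hp₂, reassoc_of% hq₂]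
      simp
  · rintro ⟨p, q, h₁, h₂, h₃, h₄, h₅⟩
    refine ⟨BinaryCofan.IsColimit.mk _ (fun f g => p ≫ f + q ≫ g) (fun f g => ?_) (fun f g => ?_)
      fun f g m hm₁ hm₂ => ?_⟩
    · change i ≫ (p ≫ f + q ≫ g) = f
      rw [Preadditive.comp_add, reassoc_of% h₁, reassoc_of% h₂]
      simp
    · change j ≫ (p ≫ f + q ≫ g) = g
      rw [Preadditive.comp_add, reassoc_of% h₃, reassoc_of% h₄]
      simp
    · change M ⟶ _ at m
      replace hm₁ : i ≫ m = f := hm₁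
      replace hm₂ : j ≫ m = g := hm₂
      rw [← hm₁, ← hm₂]
      change m = p ≫ i ≫ m + q ≫ j ≫ m
      rw [← Category.assoc, ← Category.assoc, ← Preadditive.add_comp, h₅, Category.id_comp]

/-- If r inverts 1 - ab, then 1 + b r a inverts 1 - ba. -/
theorem isIso_one_sub_comp_swap {M N : A} (a : M ⟶ N) (b : N ⟶ M) [IsIso (𝟙 M - a ≫ b)] :
    IsIso (𝟙 N - b ≫ a) := by
  have h₁ := congrArg (fun t => b ≫ t ≫ a) (IsIso.hom_inv_id (𝟙 M - a ≫ b))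
  have h₂ := congrArg (fun t => b ≫ t ≫ a) (IsIso.inv_hom_id (𝟙 M - a ≫ b))
  set r := inv (𝟙 M - a ≫ b)
  simp only [Preadditive.sub_comp, Preadditive.comp_sub, Category.id_comp, Category.comp_id,
    Category.assoc] at h₁ h₂
  refine ⟨𝟙 N + b ≫ r ≫ a, ?_, ?_⟩
  · simp only [Preadditive.sub_comp, Preadditive.comp_add, Category.id_comp, Category.comp_id,
      Category.assoc]
    linear_combination (norm := abel) h₁
  · simp only [Preadditive.comp_sub, Preadditive.add_comp, Category.id_comp, Category.comp_id,
      Category.assoc]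
    linear_combination (norm := abel) h₂

/-- A split monomorphism of the form `1 - ab` is invertible if its right inverses of the form
`1 - a'b` are split monomorphisms as well. -/
theorem isIso_one_sub_of_forall {M N : A} (b : N ⟶ M)
    (H : ∀ a : M ⟶ N, ∃ r : N ⟶ N, (𝟙 N - b ≫ a) ≫ r = 𝟙 N) (a : M ⟶ N) :
    IsIso (𝟙 M - a ≫ b) := by
  -- With (1 - ba) r = 1, the morphism 1 + a r b is a right inverse of 1 - ab. It has the same form,
  -- with -a r in place of a, so it has a right inverse as well and is therefore a two-sided
  -- inverse.
  have key (a : M ⟶ N) : ∃ a' : M ⟶ N, (𝟙 M - a ≫ b) ≫ (𝟙 M - a' ≫ b) = 𝟙 M := by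
    obtain ⟨r, hr⟩ := H a
    have hr' := congrArg (fun t => a ≫ t ≫ b) hr
    refine ⟨- a ≫ r, ?_⟩
    simp only [Preadditive.neg_comp, sub_neg_eq_add, Preadditive.sub_comp, Preadditive.comp_add,
      Preadditive.comp_sub, Category.comp_id, Category.id_comp, Category.assoc] at hr' ⊢
    linear_combination (norm := abel) hr'
  obtain ⟨a', h⟩ := key a
  obtain ⟨a'', h'⟩ := key a'
  have : 𝟙 M - a'' ≫ b = 𝟙 M - a ≫ b := by
    have h₁ := congrArg (fun t => t ≫ (𝟙 M - a'' ≫ b)) h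
    have h₂ := congrArg (fun t => (𝟙 M - a ≫ b) ≫ t) h'
    simp only [Category.assoc, Category.id_comp, Category.comp_id] at h₁ h₂
    exact h₁.symm.trans h₂
  rw [this] at h'
  exact ⟨_, h, h'⟩

/-- A decomposition of M yields the idempotent p ≫ i. Together with its converse
`IsIndecomposable.idempotent`, this allows indecomposability to be compared by means of
endomorphisms. -/
theorem isIndecomposable_of_idempotents {M : A} (h₀ : ¬ IsZero M)
    (h : ∀ e : M ⟶ M, e ≫ e = e → e = 0 ∨ e = 𝟙 M) : IsIndecomposable M := by
  refine ⟨h₀, fun Y Z i j hij => ?_⟩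
  obtain ⟨p, q, h₁, h₂, h₃, h₄, h₅⟩ := nonempty_isColimit_binaryCofan_iff.1 hij
  rcases h (p ≫ i) (by simp [reassoc_of% h₁]) with h | h
  · left
    rw [IsZero.iff_id_eq_zero, ← h₁, ← Category.comp_id (i ≫ p), ← h₁]
    simp [reassoc_of% h]
  · right
    have : q ≫ j = 0 := by rwa [h, add_eq_left] at h₅
    rw [IsZero.iff_id_eq_zero, ← h₄, ← Category.comp_id (j ≫ q), ← h₄]
    simp [reassoc_of% this]

theorem IsIndecomposable.idempotent {M : A} [IsIdempotentComplete A] (hM : IsIndecomposable M)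
    (e : M ⟶ M) (he : e ≫ e = e) : e = 0 ∨ e = 𝟙 M := by
  obtain ⟨Y, i, p, h₁, h₂⟩ := IsIdempotentComplete.idempotents_split M e he
  obtain ⟨Z, j, q, h₃, h₄⟩ := IsIdempotentComplete.idempotents_split M (𝟙 M - e) (by simp [he])
  have hi : i ≫ e = i := by rw [← h₂, reassoc_of% h₁]
  have hp : e ≫ p = p := by rw [← h₂, Category.assoc, h₁, Category.comp_id]
  have hj : j ≫ e = 0 := by
    have : j ≫ (𝟙 M - e) = j := by rw [← h₄, reassoc_of% h₃]
    simpa using this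
  have hq : e ≫ q = 0 := by
    have : (𝟙 M - e) ≫ q = q := by rw [← h₄, Category.assoc, h₃, Category.comp_id]
    simpa using this
  rcases hM.2 Y Z i j (nonempty_isColimit_binaryCofan_iff.2 ⟨p, q, h₁, by rw [← hi, Category.assoc, hq,
    comp_zero], by rw [← hp, reassoc_of% hj, zero_comp], h₃, by rw [h₂, h₄]; simp⟩) with h | h
  · left
    rw [← h₂, h.eq_of_src i 0, comp_zero]
  · right
    rw [h.eq_of_src j 0, comp_zero] at h₄
    exact (sub_eq_zero.1 h₄.symm).symm

theorem IsIndecomposable.of_iso {A : Type u} [Category.{v} A] {M N : A} (e : M ≅ N)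
    (hM : IsIndecomposable M) : IsIndecomposable N := by
  refine ⟨fun h => hM.1 (h.of_iso e), fun Y Z i j ⟨h⟩ => hM.2 Y Z (i ≫ e.inv) (j ≫ e.inv) ⟨?_⟩⟩
  refine IsColimit.ofIsoColimit h (BinaryCofan.ext e.symm ?_ ?_)
  · rfl
  · rfl

theorem IsIndecomposable.isIso_of_retract {M N : A} (hM : IsIndecomposable M) (hN : ¬ IsZero N)
    {i : N ⟶ M}
    (hc : ∃ (Z : A) (z : Z ⟶ M), Nonempty (IsColimit (BinaryCofan.mk i z))) : IsIso i := by
  obtain ⟨Z, z, hz⟩ := hc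
  rcases hM.2 _ _ i z hz with h' | h'
  · exact absurd h' hN
  · obtain ⟨p, q, h₁, h₂, h₃, h₄, h₅⟩ := nonempty_isColimit_binaryCofan_iff.1 hz
    rw [h'.eq_of_tgt q 0, zero_comp, add_zero] at h₅
    exact ⟨p, h₁, h₅⟩

end Preadditive

/-! ### The formal argument: full functors, injectives and reduced objects -/

section Framework
variable {A : Type u} [Category.{v} A] [Preadditive A] {P : ObjectProperty A}

theorem IsExactInjective.of_retract {M N : P.FullSubcategory} (hM : IsExactInjective P M)
    (i : N ⟶ M) (r : M ⟶ N) (h : i ≫ r = 𝟙 N) : IsExactInjective P N := by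
  intro L M' K hL hM' hK f g hfg u
  obtain ⟨v, hv⟩ := hM hL hM' hK f g hfg (u ≫ i.hom)
  have h' : i.hom ≫ r.hom = 𝟙 _ := congrArg (fun t => t.hom) h
  exact ⟨v ≫ r.hom, by rw [reassoc_of% hv, h', Category.comp_id]⟩

variable (P) in
/-- An object of an exact category is reduced if all its injective retracts are zero. -/
def IsReduced (N : P.FullSubcategory) : Prop :=
  ∀ J, IsExactInjective P J → ∀ (i : J ⟶ N) (r : N ⟶ J), i ≫ r = 𝟙 J → IsZero J

/-- Formal properties of a functor `K` which imply that it induces an epivalence on the injectively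
stable category, and which relate indecomposable objects. -/
structure IsStablyEpivalent {D : Type u'} [Category.{v'} D] [Preadditive D]
    (K : P.FullSubcategory ⥤ D) (R : D → P.FullSubcategory → Prop) : Prop where
  additive : K.Additive
  full : K.Full
  isZero_of_injective (N) : IsExactInjective P N → IsZero (K.obj N)
  -- The kernel ideal of K itself need not consist of morphisms through injectives; only its square
  -- has to.
  factors {N N' N'' : P.FullSubcategory} (θ : N ⟶ N') (θ' : N' ⟶ N'') : K.map θ = 0 → K.map θ' = 0 →
    ∃ J, IsExactInjective P J ∧ ∃ (u : N ⟶ J) (v : J ⟶ N''), u ≫ v = θ ≫ θ'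
  isIso_one_sub (N) : IsReduced P N → ∀ J, IsExactInjective P J → ∀ (a : N ⟶ J) (b : J ⟶ N),
    IsIso (𝟙 N - a ≫ b)
  exists_complement (J N : P.FullSubcategory) (i : J ⟶ N) (r : N ⟶ J) : i ≫ r = 𝟙 J →
    ∃ (Z : P.FullSubcategory) (z : Z ⟶ N), Nonempty (IsColimit (BinaryCofan.mk i z))
  isReduced (M N) : R M N → IsReduced P N
  nonempty_iso (M N) : R M N → Nonempty (K.obj N ≅ M)
  exists_rel (M) : ∃ N, R M N

namespace IsStablyEpivalent
variable {D : Type u'} [Category.{v'} D] [Preadditive D]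
  {K : P.FullSubcategory ⥤ D} {R : D → P.FullSubcategory → Prop} (H : IsStablyEpivalent K R)
include H

theorem map_eq {M N : P.FullSubcategory} (f g : M ⟶ N)
    (h : stableRel (IsExactInjective P) f g) : K.map f = K.map g := by
  have := H.additive
  obtain ⟨J, hJ, u, v, h⟩ := h
  rw [← sub_eq_zero, ← K.map_sub, ← h, K.map_comp,
    (H.isZero_of_injective J hJ).eq_of_tgt (K.map u) 0, zero_comp]

/-- A morphism which becomes invertible is invertible up to injectives. -/
theorem exists_inverse {N N' : P.FullSubcategory} (φ : N ⟶ N') [IsIso (K.map φ)] :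
    ∃ ψ ψ' : N' ⟶ N, stableRel (IsExactInjective P) (𝟙 N) (φ ≫ ψ) ∧
      stableRel (IsExactInjective P) (𝟙 N') (ψ' ≫ φ) := by
  have := H.additive
  have := H.full
  obtain ⟨ψ, hψ⟩ := K.map_surjective (inv (K.map φ))
  have h₁ : K.map (𝟙 N - φ ≫ ψ) = 0 := by simp [hψ]
  have h₂ : K.map (𝟙 N' - ψ ≫ φ) = 0 := by simp [hψ]
  obtain ⟨J, hJ, u, v, h⟩ := H.factors _ _ h₁ h₁
  obtain ⟨J', hJ', u', v', h'⟩ := H.factors _ _ h₂ h₂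
  -- For n = 1 - φψ one has φψ(1 + n) = (1 - n)(1 + n) = 1 - n², and n² factors through an
  -- injective. The left inverse arises in the same way from 1 - ψφ.
  refine ⟨ψ ≫ (𝟙 N + (𝟙 N - φ ≫ ψ)), (𝟙 N' + (𝟙 N' - ψ ≫ φ)) ≫ ψ, ⟨J, hJ, u, v, ?_⟩,
    ⟨J', hJ', u', v', ?_⟩⟩
  · rw [h]; simp; abel
  · rw [h']; simp; abel

/-- Modulo injectives φ has inverses on both sides. On reduced objects the error terms 1 - uv are
honestly invertible, so φ is a split monomorphism and an epimorphism. -/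
theorem isIso_of_isReduced {N N' : P.FullSubcategory} (hN : IsReduced P N) (hN' : IsReduced P N')
    (φ : N ⟶ N') [IsIso (K.map φ)] : IsIso φ := by
  obtain ⟨ψ, ψ', ⟨J, hJ, u, v, h⟩, ⟨J', hJ', u', v', h'⟩⟩ := H.exists_inverse φ
  have h₁ := H.isIso_one_sub N hN J hJ u v
  have h₂ := H.isIso_one_sub N' hN' J' hJ' u' v'
  rw [h, sub_sub_cancel] at h₁
  rw [h', sub_sub_cancel] at h₂
  have : IsSplitMono φ := ⟨⟨ψ ≫ inv (φ ≫ ψ), by rw [← Category.assoc, IsIso.hom_inv_id]⟩⟩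
  have : Epi φ := epi_of_epi ψ' φ
  exact isIso_of_epi_of_isSplitMono φ

theorem nonempty_iso_of_isReduced {N N' : P.FullSubcategory} (hN : IsReduced P N)
    (hN' : IsReduced P N') (e : K.obj N ≅ K.obj N') : ∃ e' : N ≅ N', K.map e'.hom = e.hom := by
  have := H.full
  obtain ⟨φ, hφ⟩ := K.map_surjective e.hom
  have : IsIso (K.map φ) := by rw [hφ]; infer_instance
  have := H.isIso_of_isReduced hN hN' φ
  exact ⟨asIso φ, hφ⟩

/-- An exchange argument: an injective retract J of N ⊞ N' gives i₁r₁ + i₂r₂ = 1 on J. As N is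
reduced, 1 - r₁i₁ is invertible, hence so is 1 - i₁r₁ = i₂r₂. Thus J is a retract of N' and
vanishes. -/
theorem isReduced_biprod [HasBinaryBiproducts P.FullSubcategory] {N N' : P.FullSubcategory}
    (hN : IsReduced P N) (hN' : IsReduced P N') : IsReduced P (N ⊞ N') := by
  intro J hJ i r h
  have h₁ := H.isIso_one_sub N hN J hJ (biprod.inl ≫ r) (i ≫ biprod.fst)
  have h₂ := isIso_one_sub_comp_swap (biprod.inl ≫ r) (i ≫ biprod.fst)
  have h₃ : 𝟙 J - (i ≫ biprod.fst) ≫ biprod.inl ≫ r = (i ≫ biprod.snd) ≫ biprod.inr ≫ r := by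
    rw [sub_eq_iff_eq_add', ← h]
    conv_lhs => rw [← Category.id_comp r, ← biprod.total]
    simp only [Preadditive.add_comp, Preadditive.comp_add, Category.assoc]
  rw [h₃] at h₂
  refine hN' J hJ (i ≫ biprod.snd) ((biprod.inr ≫ r) ≫ inv ((i ≫ biprod.snd) ≫ biprod.inr ≫ r)) ?_
  rw [← Category.assoc, IsIso.hom_inv_id]

theorem isReduced_of_isIndecomposable {N : P.FullSubcategory} (h : IsIndecomposable N)
    (hN : ¬ IsExactInjective P N) : IsReduced P N := by
  intro J hJ i r hir
  by_contra h₀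
  have := h.isIso_of_retract h₀ (H.exists_complement J N i r hir)
  exact hN (hJ.of_retract (inv i) i (IsIso.inv_hom_id i))

/-- The identity is killed by K, so its square, again the identity, factors through an injective. -/
theorem isExactInjective_of_isZero {N : P.FullSubcategory} (h : IsZero (K.obj N)) :
    IsExactInjective P N := by
  have h₀ : K.map (𝟙 N) = 0 := h.eq_of_src _ _
  obtain ⟨J, hJ, u, v, h⟩ := H.factors (𝟙 N) (𝟙 N) h₀ h₀
  exact hJ.of_retract u v (by rw [h, Category.comp_id])

/-- A decomposition of K(N) lifts to a morphism from a sum of two reduced objects to N. It becomes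
invertible under K and both sides are reduced, so it already is an isomorphism and one summand
vanishes. -/
theorem isIndecomposable_obj [HasBinaryBiproducts P.FullSubcategory] {N : P.FullSubcategory}
    (h : IsIndecomposable N) (hN : ¬ IsExactInjective P N) : IsIndecomposable (K.obj N) := by
  refine ⟨fun h₀ => hN (H.isExactInjective_of_isZero h₀), fun Y Z i j hij => ?_⟩
  have := H.additive
  have := H.full
  obtain ⟨p, q, h₁, h₂, h₃, h₄, h₅⟩ := nonempty_isColimit_binaryCofan_iff.1 hij
  obtain ⟨Y', hY⟩ := H.exists_rel Y
  obtain ⟨Z', hZ⟩ := H.exists_rel Z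
  obtain ⟨y⟩ := H.nonempty_iso _ _ hY
  obtain ⟨z⟩ := H.nonempty_iso _ _ hZ
  obtain ⟨f, hf⟩ := K.map_surjective (y.hom ≫ i)
  obtain ⟨g, hg⟩ := K.map_surjective (z.hom ≫ j)
  have h₆ : IsIso (K.map (biprod.desc f g)) := by
    refine ⟨p ≫ y.inv ≫ K.map biprod.inl + q ≫ z.inv ≫ K.map biprod.inr, ?_, ?_⟩
    · rw [biprod.desc_eq, K.map_add, K.map_comp, K.map_comp, hf, hg]
      simp only [Preadditive.add_comp, Preadditive.comp_add, Category.assoc, reassoc_of% h₁,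
        reassoc_of% h₂, reassoc_of% h₃, reassoc_of% h₄, zero_comp, comp_zero, add_zero, zero_add,
        Iso.hom_inv_id_assoc, ← K.map_comp]
      rw [← K.map_add, biprod.total, K.map_id]
    · simp only [Preadditive.add_comp, Category.assoc, ← K.map_comp, biprod.inl_desc,
        biprod.inr_desc, hf, hg, Iso.inv_hom_id_assoc, h₅]
  have := H.isIso_of_isReduced (H.isReduced_biprod (H.isReduced _ _ hY) (H.isReduced _ _ hZ))
    (H.isReduced_of_isIndecomposable h hN) (biprod.desc f g)
  have hfg : f ≫ inv (biprod.desc f g) = biprod.inl ∧ g ≫ inv (biprod.desc f g) = biprod.inr := by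
    simp [IsIso.comp_inv_eq]
  have hc : Nonempty (IsColimit (BinaryCofan.mk f g)) := by
    refine nonempty_isColimit_binaryCofan_iff.2
      ⟨inv (biprod.desc f g) ≫ biprod.fst, inv (biprod.desc f g) ≫ biprod.snd, ?_, ?_, ?_, ?_, ?_⟩
    · rw [← Category.assoc, hfg.1, biprod.inl_fst]
    · rw [← Category.assoc, hfg.1, biprod.inl_snd]
    · rw [← Category.assoc, hfg.2, biprod.inr_fst]
    · rw [← Category.assoc, hfg.2, biprod.inr_snd]
    · rw [Category.assoc, Category.assoc, ← Preadditive.comp_add, IsIso.inv_comp_eq,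
        Category.comp_id]
      exact biprod.desc_eq.symm
  rcases h.2 Y' Z' f g hc with h | h
  · exact Or.inl ((K.map_isZero h).of_iso y.symm)
  · exact Or.inr ((K.map_isZero h).of_iso z.symm)

/-- One summand in a decomposition of N has zero image in D. It is then an injective retract of a
reduced object, hence zero. -/
theorem isIndecomposable_of_rel {M : D} {N : P.FullSubcategory} (h : R M N)
    (hM : IsIndecomposable M) : IsIndecomposable N ∧ ¬ IsExactInjective P N := by
  have := H.additive
  obtain ⟨e⟩ := H.nonempty_iso _ _ h
  refine ⟨⟨fun h₀ => hM.1 ((K.map_isZero h₀).of_iso e.symm), fun Y Z i j hij => ?_⟩, fun h₀ =>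
    hM.1 ((H.isZero_of_injective _ h₀).of_iso e.symm)⟩
  obtain ⟨p, q, h₁, h₂, h₃, h₄, h₅⟩ := nonempty_isColimit_binaryCofan_iff.1 hij
  have key : IsZero (K.obj Y) ∨ IsZero (K.obj Z) := by
    refine (hM.of_iso e.symm).2 _ _ (K.map i) (K.map j) (nonempty_isColimit_binaryCofan_iff.2
      ⟨K.map p, K.map q, ?_, ?_, ?_, ?_, ?_⟩)
    all_goals simp only [← K.map_comp, ← K.map_add, h₁, h₂, h₃, h₄, h₅, K.map_id, K.map_zero]
  rcases key with h₀ | h₀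
  · exact Or.inl (H.isReduced _ _ h _ (H.isExactInjective_of_isZero h₀) i p h₁)
  · exact Or.inr (H.isReduced _ _ h _ (H.isExactInjective_of_isZero h₀) j q h₄)

/-- Reduced objects with isomorphic images are isomorphic, so R descends to a map on isomorphism
classes. Non-injective indecomposables are reduced, which makes the two maps mutually inverse. -/
theorem isInverseOfEpivalence [HasBinaryBiproducts P.FullSubcategory] :
    IsInverseOfEpivalence P K R := by
  have := H.additive
  have := H.full
  let E : StableQuotient (IsExactInjective P) ⥤ D :=
    CategoryTheory.Quotient.lift _ K fun _ _ f g h => H.map_eq f g h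
  have hE : toStable (IsExactInjective P) ⋙ E = K := Quotient.lift_spec _ _ _
  have hR {M M' N N'} (h : R M N) (h' : R M' N') (e : M ≅ M') : Nonempty (N ≅ N') := by
    obtain ⟨e₁⟩ := H.nonempty_iso _ _ h
    obtain ⟨e₂⟩ := H.nonempty_iso _ _ h'
    obtain ⟨e', -⟩ := H.nonempty_iso_of_isReduced (H.isReduced _ _ h) (H.isReduced _ _ h')
      (e₁ ≪≫ e ≪≫ e₂.symm)
    exact ⟨e'⟩
  let mimo : IsoClasses D → IsoClasses P.FullSubcategory :=
    Quotient.map (fun M => (H.exists_rel M).choose) fun M M' ⟨e⟩ =>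
      hR (H.exists_rel M).choose_spec (H.exists_rel M').choose_spec e
  have hmimo (M N) (h : R M N) : mimo (isoClass M) = isoClass N :=
    Quotient.sound (hR (H.exists_rel M).choose_spec h (Iso.refl M))
  have hleft : ∀ c ∈ classes (IsIndecomposable (A := D)), isoMap K (mimo c) = c := by
    rintro _ ⟨M, -, rfl⟩
    obtain ⟨N, hN⟩ := H.exists_rel M
    rw [hmimo M N hN]
    exact Quotient.sound (H.nonempty_iso _ _ hN)
  have hright : ∀ c ∈ classes (fun N => IsIndecomposable N ∧ ¬ IsExactInjective P N),
      mimo (isoMap K c) = c := by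
    rintro _ ⟨N, hN, rfl⟩
    obtain ⟨N', hN'⟩ := H.exists_rel (K.obj N)
    obtain ⟨e⟩ := H.nonempty_iso _ _ hN'
    obtain ⟨e', -⟩ := H.nonempty_iso_of_isReduced (H.isReduced _ _ hN')
      (H.isReduced_of_isIndecomposable hN.1 hN.2) e
    exact (hmimo _ _ hN').trans (Quotient.sound ⟨e'⟩)
  have hmaps : Set.MapsTo mimo (classes IsIndecomposable)
      (classes fun N => IsIndecomposable N ∧ ¬ IsExactInjective P N) := by
    rintro _ ⟨M, hM, rfl⟩
    obtain ⟨N, hN⟩ := H.exists_rel M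
    exact ⟨N, H.isIndecomposable_of_rel hN hM, (hmimo M N hN).symm⟩
  have hmaps' : Set.MapsTo (isoMap K)
      (classes fun N => IsIndecomposable N ∧ ¬ IsExactInjective P N) (classes IsIndecomposable) := by
    rintro _ ⟨N, hN, rfl⟩
    exact ⟨K.obj N, H.isIndecomposable_obj hN.1 hN.2, rfl⟩
  have hinv : Set.InvOn (isoMap K) mimo (classes IsIndecomposable)
      (classes fun N => IsIndecomposable N ∧ ¬ IsExactInjective P N) := ⟨hleft, hright⟩
  refine ⟨E, mimo, hE, ⟨⟨?_⟩, ⟨fun M => ?_⟩, ⟨?_⟩⟩, hmimo, hinv.bijOn hmaps hmaps', ?_⟩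
  · intro M N f
    obtain ⟨φ, hφ⟩ := K.map_surjective (X := M.as) (Y := N.as) f
    exact ⟨(toStable (IsExactInjective P)).map φ, hφ⟩
  · obtain ⟨N, hN⟩ := H.exists_rel M
    exact ⟨(toStable (IsExactInjective P)).obj N, H.nonempty_iso _ _ hN⟩
  · intro M N f hf
    obtain ⟨φ, rfl⟩ := (toStable (IsExactInjective P)).map_surjective (X := M.as) (Y := N.as) f
    have : IsIso (K.map φ) := hf
    obtain ⟨ψ, ψ', h, h'⟩ := H.exists_inverse φ
    let T := toStable (IsExactInjective P)
    have h₁ : T.map φ ≫ T.map ψ = 𝟙 _ := by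
      rw [← T.map_comp, ← T.map_id]
      exact (CategoryTheory.Quotient.sound _ h).symm
    have h₂ : T.map ψ' ≫ T.map φ = 𝟙 _ := by
      rw [← T.map_comp, ← T.map_id]
      exact (CategoryTheory.Quotient.sound _ h').symm
    have : IsSplitMono (T.map φ) := ⟨⟨_, h₁⟩⟩
    have : IsSplitEpi (T.map φ) := ⟨⟨_, h₂⟩⟩
    have := IsSplitMono.mono (T.map φ)
    exact isIso_of_mono_of_isSplitEpi (T.map φ)
  · rw [hE]
    exact hinv

end IsStablyEpivalent

end Framework

/-! ### The splitting of free algebras and their degree zero part -/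

section FreeAlgebras
variable {C : Type u} [Category.{v} C] [Abelian C] (X : C ⥤ C) [X.Additive] [IsLocallyNilpotent X]

/-- The inclusion of the generators `M` into `f_!(M)`. -/
def freeη (M : C) : M ⟶ freeCarrier X M := freeι X M 0

/-- The projection of `f_!(M)` onto the summand `M`. -/
def freeπ (M : C) : freeCarrier X M ⟶ M :=
  Sigma.desc fun i : ℕ => match i with
    | 0 => 𝟙 M
    | _ + 1 => 0

/-- The left inverse of the structure map of `f_!(M)` which vanishes on the summand `M`. -/
def freeσ (M : C) : freeCarrier X M ⟶ X.obj (freeCarrier X M) :=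
  Sigma.desc fun i : ℕ => match i with
    | 0 => 0
    | i + 1 => X.map (freeι X M i)

lemma freeη_freeπ (M : C) : freeη X M ≫ freeπ X M = 𝟙 M := Sigma.ι_desc _ 0

lemma freeStr_freeπ (M : C) : freeStr X M ≫ freeπ X M = 0 :=
  map_free_hom_ext fun i => by
    rw [map_freeι_freeStr_assoc, comp_zero]
    exact Sigma.ι_desc _ (i + 1)

lemma freeη_freeσ (M : C) : freeη X M ≫ freeσ X M = 0 := Sigma.ι_desc _ 0

lemma freeStr_freeσ (M : C) : freeStr X M ≫ freeσ X M = 𝟙 _ :=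
  map_free_hom_ext fun i => by
    rw [map_freeι_freeStr_assoc, Category.comp_id]
    exact Sigma.ι_desc _ (i + 1)

variable {X} in
lemma freeCarrier_hom_ext {M T : C} {f g : freeCarrier X M ⟶ T} (h : freeη X M ≫ f = freeη X M ≫ g)
    (h' : freeStr X M ≫ f = freeStr X M ≫ g) : f = g := by
  refine Sigma.hom_ext _ _ fun i => ?_
  cases i with
  | zero => exact h
  | succ i =>
    change freeι X M (i + 1) ≫ f = freeι X M (i + 1) ≫ g
    rw [← map_freeι_freeStr_assoc, ← map_freeι_freeStr_assoc, h']

/-- This is the splitting f_!(M) = M ⊕ X(f_!(M)). It replaces the sum over all degrees wherever no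
recursion on the degree is needed. -/
lemma free_decomposition (M : C) :
    freeπ X M ≫ freeη X M + freeσ X M ≫ freeStr X M = 𝟙 (freeCarrier X M) := by
  refine freeCarrier_hom_ext ?_ ?_
  · rw [Preadditive.comp_add, reassoc_of% freeη_freeπ, reassoc_of% freeη_freeσ, zero_comp, add_zero,
      Category.comp_id]
  · rw [Preadditive.comp_add, reassoc_of% freeStr_freeπ, reassoc_of% freeStr_freeσ, zero_comp, zero_add,
      Category.comp_id]

variable {X}

lemma eq_freeπ_comp {M T : C} (q : freeCarrier X M ⟶ T) (h : freeStr X M ≫ q = 0) :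
    q = freeπ X M ≫ freeη X M ≫ q := by
  conv_lhs => rw [← Category.id_comp q, ← free_decomposition X M]
  rw [Preadditive.add_comp, Category.assoc, Category.assoc, h, comp_zero, add_zero]

lemma eq_comp_freeStr {M T : C} (x : T ⟶ freeCarrier X M) (h : x ≫ freeπ X M = 0) :
    x = (x ≫ freeσ X M) ≫ freeStr X M := by
  conv_lhs => rw [← Category.comp_id x, ← free_decomposition X M]
  rw [Preadditive.comp_add, reassoc_of% h, zero_comp, zero_add, Category.assoc]

lemma freeη_extend {M : C} (N : Endofunctor.Algebra X) (g : M ⟶ N.a) :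
    freeη X M ≫ (extend N g).f = g := freeι_extend N g 0

lemma free_hom_ext {M : C} {N : Endofunctor.Algebra X} {φ ψ : freeAlgebra X M ⟶ N}
    (h : freeη X M ≫ φ.f = freeη X M ≫ ψ.f) : φ = ψ :=
  (freeHomEquiv X M N).injective h

lemma extend_comp {M : C} {N N' : Endofunctor.Algebra X} (g : M ⟶ N.a) (φ : N ⟶ N') :
    extend N g ≫ φ = extend N' (g ≫ φ.f) :=
  free_hom_ext (by
    rw [Endofunctor.Algebra.comp_f, freeη_extend]
    rw [reassoc_of% freeη_extend N g])

lemma map_freeStr {M : C} {N : Endofunctor.Algebra X} (φ : freeAlgebra X M ⟶ N) :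
    X.map φ.f ≫ N.str = freeStr X M ≫ φ.f := φ.h

/-- The component in degree zero of a morphism between free algebras. -/
def top {M M' : C} (φ : freeAlgebra X M ⟶ freeAlgebra X M') : M ⟶ M' :=
  freeη X M ≫ φ.f ≫ freeπ X M'

/-- An algebra morphism carries the image of one structure map into the image of the other. It
therefore acts on their cokernels M and M', which makes `top` functorial. -/
lemma freeπ_top {M M' : C} (φ : freeAlgebra X M ⟶ freeAlgebra X M') :
    freeπ X M ≫ top φ = φ.f ≫ freeπ X M' := by
  refine (eq_freeπ_comp _ ?_).symm
  have h : X.map φ.f ≫ freeStr X M' = freeStr X M ≫ φ.f := φ.h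
  rw [← reassoc_of% h, freeStr_freeπ, comp_zero]

lemma top_comp {M M' M'' : C} (φ : freeAlgebra X M ⟶ freeAlgebra X M')
    (ψ : freeAlgebra X M' ⟶ freeAlgebra X M'') : top (φ ≫ ψ) = top φ ≫ top ψ := by
  rw [top, Endofunctor.Algebra.comp_f, Category.assoc, ← freeπ_top ψ, ← reassoc_of% freeπ_top φ,
    reassoc_of% freeη_freeπ]

lemma top_id (M : C) : top (𝟙 (freeAlgebra X M)) = 𝟙 M := by
  rw [top, Endofunctor.Algebra.id_f]
  exact (congrArg (freeη X M ≫ ·) (Category.id_comp _)).trans (freeη_freeπ X M)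

lemma top_sub {M M' : C} (φ ψ : freeAlgebra X M ⟶ freeAlgebra X M') :
    top (φ - ψ) = top φ - top ψ := by
  have : (φ - ψ).f = φ.f - ψ.f := rfl
  rw [top, this, Preadditive.sub_comp, Preadditive.comp_sub]
  rfl

/-- The morphism between free algebras induced by a morphism of generators. -/
abbrev freeMap {M M' : C} (g : M ⟶ M') : freeAlgebra X M ⟶ freeAlgebra X M' :=
  extend (freeAlgebra X M') (g ≫ freeη X M')

lemma top_freeMap {M M' : C} (g : M ⟶ M') : top (freeMap (X := X) g) = g := by
  rw [top, ← Category.assoc, freeη_extend, Category.assoc, freeη_freeπ, Category.comp_id]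

variable (X) in
/-- The decomposition of `f_!(M)` as the sum of the objects `P i = X^i(M)`. -/
lemma exists_freeProjections (M : C) : ∃ (n : ℕ) (P : ℕ → C) (ι : ∀ i, P i ⟶ freeCarrier X M)
    (π : ∀ i, freeCarrier X M ⟶ P i) (τ : ∀ i, X.obj (P i) ⟶ P (i + 1)) (ε : M ⟶ P 0),
    IsZero (P n) ∧ ∑ i ∈ Finset.range (n + 1), π i ≫ ι i = 𝟙 _ ∧ ε ≫ ι 0 = freeη X M ∧
      freeη X M ≫ π 0 = ε ∧ (∀ i, freeη X M ≫ π (i + 1) = 0) ∧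
      (∀ i, X.map (ι i) ≫ freeStr X M = τ i ≫ ι (i + 1)) ∧
      freeStr X M ≫ π 0 = 0 ∧ (∀ i, freeStr X M ≫ π (i + 1) = X.map (π i) ≫ τ i) ∧
      ∀ i, X.PreservesInjectiveObjects → Injective M → Injective (P i) := by
  obtain ⟨n, hn⟩ := IsLocallyNilpotent.exists_isZero (X := X) M
  obtain ⟨π, h₁, h₂, h₃⟩ := exists_projections (n := n + 1)
    (fun i hi => isZero_power_of_le X M hn i (Nat.le_of_succ_le hi))
    (coproductIsCoproduct fun i : ℕ => (power X i).obj M)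
  have h₁ (i : ℕ) : freeι X M i ≫ π i = 𝟙 _ := h₁ i
  have h₂ (i j : ℕ) (hij : i ≠ j) : freeι X M i ≫ π j = 0 := h₂ i j hij
  -- The sum includes degree n, where the summand is already zero. This lets recursions shift the
  -- degree by one without a boundary term.
  refine ⟨n, fun i => (power X i).obj M, freeι X M, π, fun _ => 𝟙 _, 𝟙 M, hn, h₃,
    Category.id_comp _, h₁ 0, fun i => h₂ _ _ (Nat.succ_ne_zero i).symm,
    fun i => (map_freeι_freeStr X M i).trans (Category.id_comp _).symm,
    map_free_hom_ext fun i => ?_, fun j => map_free_hom_ext fun i => ?_, fun i hX hM => ?_⟩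
  · exact (map_freeι_freeStr_assoc X M i (π 0)).trans
      ((h₂ _ _ (Nat.succ_ne_zero i)).trans comp_zero.symm)
  · refine (map_freeι_freeStr_assoc X M i (π (j + 1))).trans ?_
    refine Eq.trans ?_ (congrArg (X.map (freeι X M i) ≫ ·) (Category.comp_id _)).symm
    refine Eq.trans ?_ (X.map_comp _ _)
    by_cases h : i = j
    · subst h
      rw [h₁, h₁, X.map_id]
      rfl
    · rw [h₂ _ _ h, h₂ _ _ (by simpa using h), X.map_zero]
      rfl
  · induction i with
    | zero => exact hM
    | succ i ih => exact X.injective_obj_of_injective ih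

/-- The carrier is a finite sum of objects X^i(J), which are injective since X preserves injectives.
-/
instance injective_freeCarrier [X.PreservesInjectiveObjects] (J : C) [Injective J] :
    Injective (freeCarrier X J) := by
  obtain ⟨n, P, ι, π, -, -, -, h, -, -, -, -, -, -, hP⟩ := exists_freeProjections X J
  have (i : ℕ) : Injective (P i) := hP i inferInstance inferInstance
  refine ⟨fun {A B} g f _ => ⟨∑ i ∈ Finset.range (n + 1),
    Injective.factorThru (g ≫ π i) f ≫ ι i, ?_⟩⟩
  conv_rhs => rw [← Category.comp_id g, ← h]
  simp only [Preadditive.comp_sum, ← Category.assoc, Injective.comp_factorThru]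

end FreeAlgebras

/-! ### Nakayama lemmas -/

section Nilpotent
variable {C : Type u} [Category.{v} C] [Abelian C] {X : C ⥤ C} [X.Additive] [IsLocallyNilpotent X]

-- Applying the left exact functor X repeatedly gives monomorphisms K → X(K) → X²(K) → ⋯, and some
-- X^n(K) is zero. The next lemma is dual.
omit [X.Additive] in
lemma isZero_of_mono [PreservesFiniteLimits X] {K : C} (z : K ⟶ X.obj K) [Mono z] : IsZero K := by
  have key : ∀ n : ℕ, ∃ f : K ⟶ (power X n).obj K, Mono f := by
    intro n
    induction n with
    | zero => exact ⟨𝟙 K, (inferInstance : Mono (𝟙 K))⟩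
    | succ n ih =>
      obtain ⟨f, hf⟩ := ih
      exact ⟨z ≫ X.map f, mono_comp z (X.map f)⟩
  obtain ⟨n, hn⟩ := IsLocallyNilpotent.exists_isZero (X := X) K
  obtain ⟨f, hf⟩ := key n
  exact hn.of_mono f

omit [X.Additive] in
lemma isZero_of_epi [PreservesFiniteColimits X] {K : C} (z : X.obj K ⟶ K) [Epi z] : IsZero K := by
  have key : ∀ n : ℕ, ∃ f : (power X n).obj K ⟶ K, Epi f := by
    intro n
    induction n with
    | zero => exact ⟨𝟙 K, (inferInstance : Epi (𝟙 K))⟩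
    | succ n ih =>
      obtain ⟨f, hf⟩ := ih
      exact ⟨X.map f ≫ z, epi_comp (X.map f) z⟩
  obtain ⟨n, hn⟩ := IsLocallyNilpotent.exists_isZero (X := X) K
  obtain ⟨f, hf⟩ := key n
  exact hn.of_epi f

/-- Nakayama's lemma for epimorphisms of algebras. -/
theorem epi_of_generates [PreservesFiniteColimits X] {A B : Endofunctor.Algebra X} (φ : A ⟶ B)
    (H : ∀ {T : C} (q : B.a ⟶ T), φ.f ≫ q = 0 → B.str ≫ q = 0 → q = 0) : Epi φ.f := by
  let q := cokernel.π φ.f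
  have hq : φ.f ≫ q = 0 := cokernel.condition _
  have hXq := isColimitCoforkMapOfIsColimit' X hq (cokernelIsCokernel φ.f)
  obtain ⟨h, hh⟩ := CokernelCofork.IsColimit.desc' hXq (B.str ≫ q) (by
    rw [← Category.assoc, φ.h, Category.assoc, hq, comp_zero])
  replace hh : X.map q ≫ h = B.str ≫ q := hh
  -- The cokernel of φ inherits the structure map h. If t kills h, then q ≫ t kills both φ and the
  -- structure map of B, so it is zero. An epimorphism from X(K) onto K forces K = 0.
  have : Epi h := Preadditive.epi_of_cancel_zero _ fun {T} t ht => by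
    have := H (q ≫ t) (by rw [reassoc_of% hq, zero_comp])
      (by rw [← Category.assoc, ← hh, Category.assoc, ht, comp_zero])
    exact (cancel_epi q).1 (by rw [this, comp_zero])
  exact Preadditive.epi_of_isZero_cokernel _ (isZero_of_epi h)

/-- Nakayama's lemma for monomorphisms of algebras. -/
theorem mono_of_ker_le [PreservesFiniteLimits X] {A B : Endofunctor.Algebra X} (φ : A ⟶ B)
    [Mono B.str] (H : ∀ {T : C} (x : T ⟶ A.a), x ≫ φ.f = 0 → ∃ y, x = y ≫ A.str) :
    Mono φ.f := by
  let k := kernel.ι φ.f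
  have hk : k ≫ φ.f = 0 := kernel.condition _
  obtain ⟨y, hy⟩ := H k hk
  -- The kernel K factors through the structure map of A via y. As the structure map of B is monic,
  -- y lands in X(K), so K embeds in X(K) and vanishes.
  have hXk := isLimitForkMapOfIsLimit' X hk (kernelIsKernel φ.f)
  obtain ⟨z, hz⟩ := KernelFork.IsLimit.lift' hXk y (by
    rw [← cancel_mono B.str, Category.assoc, φ.h, ← reassoc_of% hy, hk, zero_comp])
  replace hz : z ≫ X.map k = y := hz
  have : Mono z := by
    have : z ≫ X.map k ≫ A.str = k := by rw [reassoc_of% hz, ← hy]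
    exact mono_of_mono_fac this
  exact Preadditive.mono_of_isZero_kernel _ (isZero_of_mono z)

omit [X.Additive] [IsLocallyNilpotent X] in
theorem isIso_of_isIso_f {A B : Endofunctor.Algebra X} (φ : A ⟶ B) [Mono φ.f] [Epi φ.f] : IsIso φ :=
  have := isIso_of_mono_of_epi φ.f
  Endofunctor.Algebra.iso_of_iso φ

/-- The cokernel of the structure map of f_!(M) is M, so the hypotheses of both Nakayama lemmas can
be read off from `top φ`. -/
theorem isIso_of_isIso_top [PreservesFiniteLimits X] [PreservesFiniteColimits X] {M M' : C}
    (φ : freeAlgebra X M ⟶ freeAlgebra X M') [IsIso (top φ)] : IsIso φ := by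
  have : Epi φ.f := epi_of_generates φ fun q h₁ h₂ => by
    rw [eq_freeπ_comp q h₂]
    have : top φ ≫ freeη X M' ≫ q = 0 := by
      rw [top, Category.assoc, Category.assoc, ← eq_freeπ_comp q h₂, h₁, comp_zero]
    rw [(cancel_epi (top φ)).1 (this.trans comp_zero.symm), comp_zero]
  have : Mono φ.f := by
    have : Mono (freeAlgebra X M').str := mono_freeStr X M'
    refine mono_of_ker_le φ fun x h => ⟨x ≫ freeσ X M, eq_comp_freeStr x ?_⟩
    rw [← cancel_mono (top φ), Category.assoc, freeπ_top, reassoc_of% h, zero_comp, zero_comp]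
  exact isIso_of_isIso_f φ

end Nilpotent

/-! ### Extending morphisms into free algebras on injective objects -/

section Extensions
variable {C : Type u} [Category.{v} C] [Abelian C] {X : C ⥤ C} [X.Additive]

/-- Morphisms into injective objects extend along `f`, with prescribed composite with the structure
map. -/
def IsRelativelyExtendable {L M : Endofunctor.Algebra X} (f : L ⟶ M) : Prop :=
  ∀ (I : C) [Injective I] (a : L.a ⟶ I) (b : X.obj M.a ⟶ I), L.str ≫ a = X.map f.f ≫ b →
    ∃ c : M.a ⟶ I, f.f ≫ c = a ∧ M.str ≫ c = b

-- The morphism w descends to the coimage of φ, and from there extends along a monomorphism into M.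
omit [X.Additive] in
lemma exists_extension {A M I : C} [Injective I] (φ : A ⟶ M) (w : A ⟶ I)
    (h : kernel.ι φ ≫ w = 0) : ∃ c, φ ≫ c = w := by
  have hφ : Abelian.coimage.π φ ≫ Abelian.factorThruCoimage φ = φ := Abelian.coimage.fac φ
  refine ⟨Injective.factorThru (cokernel.desc _ w h) (Abelian.factorThruCoimage φ), ?_⟩
  have h₁ := congrArg (· ≫ Injective.factorThru (cokernel.desc _ w h)
    (Abelian.factorThruCoimage φ)) hφ
  refine h₁.symm.trans ?_
  rw [Category.assoc, Injective.comp_factorThru]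
  exact cokernel.π_desc _ _ _

section
variable [IsLocallyNilpotent X] [PreservesFiniteLimits X]

-- The forgetful functor is a right adjoint, so it preserves kernels.
omit [PreservesFiniteLimits X] in
lemma IsConflation.isKernel_f {L M K : Endofunctor.Algebra X} {f : L ⟶ M} {g : M ⟶ K}
    (h : IsConflation f g) :
    ∃ w : f.f ≫ g.f = 0, Nonempty (IsLimit (KernelFork.ofι f.f w)) := by
  have : PreservesLimit (parallelPair g 0) (Endofunctor.Algebra.forget X) :=
    (freeAdj X).rightAdjoint_preservesLimits.preservesLimitsOfShape.preservesLimit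
  exact ⟨congrArg (fun t => t.f) h.w,
    ⟨isLimitForkMapOfIsLimit' (Endofunctor.Algebra.forget X) h.w h.isKernel.some⟩⟩

/-- Since the structure map of K is monic, the kernel of (f, M.str) : L ⊕ X(M) → M is only the copy
of X(L) embedded by (-L.str, X(f)). The compatibility of a and b says that (a, b) vanishes there. -/
theorem IsConflation.isRelativelyExtendable {L M K : Endofunctor.Algebra X} {f : L ⟶ M}
    {g : M ⟶ K} (h : IsConflation f g) [Mono K.str] : IsRelativelyExtendable f := by
  obtain ⟨w, ⟨hw⟩⟩ := h.isKernel_f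
  have hX := isLimitForkMapOfIsLimit' X w hw
  intro I _ a b hab
  let φ : L.a ⊞ X.obj M.a ⟶ M.a := biprod.desc f.f M.str
  let k := kernel.ι φ
  have hk : k ≫ φ = 0 := kernel.condition φ
  change k ≫ biprod.desc f.f M.str = 0 at hk
  rw [biprod.desc_eq, Preadditive.comp_add] at hk
  have hk₁ : (k ≫ biprod.snd) ≫ X.map g.f = 0 := by
    rw [← cancel_mono K.str, zero_comp, Category.assoc, g.h]
    have := congrArg (· ≫ g.f) hk
    simpa [w] using this
  obtain ⟨m, hm⟩ := KernelFork.IsLimit.lift' hX _ hk₁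
  replace hm : m ≫ X.map f.f = k ≫ biprod.snd := hm
  have : Mono f.f := mono_of_isLimit_fork hw
  have hk₂ : k ≫ biprod.fst = - m ≫ L.str := by
    rw [← cancel_mono f.f, Preadditive.neg_comp, Category.assoc, Category.assoc, ← f.h,
      reassoc_of% hm]
    exact eq_neg_of_add_eq_zero_left hk
  obtain ⟨c, hc⟩ := exists_extension φ (biprod.desc a b) (by
    change k ≫ _ = 0
    rw [biprod.desc_eq, Preadditive.comp_add, ← Category.assoc, hk₂, ← Category.assoc, ← hm,
      Category.assoc, ← hab]
    simp)
  exact ⟨c, by simpa [φ] using congrArg (biprod.inl ≫ ·) hc,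
    by simpa [φ] using congrArg (biprod.inr ≫ ·) hc⟩

end

lemma isRelativelyExtendable_zero (M : Endofunctor.Algebra X) [Mono M.str] :
    IsRelativelyExtendable (0 : (⟨0, 0⟩ : Endofunctor.Algebra X) ⟶ M) := by
  intro I _ a b _
  exact ⟨Injective.factorThru b M.str, (isZero_zero C).eq_of_src _ _,
    Injective.comp_factorThru _ _⟩

variable [IsLocallyNilpotent X] [X.PreservesInjectiveObjects]

/-- Morphisms to free algebras on injective objects extend along `f`, with prescribed failure of
compatibility with the structure maps. -/
theorem IsRelativelyExtendable.exists_extension {L M : Endofunctor.Algebra X} {f : L ⟶ M}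
    (hf : IsRelativelyExtendable f) {J : C} [Injective J] (u : L.a ⟶ freeCarrier X J)
    (s : X.obj M.a ⟶ J)
    (hu : L.str ≫ u = X.map f.f ≫ s ≫ freeη X J + X.map u ≫ freeStr X J) :
    ∃ v : M.a ⟶ freeCarrier X J, f.f ≫ v = u ∧
      M.str ≫ v = s ≫ freeη X J + X.map v ≫ freeStr X J := by
  obtain ⟨n, P, ι, π, τ, ε, hn, hsum, h₁, h₂, h₃, h₄, h₅, h₆, hP⟩ := exists_freeProjections X J
  have (i : ℕ) : Injective (P i) := hP i inferInstance inferInstance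
  -- The extension is built by degrees. Degree zero absorbs the prescribed failure s; in degree i +
  -- 1 the composite with the structure map is prescribed by X of the component in degree i.
  obtain ⟨c₀, hc₀, hc₀'⟩ := hf (P 0) (u ≫ π 0) (s ≫ ε) (by
    rw [← Category.assoc, hu, Preadditive.add_comp, Category.assoc, Category.assoc, Category.assoc,
      h₂, h₅, comp_zero, add_zero])
  have step (i : ℕ) (c : {c : M.a ⟶ P i // f.f ≫ c = u ≫ π i}) :
      ∃ c' : {c : M.a ⟶ P (i + 1) // f.f ≫ c = u ≫ π (i + 1)},
        M.str ≫ c'.1 = X.map c.1 ≫ τ i := by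
    obtain ⟨c', h, h'⟩ := hf (P (i + 1)) (u ≫ π (i + 1)) (X.map c.1 ≫ τ i) (by
      rw [← Category.assoc, hu, Preadditive.add_comp, Category.assoc, Category.assoc,
        Category.assoc, h₃, h₆, comp_zero, comp_zero, zero_add, ← X.map_comp_assoc,
        ← X.map_comp_assoc, c.2])
    exact ⟨⟨c', h⟩, h'⟩
  choose next hnext using step
  let c : ∀ i, {c : M.a ⟶ P i // f.f ≫ c = u ≫ π i} := fun i => Nat.rec ⟨c₀, hc₀⟩ next i
  have hc (i : ℕ) : M.str ≫ (c (i + 1)).1 = X.map (c i).1 ≫ τ i := hnext i (c i)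
  refine ⟨∑ i ∈ Finset.range (n + 1), (c i).1 ≫ ι i, ?_, ?_⟩
  · conv_rhs => rw [← Category.comp_id u, ← hsum]
    simp only [Preadditive.comp_sum, ← Category.assoc, (c _).2]
  · have hz : X.map (c n).1 ≫ τ n = 0 := by
      rw [(X.map_isZero hn).eq_of_tgt (X.map (c n).1) 0, zero_comp]
    have h₀ : M.str ≫ (c 0).1 = s ≫ ε := hc₀'
    rw [Preadditive.comp_sum, Finset.sum_range_succ', ← Category.assoc, h₀, Category.assoc, h₁,
      add_comm, X.map_sum, Preadditive.sum_comp, Finset.sum_range_succ, X.map_comp, Category.assoc,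
      h₄, reassoc_of% hz, zero_comp, add_zero]
    congr 1
    refine Finset.sum_congr rfl fun i _ => ?_
    rw [← Category.assoc, hc, X.map_comp, Category.assoc, Category.assoc, h₄]

/-- A morphism which is compatible with the structure maps up to a morphism that factors through an
injective object can be corrected to a morphism of algebras. -/
theorem exists_algebraHom {N N' : Endofunctor.Algebra X} [Mono N.str] (g : N.a ⟶ N'.a) {I : C}
    [Injective I] (s : X.obj N.a ⟶ I) (t : I ⟶ N'.a)
    (h : N.str ≫ g - X.map g ≫ N'.str = s ≫ t) :
    ∃ (φ : N ⟶ N') (b : N.a ⟶ freeCarrier X I), φ.f = g - b ≫ (extend N' t).f := by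
  -- The failure of g is s ≫ t. A morphism b into f_!(I) with failure s, followed by the algebra
  -- morphism extending t, has the same failure and can be subtracted.
  obtain ⟨b, -, hb⟩ := (isRelativelyExtendable_zero N).exists_extension (J := I) 0 s
    ((X.map_isZero (isZero_zero C)).eq_of_src _ _)
  have h' : freeStr X I ≫ (extend N' t).f = X.map (extend N' t).f ≫ N'.str := (map_freeStr _).symm
  refine ⟨⟨g - b ≫ (extend N' t).f, ?_⟩, b, rfl⟩
  rw [X.map_sub, Preadditive.sub_comp, Preadditive.comp_sub, ← Category.assoc N.str b, hb,
    Preadditive.add_comp, Category.assoc, Category.assoc, freeη_extend, ← h, h', X.map_comp,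
    Category.assoc]
  abel

/-- Extension with prescribed failure zero is extension by algebra morphisms. The conflation
supplies relative extendability. -/
theorem isExactInjective_free [PreservesFiniteLimits X] {N : (monoAlgebras X).FullSubcategory}
    {J : C} [Injective J] (e : freeAlgebra X J ≅ N.obj) :
    IsExactInjective (monoAlgebras X) N := by
  intro L M K hL hM hK f g hfg u
  have : Mono K.str := hK
  have hu : X.map (u ≫ e.inv).f ≫ freeStr X J = L.str ≫ (u ≫ e.inv).f := (u ≫ e.inv).h
  obtain ⟨v, hv, hv'⟩ := hfg.isRelativelyExtendable.exists_extension (J := J) (u ≫ e.inv).f 0 (by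
    rw [zero_comp, comp_zero, zero_add, hu])
  rw [zero_comp, zero_add] at hv'
  refine ⟨(⟨v, hv'.symm⟩ : M ⟶ freeAlgebra X J) ≫ e.hom, ?_⟩
  rw [← Category.assoc, ← cancel_mono e.inv, Category.assoc, e.hom_inv_id, Category.comp_id]
  exact Endofunctor.Algebra.ext hv

/-- Morphisms into an injective object which vanish on the image of the structure map extend to
morphisms into the free algebra. -/
theorem exists_hom_free {N : Endofunctor.Algebra X} [Mono N.str] {J : C} [Injective J]
    (c : N.a ⟶ J) (hc : N.str ≫ c = 0) :
    ∃ φ : N ⟶ freeAlgebra X J, φ.f ≫ freeπ X J = c := by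
  have : Injective (X.obj J) := X.injective_obj_of_injective ‹_›
  -- As c vanishes on the image of the structure map, the failure of c ≫ η factors through the
  -- injective object X(J). The correction takes values in the image of the structure map of f_!(J),
  -- hence is invisible to `freeπ`.
  obtain ⟨φ, b, h⟩ := exists_algebraHom (N' := freeAlgebra X J) (c ≫ freeη X J) (- X.map c)
    (X.map (freeη X J) ≫ freeStr X J) (by
      rw [reassoc_of% hc, zero_comp, zero_sub, Preadditive.neg_comp, X.map_comp, Category.assoc])
  refine ⟨φ, ?_⟩
  rw [h, Preadditive.sub_comp, Category.assoc, freeη_freeπ, Category.comp_id, Category.assoc,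
    ← freeπ_top, top, ← Category.assoc (freeη X _), freeη_extend, Category.assoc, freeStr_freeπ]
  simp

end Extensions

/-! ### Retracts, complements and the radical property of injective envelopes -/

section Complements
variable {A : Type u} [Category.{v} A] [Preadditive A]

theorem exists_complement_of_retract [IsIdempotentComplete A] {J N : A} (i : J ⟶ N) (r : N ⟶ J)
    (h : i ≫ r = 𝟙 J) : ∃ (Z : A) (z : Z ⟶ N), Nonempty (IsColimit (BinaryCofan.mk i z)) := by
  obtain ⟨Z, j, q, h₃, h₄⟩ := IsIdempotentComplete.idempotents_split N (𝟙 N - r ≫ i)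
    (by simp [reassoc_of% h])
  have hj : j ≫ r = 0 := by
    have h₁ : j ≫ (𝟙 N - r ≫ i) = j := by rw [← h₄, reassoc_of% h₃]
    rw [← h₁]
    simp [h]
  have hq : i ≫ q = 0 := by
    have h₁ : (𝟙 N - r ≫ i) ≫ q = q := by rw [← h₄, Category.assoc, h₃, Category.comp_id]
    rw [← h₁]
    simp [reassoc_of% h]
  exact ⟨Z, j, nonempty_isColimit_binaryCofan_iff.2 ⟨r, q, h, hq, hj, h₃, by rw [h₄]; abel⟩⟩

theorem HasNoInjectiveSummand.isZero_of_retract [IsIdempotentComplete A] [HasBinaryBiproducts A]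
    {M I : A} (hM : HasNoInjectiveSummand M) [Injective I] (i : I ⟶ M) (r : M ⟶ I)
    (h : i ≫ r = 𝟙 I) : IsZero I := by
  obtain ⟨Z, z, hz⟩ := exists_complement_of_retract i r h
  obtain ⟨p, q, h₁, h₂, h₃, h₄, h₅⟩ := nonempty_isColimit_binaryCofan_iff.1 hz
  refine hM I Z ‹_› ⟨⟨biprod.lift q p, biprod.desc z i, ?_, ?_⟩⟩
  · rw [biprod.lift_desc, add_comm, h₅]
  · ext <;> simp [h₁, h₂, h₃, h₄]

end Complements

section Envelopes
variable {C : Type u} [Category.{v} C] [Abelian C]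

/-- An endomorphism `ρ` of an injective object has an injective retract factoring through `ρ` that
detects whether `1 - ρ` is a split monomorphism. -/
theorem HasInjectiveEnvelopes.exists_retract (hC : HasInjectiveEnvelopes C) {I : C} [Injective I]
    (ρ : I ⟶ I) : ∃ (E : C) (_ : Injective E) (y : E ⟶ I) (z : I ⟶ E), y ≫ ρ ≫ z = 𝟙 E ∧
      (IsZero E → ∃ r, (𝟙 I - ρ) ≫ r = 𝟙 I) := by
  -- On ker(1 - ρ) the morphism ρ is the identity, so y ρ z fixes the embedding i into the envelope
  -- E and is invertible by minimality. If E = 0, then 1 - ρ is monic with injective source, hence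
  -- split.
  obtain ⟨E, i, hi⟩ := hC (kernel (𝟙 I - ρ))
  let k := kernel.ι (𝟙 I - ρ)
  have hk : k ≫ ρ = k := by
    have := kernel.condition (𝟙 I - ρ)
    rw [Preadditive.comp_sub, Category.comp_id, sub_eq_zero] at this
    exact this.symm
  have := hi.mono
  have := hi.injective
  let y : E ⟶ I := Injective.factorThru k i
  let z : I ⟶ E := Injective.factorThru i k
  have hy : i ≫ y = k := Injective.comp_factorThru _ _
  have hz : k ≫ z = i := Injective.comp_factorThru _ _
  have := hi.minimal (y ≫ ρ ≫ z) (by rw [reassoc_of% hy, reassoc_of% hk, hz])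
  refine ⟨E, inferInstance, y, z ≫ inv (y ≫ ρ ≫ z), ?_, fun h => ?_⟩
  · simpa only [Category.assoc] using IsIso.hom_inv_id (y ≫ ρ ≫ z)
  · have : Mono (𝟙 I - ρ) := Preadditive.mono_of_isZero_kernel _ (h.of_mono i)
    exact ⟨Injective.factorThru (𝟙 I) (𝟙 I - ρ), Injective.comp_factorThru _ _⟩

/-- The retract E supplied by `HasInjectiveEnvelopes.exists_retract` for b ≫ a is also a retract of
M, so it is zero and 1 - ba is a split monomorphism. As a is arbitrary, `isIso_one_sub_of_forall`
applies. -/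
theorem HasInjectiveEnvelopes.isIso_one_sub (hC : HasInjectiveEnvelopes C) {M I : C} [Injective I]
    (hM : HasNoInjectiveSummand M) (a : M ⟶ I) (b : I ⟶ M) : IsIso (𝟙 M - a ≫ b) := by
  refine isIso_one_sub_of_forall b (fun a => ?_) a
  obtain ⟨E, _, y, z, h₁, h₂⟩ := hC.exists_retract (b ≫ a)
  exact h₂ (hM.isZero_of_retract (y ≫ b) (a ≫ z) (by simpa only [Category.assoc] using h₁))

end Envelopes

/-! ### Conflations, idempotents, extensions and biproducts in Mono(X) -/

section MonoAlgebras
variable {C : Type u} [Category.{v} C] [Abelian C] {X : C ⥤ C} [X.Additive]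

/-- Factorizations found in C are automatically algebra morphisms: on the kernel side because f is
monic, on the cokernel side because X(g) is epic. -/
lemma isConflation_of_shortExact [PreservesFiniteColimits X] {L M K : Endofunctor.Algebra X}
    {f : L ⟶ M} {g : M ⟶ K} [Mono f.f] [Epi g.f] (w : f.f ≫ g.f = 0)
    (hf : ∀ {T : C} (x : T ⟶ M.a), x ≫ g.f = 0 → ∃ y, y ≫ f.f = x)
    (hg : ∀ {T : C} (x : M.a ⟶ T), f.f ≫ x = 0 → ∃ y, g.f ≫ y = x) : IsConflation f g := by
  have hw : f ≫ g = 0 := Endofunctor.Algebra.ext w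
  have := Endofunctor.Algebra.mono_of_mono f
  have := Endofunctor.Algebra.epi_of_epi g
  refine ⟨hw, ⟨KernelFork.IsLimit.ofι' f hw fun {A} k hk => Classical.choice ?_⟩,
    ⟨CokernelCofork.IsColimit.ofπ' g hw fun {A} k hk => Classical.choice ?_⟩⟩
  · obtain ⟨y, hy⟩ := hf k.f (congrArg (fun t => t.f) hk)
    refine ⟨⟨⟨y, ?_⟩, Endofunctor.Algebra.ext hy⟩⟩
    rw [← cancel_mono f.f, Category.assoc, Category.assoc, ← f.h, ← X.map_comp_assoc, hy, k.h]
  · obtain ⟨y, hy⟩ := hg k.f (congrArg (fun t => t.f) hk)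
    refine ⟨⟨⟨y, ?_⟩, Endofunctor.Algebra.ext hy⟩⟩
    rw [← cancel_epi (X.map g.f), ← X.map_comp_assoc, hy, k.h, reassoc_of% g.h, hy]

/-- Split the idempotent in C and compress the structure map. It stays monic because X(i) is split
monic and the structure map of N is monic. -/
instance : IsIdempotentComplete (monoAlgebras X).FullSubcategory where
  idempotents_split N e he := by
    have he' : e.hom.f ≫ e.hom.f = e.hom.f := congrArg (fun t => t.hom.f) he
    obtain ⟨Y, i, p, h₁, h₂⟩ := IsIdempotentComplete.idempotents_split N.obj.a e.hom.f he'
    have hN : Mono N.obj.str := N.property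
    have hp : e.hom.f ≫ p = p := by rw [← h₂, Category.assoc, h₁, Category.comp_id]
    have hi : i ≫ e.hom.f = i := by rw [← h₂, reassoc_of% h₁]
    let Z : Endofunctor.Algebra X := ⟨Y, X.map i ≫ N.obj.str ≫ p⟩
    let i' : Z ⟶ N.obj := ⟨i, by
      change _ = (X.map i ≫ N.obj.str ≫ p) ≫ i
      rw [Category.assoc, Category.assoc, h₂, ← e.hom.h, ← X.map_comp_assoc, hi]⟩
    let p' : N.obj ⟶ Z := ⟨p, by
      change X.map p ≫ X.map i ≫ N.obj.str ≫ p = _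
      rw [← X.map_comp_assoc, h₂, reassoc_of% e.hom.h, hp]⟩
    have hi' : X.map i ≫ N.obj.str = Z.str ≫ i := i'.h
    have : Mono (X.map i) := by
      have : X.map i ≫ X.map p = 𝟙 _ := by rw [← X.map_comp, h₁, X.map_id]
      exact mono_of_mono_fac this
    have hZ : Mono Z.str := by
      have : Mono (Z.str ≫ i) := by rw [← hi']; infer_instance
      exact mono_of_mono Z.str i
    refine ⟨⟨Z, hZ⟩, ObjectProperty.homMk i', ObjectProperty.homMk p', ?_, ?_⟩
    · ext1
      exact Endofunctor.Algebra.ext h₁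
    · ext1
      exact Endofunctor.Algebra.ext h₂

/-- The structure map of the extension of `L` by `G` which is given by `ε : X(L) ⟶ G`. -/
def extensionStr (L G : Endofunctor.Algebra X) (ε : X.obj L.a ⟶ G.a) :
    X.obj (L.a ⊞ G.a) ⟶ L.a ⊞ G.a :=
  X.map biprod.fst ≫ biprod.lift L.str ε + X.map biprod.snd ≫ G.str ≫ biprod.inr

/-- The extension of `L` by `G` which is given by a morphism `ε : X(L) ⟶ G`. -/
abbrev extensionAlgebra (L G : Endofunctor.Algebra X) (ε : X.obj L.a ⟶ G.a) :
    Endofunctor.Algebra X := ⟨L.a ⊞ G.a, extensionStr L G ε⟩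

section Extension
variable (L G : Endofunctor.Algebra X) (ε : X.obj L.a ⟶ G.a)

omit [X.Additive] in
lemma extensionStr_fst : extensionStr L G ε ≫ biprod.fst = X.map biprod.fst ≫ L.str := by
  simp [extensionStr]

omit [X.Additive] in
lemma extensionStr_snd : extensionStr L G ε ≫ biprod.snd =
    X.map biprod.fst ≫ ε + X.map biprod.snd ≫ G.str := by
  simp [extensionStr]

lemma map_inl_extensionStr : X.map biprod.inl ≫ extensionStr L G ε = biprod.lift L.str ε := by
  simp only [extensionStr, Preadditive.comp_add, ← X.map_comp_assoc, biprod.inl_fst,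
    biprod.inl_snd, X.map_id, X.map_zero, zero_comp, Category.id_comp, add_zero]

lemma map_inr_extensionStr : X.map biprod.inr ≫ extensionStr L G ε = G.str ≫ biprod.inr := by
  simp only [extensionStr, Preadditive.comp_add, ← X.map_comp_assoc, biprod.inr_fst,
    biprod.inr_snd, X.map_id, X.map_zero, zero_comp, Category.id_comp, zero_add]

/-- The projection onto `L`. -/
def extensionπ : extensionAlgebra L G ε ⟶ L := ⟨biprod.fst, (extensionStr_fst L G ε).symm⟩

/-- The inclusion of `G`. -/
def extensionι : G ⟶ extensionAlgebra L G ε := ⟨biprod.inr, map_inr_extensionStr L G ε⟩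

lemma map_biprod_hom_ext {T M N : C} {x y : X.obj (M ⊞ N) ⟶ T}
    (h₁ : X.map biprod.inl ≫ x = X.map biprod.inl ≫ y)
    (h₂ : X.map biprod.inr ≫ x = X.map biprod.inr ≫ y) : x = y := by
  rw [← Category.id_comp x, ← Category.id_comp y, ← X.map_id, ← biprod.total, X.map_add,
    X.map_comp, X.map_comp, Preadditive.add_comp, Preadditive.add_comp, Category.assoc,
    Category.assoc, Category.assoc, Category.assoc, h₁, h₂]

-- The structure map is block triangular. The hypothesis kills the L-component of a kernel element;
-- the G-component then dies because the structure map of G is monic.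
variable {L G ε} in
theorem mono_extensionStr [Mono G.str] (H : ∀ {T : C} (x : T ⟶ X.obj L.a) (y : T ⟶ X.obj G.a),
    x ≫ L.str = 0 → x ≫ ε + y ≫ G.str = 0 → x = 0) : Mono (extensionStr L G ε) := by
  refine Preadditive.mono_of_cancel_zero _ fun x hx => ?_
  have h₁ : (x ≫ X.map biprod.fst) ≫ L.str = 0 := by
    rw [Category.assoc, ← extensionStr_fst L G ε, reassoc_of% hx, zero_comp]
  have h₂ : (x ≫ X.map biprod.fst) ≫ ε + (x ≫ X.map biprod.snd) ≫ G.str = 0 := by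
    rw [Category.assoc, Category.assoc, ← Preadditive.comp_add, ← extensionStr_snd L G ε,
      reassoc_of% hx, zero_comp]
  have h₃ := H _ _ h₁ h₂
  rw [h₃, zero_comp, zero_add] at h₂
  have h₄ : x ≫ X.map biprod.snd = 0 := by rw [← cancel_mono G.str, h₂, zero_comp]
  rw [← Category.comp_id x, ← X.map_id, ← biprod.total, X.map_add, X.map_comp, X.map_comp,
    Preadditive.comp_add, reassoc_of% h₃, reassoc_of% h₄, zero_comp, zero_comp, add_zero]

end Extension

instance (M N : (monoAlgebras X).FullSubcategory) : HasBinaryBiproduct M N := by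
  have hM : Mono M.obj.str := M.property
  have hN : Mono N.obj.str := N.property
  have hW : Mono (extensionStr M.obj N.obj 0) := mono_extensionStr fun x _ h _ => by
    rw [← cancel_mono M.obj.str, h, zero_comp]
  refine hasBinaryBiproduct_of_total
    { pt := ⟨extensionAlgebra M.obj N.obj 0, hW⟩
      fst := ObjectProperty.homMk (extensionπ M.obj N.obj 0)
      snd := ObjectProperty.homMk ⟨biprod.snd, by
        rw [extensionStr_snd, comp_zero, zero_add]⟩
      inl := ObjectProperty.homMk ⟨biprod.inl, by
        rw [map_inl_extensionStr]
        ext <;> simp⟩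
      inr := ObjectProperty.homMk (extensionι M.obj N.obj 0)
      inl_fst := ?_
      inl_snd := ?_
      inr_fst := ?_
      inr_snd := ?_ } ?_
  all_goals ext1; apply Endofunctor.Algebra.ext
  · exact biprod.inl_fst
  · exact biprod.inl_snd
  · exact biprod.inr_fst
  · exact biprod.inr_snd
  · exact biprod.total

instance : HasBinaryBiproducts (monoAlgebras X).FullSubcategory := ⟨inferInstance⟩

end MonoAlgebras

/-! ### Classification of the exact injectives and factorization through them -/

section ExactInjectives
variable {C : Type u} [Category.{v} C] [Abelian C] {X : C ⥤ C} [X.Additive]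
  [IsLocallyNilpotent X] [X.PreservesInjectiveObjects]
  [PreservesFiniteLimits X] [PreservesFiniteColimits X]

/-- An algebra with monic structure map embeds into a free algebra on an injective object, with
cokernel of the same type. -/
theorem HasInjectiveEnvelopes.exists_isConflation (hC : HasInjectiveEnvelopes C)
    (N : Endofunctor.Algebra X) [Mono N.str] : ∃ (J : C) (_ : Injective J)
      (i : cokernel N.str ⟶ J) (φ : N ⟶ freeAlgebra X J) (K : Endofunctor.Algebra X)
      (q : freeAlgebra X J ⟶ K), φ.f ≫ freeπ X J = cokernel.π N.str ≫ i ∧ Mono K.str ∧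
      IsConflation φ q := by
  obtain ⟨J, i, hi⟩ := hC (cokernel N.str)
  have := hi.mono
  have := hi.injective
  obtain ⟨φ, hφ⟩ := exists_hom_free (cokernel.π N.str ≫ i) (by simp)
  -- As i is monic, an element of N that φ sends into the image of the structure map of f_!(J)
  -- already lies in the image of the structure map of N. Nakayama then makes φ monic.
  have hN {T : C} (x : T ⟶ N.a) (hx : x ≫ φ.f ≫ freeπ X J = 0) : ∃ y, x = y ≫ N.str := by
    have hx : x ≫ cokernel.π N.str = 0 := by
      rwa [hφ, ← Category.assoc, ← cancel_mono i, zero_comp] at *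
    exact ⟨Abelian.monoLift N.str x hx, (Abelian.monoLift_comp N.str x hx).symm⟩
  have hF : Mono (freeAlgebra X J).str := mono_freeStr X J
  have : Mono φ.f := mono_of_ker_le φ fun x hx => hN x (by rw [reassoc_of% hx, zero_comp])
  let q : freeCarrier X J ⟶ cokernel φ.f := cokernel.π φ.f
  have hq : φ.f ≫ q = 0 := cokernel.condition φ.f
  have hXq := isColimitCoforkMapOfIsColimit' X hq (cokernelIsCokernel φ.f)
  have hφs : X.map φ.f ≫ freeStr X J = N.str ≫ φ.f := φ.h
  obtain ⟨k, hk⟩ := CokernelCofork.IsColimit.desc' hXq (freeStr X J ≫ q)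
    (by rw [reassoc_of% hφs, hq, comp_zero])
  replace hk : X.map q ≫ k = freeStr X J ≫ q := hk
  -- If the structure map of f_!(J) sends y' into the image of φ, say to φ(n), then n comes from
  -- some m in X(N) by `hN`. Hence y' = X(φ)(m), which vanishes in X of the cokernel.
  have hk' : Mono k := Preadditive.mono_of_cancel_zero _ fun {T} y hy => by
    obtain ⟨T', e, _, y', hy'⟩ := surjective_up_to_refinements_of_epi (X.map q) y
    have h₁ : (y' ≫ freeStr X J) ≫ q = 0 := by
      rw [Category.assoc, ← hk, ← reassoc_of% hy', hy, comp_zero]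
    let n := Abelian.monoLift φ.f _ h₁
    have hn : n ≫ φ.f = y' ≫ freeStr X J := Abelian.monoLift_comp φ.f _ h₁
    obtain ⟨m, hm⟩ := hN n (by rw [reassoc_of% hn, freeStr_freeπ, comp_zero])
    have h₂ : m ≫ X.map φ.f = y' := by
      rw [← cancel_mono (freeStr X J), Category.assoc, hφs, ← reassoc_of% hm, hn]
    rw [← cancel_epi e, hy', ← h₂, Category.assoc, ← X.map_comp, hq, X.map_zero, comp_zero,
      comp_zero]
  let q' : freeAlgebra X J ⟶ ⟨cokernel φ.f, k⟩ := ⟨q, hk⟩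
  have hq' : Epi q'.f := (inferInstance : Epi (cokernel.π φ.f))
  exact ⟨J, hi.injective, i, φ, _, q', hφ, hk', isConflation_of_shortExact hq
    (fun x hx => ⟨Abelian.monoLift φ.f x hx, Abelian.monoLift_comp φ.f x hx⟩)
    fun x hx => ⟨cokernel.desc φ.f x hx, cokernel.π_desc φ.f x hx⟩⟩

/-- The exact injective objects of `Mono(X)` are the free algebras on injective objects. -/
theorem HasInjectiveEnvelopes.exists_iso_free (hC : HasInjectiveEnvelopes C)
    {N : (monoAlgebras X).FullSubcategory} (hN : IsExactInjective (monoAlgebras X) N) :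
    ∃ I : C, Injective I ∧ Nonempty (freeAlgebra X I ≅ N.obj) := by
  have hm : Mono N.obj.str := N.property
  obtain ⟨J, hJ, i, φ, K, q, hφ, hK, hc⟩ := hC.exists_isConflation N.obj
  obtain ⟨r, hr⟩ := hN hm (show monoAlgebras X (freeAlgebra X J) from mono_freeStr X J) hK φ q hc (𝟙 N.obj)
  have hr : φ.f ≫ r.f = 𝟙 N.obj.a := congrArg (fun t => t.f) hr
  have hrs : X.map r.f ≫ N.obj.str = freeStr X J ≫ r.f := r.h
  let p := cokernel.π N.obj.str
  have hp : N.obj.str ≫ p = 0 := cokernel.condition _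
  have h₁ : r.f ≫ p = freeπ X J ≫ freeη X J ≫ r.f ≫ p := by
    refine eq_freeπ_comp _ ?_
    rw [← reassoc_of% hrs, hp, comp_zero]
  -- Modulo the structure maps, the retraction r exhibits the cokernel of `N.obj.str` as a retract
  -- of J, hence as an injective object.
  have h₂ : i ≫ freeη X J ≫ r.f ≫ p = 𝟙 _ := by
    rw [← cancel_epi p, ← reassoc_of% hφ, ← h₁, reassoc_of% hr, Category.comp_id]
  have : Injective (cokernel N.obj.str) := ⟨fun g f _ => by
    refine ⟨Injective.factorThru (g ≫ i) f ≫ freeη X J ≫ r.f ≫ p, ?_⟩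
    rw [← Category.assoc, Injective.comp_factorThru, Category.assoc, h₂, Category.comp_id]⟩
  -- The generators are sent to a lift of the cokernel to N. Then ψ is the identity on the cokernels
  -- of the structure maps, and both Nakayama lemmas apply.
  let ψ : freeAlgebra X (cokernel N.obj.str) ⟶ N.obj := extend N.obj (i ≫ freeη X J ≫ r.f)
  have hψ : freeη X _ ≫ ψ.f = i ≫ freeη X J ≫ r.f := freeη_extend _ _
  have hψs : X.map ψ.f ≫ N.obj.str = freeStr X _ ≫ ψ.f := ψ.h
  have hψp : ψ.f ≫ p = freeπ X _ := by
    rw [eq_freeπ_comp (ψ.f ≫ p) (by rw [← reassoc_of% hψs, hp, comp_zero]), reassoc_of% hψ, h₂,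
      Category.comp_id]
  have : Epi ψ.f := epi_of_generates ψ fun t ht ht' => by
    have h₃ : p ≫ cokernel.desc _ t ht' = t := cokernel.π_desc _ _ _
    rw [← h₃, ← Category.id_comp (cokernel.desc _ t ht'), ← h₂]
    simp only [Category.assoc]
    rw [h₃, ← reassoc_of% hψ, ht, comp_zero, comp_zero]
  have : Mono ψ.f := mono_of_ker_le ψ fun x hx => ⟨x ≫ freeσ X _, eq_comp_freeStr x (by
    rw [← hψp, reassoc_of% hx, zero_comp])⟩
  have := isIso_of_isIso_f ψ
  exact ⟨_, inferInstance, ⟨asIso ψ⟩⟩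

theorem HasInjectiveEnvelopes.injective_of_isExactInjective (hC : HasInjectiveEnvelopes C)
    {N : (monoAlgebras X).FullSubcategory} (hN : IsExactInjective (monoAlgebras X) N) :
    Injective N.obj.a := by
  obtain ⟨I, hI, ⟨e⟩⟩ := hC.exists_iso_free hN
  exact Injective.of_iso ((Endofunctor.Algebra.forget X).mapIso e)
    (inferInstance : Injective (freeCarrier X I))

omit [PreservesFiniteColimits X] [PreservesFiniteLimits X] in
/-- A composite of two morphisms of algebras which factor through injective objects in `C` factors
through a free algebra on an injective object. -/
theorem exists_factorization {N N' N'' : Endofunctor.Algebra X} [Mono N.str] (θ : N ⟶ N')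
    (θ' : N' ⟶ N'') {I I' : C} [Injective I] [Injective I'] {u : N.a ⟶ I} {v : I ⟶ N'.a}
    (h : u ≫ v = θ.f) {u' : N'.a ⟶ I'} {v' : I' ⟶ N''.a} (h' : u' ≫ v' = θ'.f) :
    ∃ a : N ⟶ freeAlgebra X I', a ≫ extend N'' v' = θ ≫ θ' := by
  have : Injective (X.obj I) := X.injective_obj_of_injective ‹_›
  -- The failure of θ u' η to be an algebra morphism is X(u) ≫ t, through the injective X(I). The
  -- algebra morphism extending v' kills t because u' v' = θ' is an algebra morphism, so the
  -- correction of θ u' η does not change the composite θ u' v' = θ θ'.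
  let t : X.obj I ⟶ freeCarrier X I' := X.map v ≫
    (N'.str ≫ u' ≫ freeη X I' - X.map (u' ≫ freeη X I') ≫ freeStr X I')
  obtain ⟨a, b, hab⟩ := exists_algebraHom (N' := freeAlgebra X I') (θ.f ≫ u' ≫ freeη X I')
    (X.map u) t (by
      change _ = X.map u ≫ X.map v ≫ _
      rw [← X.map_comp_assoc, h, Preadditive.comp_sub, reassoc_of% θ.h, X.map_comp θ.f,
        Category.assoc])
  refine ⟨a, Endofunctor.Algebra.ext ?_⟩
  have hs : freeStr X I' ≫ (extend N'' v').f = X.map (extend N'' v').f ≫ N''.str :=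
    (map_freeStr (extend N'' v')).symm
  have ht : t ≫ (extend N'' v').f = 0 := by
    simp only [t, Category.assoc, Preadditive.sub_comp, hs, freeη_extend, ← X.map_comp_assoc, h']
    rw [θ'.h, sub_self, comp_zero]
  have h₁ : (extend (freeAlgebra X I') t).f ≫ (extend N'' v').f = 0 := by
    have := extend_comp (N := freeAlgebra X I') t (extend N'' v')
    rw [ht] at this
    have h₂ : extend N'' (0 : X.obj I ⟶ N''.a) = 0 :=
      free_hom_ext ((freeη_extend _ _).trans comp_zero.symm)
    rw [h₂] at this
    exact congrArg (fun t => t.f) this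
  rw [Endofunctor.Algebra.comp_f, Endofunctor.Algebra.comp_f, hab, Preadditive.sub_comp,
    Category.assoc, Category.assoc, Category.assoc, h₁, freeη_extend, h', comp_zero, sub_zero]

/-- The argument in C is applied to the degree zero part of an endomorphism of f_!(I), since `top`
detects isomorphisms of free algebras. A nonzero retract E of I would make f_!(E) an injective
retract of N. -/
theorem HasInjectiveEnvelopes.isIso_one_sub_of_isReduced (hC : HasInjectiveEnvelopes C)
    {N : (monoAlgebras X).FullSubcategory} (hN : IsReduced (monoAlgebras X) N)
    {J : (monoAlgebras X).FullSubcategory} (hJ : IsExactInjective (monoAlgebras X) J) (a : N ⟶ J)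
    (b : J ⟶ N) : IsIso (𝟙 N - a ≫ b) := by
  obtain ⟨I, hI, ⟨e⟩⟩ := hC.exists_iso_free hJ
  refine isIso_one_sub_of_forall b (fun a => ?_) a
  let β : freeAlgebra X I ⟶ freeAlgebra X I := (e.hom ≫ b.hom ≫ a.hom ≫ e.inv)
  obtain ⟨E, hE, y, z, h₁, h₂⟩ := hC.exists_retract (top β)
  have h₃ : IsIso (freeMap (X := X) y ≫ β ≫ freeMap z) := by
    have : IsIso (top (freeMap (X := X) y ≫ β ≫ freeMap z)) := by
      rw [top_comp, top_comp, top_freeMap, top_freeMap, h₁]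
      infer_instance
    exact isIso_of_isIso_top _
  obtain ⟨w, hw, -⟩ := h₃.out
  let E' : (monoAlgebras X).FullSubcategory := ⟨freeAlgebra X E, mono_freeStr X E⟩
  have hE' : IsZero E' := hN E' (isExactInjective_free (Iso.refl _))
    (ObjectProperty.homMk (freeMap y ≫ e.hom ≫ b.hom))
    (ObjectProperty.homMk (a.hom ≫ e.inv ≫ freeMap z ≫ w))
    (by
      ext1
      refine Eq.trans ?_ hw
      change (freeMap y ≫ e.hom ≫ b.hom) ≫ a.hom ≫ e.inv ≫ freeMap z ≫ w = _
      simp only [β, Category.assoc])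
  have hE₀ : IsZero E := by
    have h₀ : (𝟙 E' : E' ⟶ E') = 0 := hE'.eq_of_src _ _
    have : (𝟙 (freeAlgebra X E)) = 0 := congrArg (fun t => t.hom) h₀
    rw [IsZero.iff_id_eq_zero, ← top_id (X := X), this]
    exact (congrArg (freeη X E ≫ ·) zero_comp).trans comp_zero
  obtain ⟨r, hr⟩ := h₂ hE₀
  have h₄ : IsIso ((𝟙 (freeAlgebra X I) - β) ≫ freeMap r) := by
    have : IsIso (top ((𝟙 (freeAlgebra X I) - β) ≫ freeMap r)) := by
      rw [top_comp, top_sub, top_id, top_freeMap, hr]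
      infer_instance
    exact isIso_of_isIso_top _
  refine ⟨ObjectProperty.homMk (e.inv ≫ (freeMap r ≫
    inv ((𝟙 (freeAlgebra X I) - β) ≫ freeMap r)) ≫ e.hom), ?_⟩
  ext1
  have h₅ : 𝟙 J.obj - b.hom ≫ a.hom = e.inv ≫ (𝟙 (freeAlgebra X I) - β) ≫ e.hom := by
    simp [β]
  have h₆ := IsIso.hom_inv_id ((𝟙 (freeAlgebra X I) - β) ≫ freeMap r)
  change (𝟙 J.obj - b.hom ≫ a.hom) ≫ _ = 𝟙 J.obj
  rw [h₅]
  rw [Category.assoc] at h₆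
  simp only [ObjectProperty.homMk_hom, Category.assoc, e.hom_inv_id_assoc, reassoc_of% h₆,
    e.inv_hom_id]

end ExactInjectives

/-! ### Morphisms in the injectively stable category -/

section Stable
variable {C : Type u} [Category.{v} C] [Preadditive C] [HasFiniteCoproducts C]

/-- Factoring through an injective already defines a congruence, so no closure under composition has
to be taken. -/
lemma toStable_map_eq_iff {M N : C} (f g : M ⟶ N) :
    (toStable (injectives C)).map f = (toStable (injectives C)).map g ↔
      ∃ (J : C) (_ : Injective J) (u : M ⟶ J) (v : J ⟶ N), u ≫ v = f - g := by
  rw [CategoryTheory.Quotient.functor_map_eq_iff]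
  exact ⟨fun ⟨J, hJ, u, v, h⟩ => ⟨J, hJ, u, v, h⟩, fun ⟨J, hJ, u, v, h⟩ => ⟨J, hJ, u, v, h⟩⟩

lemma toStable_map_eq_zero_iff {M N : C} (f : M ⟶ N) :
    (toStable (injectives C)).map f = 0 ↔
      ∃ (J : C) (_ : Injective J) (u : M ⟶ J) (v : J ⟶ N), u ≫ v = f := by
  rw [← (toStable (injectives C)).map_zero, toStable_map_eq_iff, sub_zero]

lemma toStable_map_comp_eq_zero {M N J : C} [hJ : Injective J] (u : M ⟶ J) (v : J ⟶ N) :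
    (toStable (injectives C)).map (u ≫ v) = 0 :=
  (toStable_map_eq_zero_iff _).2 ⟨J, hJ, u, v, rfl⟩

/-- A split epimorphism with injective kernel becomes invertible in the stable category. -/
lemma toStable_isIso_of_total {M N J : C} [Injective J] {p : M ⟶ N} {s : N ⟶ M} {u : M ⟶ J}
    {v : J ⟶ M} (h : s ≫ p = 𝟙 N) (h' : p ≫ s + u ≫ v = 𝟙 M) :
    (toStable (injectives C)).map s ≫ (toStable (injectives C)).map p = 𝟙 _ ∧
      (toStable (injectives C)).map p ≫ (toStable (injectives C)).map s = 𝟙 _ := by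
  have h₁ := congrArg (toStable (injectives C)).map h'
  rw [Functor.map_add, toStable_map_comp_eq_zero u v, add_zero] at h₁
  exact ⟨by rw [← Functor.map_comp, h, CategoryTheory.Functor.map_id],
    by rw [← Functor.map_comp, h₁, CategoryTheory.Functor.map_id]⟩

lemma isIso_toStable_fst [HasBinaryBiproducts C] (M J : C) [Injective J] :
    IsIso ((toStable (injectives C)).map (biprod.fst : M ⊞ J ⟶ M)) := by
  obtain ⟨h₁, h₂⟩ := toStable_isIso_of_total (biprod.inl_fst (X := M) (Y := J)) biprod.total
  exact ⟨_, h₂, h₁⟩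

end Stable

/-! ### The explicit form of the Mimo-construction and its reducedness -/

section MimoConstruction
variable {C : Type u} [Category.{v} C] [Abelian C] {X : C ⥤ C} [X.Additive]
  [IsLocallyNilpotent X]

section
variable (L : Endofunctor.Algebra X) {J : C} (e : X.obj L.a ⟶ J)

/-- The structure map of the Mimo-construction. -/
def mimoStr : X.obj (L.a ⊞ freeCarrier X J) ⟶ L.a ⊞ freeCarrier X J :=
  extensionStr L (freeAlgebra X J) (e ≫ freeη X J)

/-- An explicit description of the Mimo-construction: the extension of `L` by `f_!(J)` given by `e`. -/
abbrev mimoAlgebra : Endofunctor.Algebra X := ⟨L.a ⊞ freeCarrier X J, mimoStr L e⟩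

lemma map_inl_mimoStr :
    X.map biprod.inl ≫ mimoStr L e = biprod.lift L.str (e ≫ freeη X J) :=
  map_inl_extensionStr L (freeAlgebra X J) (e ≫ freeη X J)

lemma map_inr_mimoStr : X.map biprod.inr ≫ mimoStr L e = freeStr X J ≫ biprod.inr :=
  map_inr_extensionStr L (freeAlgebra X J) (e ≫ freeη X J)

/-- The inclusion of `f_!(J)`. -/
def mimoι : freeAlgebra X J ⟶ mimoAlgebra L e := ⟨biprod.inr, map_inr_mimoStr L e⟩

/-- The projection onto `L`. -/
def mimoπ : mimoAlgebra L e ⟶ L := ⟨biprod.fst, (extensionStr_fst L (freeAlgebra X J) (e ≫ freeη X J)).symm⟩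

end

/-- In degree zero an injective retract f_!(I) gives p₁q₁ + p₂q₂ = 1 on I, through L and J. As L has
no injective summands, p₂q₂ is invertible, with inverse w. Compatibility with the structure maps
gives h q₁ + e q₂ = 0, so e q₂ vanishes on the kernel of h and `hmin` makes 1 - q₂ w p₂ invertible.
It annihilates q₂, hence q₂ = 0 and I = 0. -/
theorem HasInjectiveEnvelopes.isReduced_extension [X.PreservesInjectiveObjects]
    [PreservesFiniteLimits X] [PreservesFiniteColimits X] (hC : HasInjectiveEnvelopes C)
    {N : (monoAlgebras X).FullSubcategory} {L : Endofunctor.Algebra X} {J : C} {e : X.obj L.a ⟶ J}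
    (i : N.obj ≅ mimoAlgebra L e)
    (hL : HasNoInjectiveSummand L.a)
    (hmin : ∀ g : J ⟶ J, (∀ {T : C} (x : T ⟶ X.obj L.a), x ≫ L.str = 0 → x ≫ e ≫ g = x ≫ e) →
      IsIso g) : IsReduced (monoAlgebras X) N := by
  intro J' hJ' s r hsr
  obtain ⟨I, hI, ⟨ε⟩⟩ := hC.exists_iso_free hJ'
  let E := mimoAlgebra L e
  let p : freeAlgebra X I ⟶ E := ε.hom ≫ s.hom ≫ i.hom
  let q : E ⟶ freeAlgebra X I := i.inv ≫ r.hom ≫ ε.inv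
  have hsr' : s.hom ≫ r.hom = 𝟙 J'.obj := congrArg (fun t => t.hom) hsr
  have hpq : p ≫ q = 𝟙 _ := by
    simp only [p, q, Category.assoc, i.hom_inv_id_assoc, reassoc_of% hsr', ε.hom_inv_id]
  have hpq' : p.f ≫ q.f = 𝟙 (freeCarrier X I) := congrArg (fun t => t.f) hpq
  let q' : L.a ⊞ freeCarrier X J ⟶ freeCarrier X I := q.f
  let p' : freeCarrier X I ⟶ L.a ⊞ freeCarrier X J := p.f
  have hq' : X.map q' ≫ freeStr X I = mimoStr L e ≫ q' := q.h
  let q₁ : L.a ⟶ I := biprod.inl ≫ q' ≫ freeπ X I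
  let q₂ : J ⟶ I := freeη X J ≫ biprod.inr ≫ q' ≫ freeπ X I
  let p₁ : I ⟶ L.a := freeη X I ≫ p' ≫ biprod.fst
  let p₂ : I ⟶ J := freeη X I ≫ p' ≫ biprod.snd ≫ freeπ X J
  have h₁ : mimoStr L e ≫ q' ≫ freeπ X I = 0 := by
    rw [← reassoc_of% hq', freeStr_freeπ, comp_zero]
  have h₂ : L.str ≫ q₁ + e ≫ q₂ = 0 := by
    have := congrArg (X.map biprod.inl ≫ ·) h₁
    simp only [comp_zero] at this
    rw [← Category.assoc, map_inl_mimoStr, biprod.lift_eq, Preadditive.add_comp] at this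
    simpa only [q₁, q₂, Category.assoc] using this
  have h₃ : biprod.inr ≫ q' ≫ freeπ X I = freeπ X J ≫ q₂ := by
    refine eq_freeπ_comp _ ?_
    have := congrArg (X.map biprod.inr ≫ ·) h₁
    simp only [comp_zero] at this
    rw [← Category.assoc, map_inr_mimoStr] at this
    simpa only [Category.assoc] using this
  have h₄ : 𝟙 I - p₁ ≫ q₁ = p₂ ≫ q₂ := by
    rw [sub_eq_iff_eq_add']
    simp only [p₁, q₁, p₂, Category.assoc]
    rw [← h₃, ← Preadditive.comp_add, ← Preadditive.comp_add, ← Category.assoc biprod.fst,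
      ← Category.assoc biprod.snd, ← Preadditive.add_comp, biprod.total, Category.id_comp,
      reassoc_of% hpq', freeη_freeπ]
  have h₅ := hC.isIso_one_sub hL q₁ p₁
  have h₆ := isIso_one_sub_comp_swap q₁ p₁
  rw [h₄] at h₆
  obtain ⟨w, -, hw⟩ := h₆.out
  have hz : (w ≫ p₂) ≫ q₂ = 𝟙 I := by rw [Category.assoc, hw]
  have h₇ : IsIso (𝟙 J - q₂ ≫ w ≫ p₂) := hmin _ fun x hx => by
    have : x ≫ e ≫ q₂ = 0 := by
      have := congrArg (x ≫ ·) h₂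
      simpa only [Preadditive.comp_add, reassoc_of% hx, zero_comp, comp_zero, zero_add] using this
    simp only [Preadditive.comp_sub, Category.comp_id, reassoc_of% this, zero_comp, sub_zero]
  have h₈ : q₂ = 0 := by
    rw [← cancel_epi (𝟙 J - q₂ ≫ w ≫ p₂), Preadditive.sub_comp, Category.assoc, hz]
    simp
  have h₉ : IsZero I := by rw [IsZero.iff_id_eq_zero, ← hz, h₈, comp_zero]
  have h₁₀ : (𝟙 (freeAlgebra X I)) = 0 := free_hom_ext (h₉.eq_of_src _ _)
  rw [IsZero.iff_id_eq_zero]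
  ext1
  change 𝟙 J'.obj = 0
  rw [← ε.inv_hom_id, ← Category.id_comp ε.hom, h₁₀, zero_comp, comp_zero]

variable {L : Endofunctor.Algebra X} {J : C} (e : X.obj L.a ⟶ J)

lemma freeη_freeIncl (M : C) : freeη X (X.obj M) ≫ (freeIncl X M).f =
    X.map (freeη X M) ≫ freeStr X M :=
  (freeη_extend (freeAlgebra X M) (freeι X M 1)).trans (map_freeι_freeStr X M 0).symm

lemma freeη_free_map {M N : C} (g : M ⟶ N) : freeη X M ≫ ((free X).map g).f = g ≫ freeη X N :=
  power_map_free X M N g 0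

variable (L) in
/-- The morphism `ι_L - f_!(h_L)`. -/
def relationMap : freeAlgebra X (X.obj L.a) ⟶ freeAlgebra X L.a :=
  freeIncl X L.a - (free X).map L.str

lemma freeη_relationMap : freeη X (X.obj L.a) ≫ (relationMap L).f =
    X.map (freeη X L.a) ≫ freeStr X L.a - L.str ≫ freeη X L.a := by
  rw [← freeη_freeIncl, ← freeη_free_map]
  exact Preadditive.comp_sub _ _ _

/-- By adjunction a cocone consists of morphisms L → T and J → T in C, and its commutativity says
how the structure map of T restricts to X(L). These are the data of an algebra morphism from L ⊕
f_!(J) with entry e. -/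
lemma relationMap_comp_eq_iff {T : Endofunctor.Algebra X} (r : freeAlgebra X L.a ⟶ T)
    (s : freeAlgebra X J ⟶ T) : relationMap L ≫ r = freeMap e ≫ s ↔
      X.map (freeη X L.a ≫ r.f) ≫ T.str = L.str ≫ freeη X L.a ≫ r.f + e ≫ freeη X J ≫ s.f := by
  have h₁ : freeη X (X.obj L.a) ≫ (relationMap L).f ≫ r.f =
      X.map (freeη X L.a ≫ r.f) ≫ T.str - L.str ≫ freeη X L.a ≫ r.f := by
    rw [← Category.assoc, freeη_relationMap, Preadditive.sub_comp, X.map_comp, Category.assoc,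
      Category.assoc, Category.assoc, map_freeStr]
  have h₂ : freeη X (X.obj L.a) ≫ (freeMap e).f ≫ s.f = e ≫ freeη X J ≫ s.f := by
    rw [← Category.assoc, freeη_extend, Category.assoc]
  rw [← sub_eq_iff_eq_add', ← h₁, ← h₂]
  exact ⟨fun h => congrArg (fun t => freeη X (X.obj L.a) ≫ t.f) h, fun h => free_hom_ext h⟩

variable (L) in
/-- The explicit description satisfies the universal property of the Mimo-construction. -/
theorem isPushout_mimoAlgebra : IsPushout (relationMap L) (freeMap e)
    (extend (mimoAlgebra L e) biprod.inl) (mimoι L e) := by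
  refine ⟨⟨(relationMap_comp_eq_iff e _ _).2 ?_⟩, ⟨PushoutCocone.IsColimit.mk _ (fun c =>
    ⟨biprod.desc (freeη X L.a ≫ c.inl.f) c.inr.f, map_biprod_hom_ext ?_ ?_⟩) (fun c => ?_)
    (fun c => ?_) fun c m h₁ h₂ => ?_⟩⟩
  · rw [freeη_extend, map_inl_mimoStr, biprod.lift_eq]
    simp only [mimoι, Category.assoc]
  · rw [← X.map_comp_assoc, biprod.inl_desc, ← Category.assoc, map_inl_mimoStr,
      biprod.lift_desc, Category.assoc]
    exact (relationMap_comp_eq_iff e c.inl c.inr).1 c.condition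
  · rw [← X.map_comp_assoc, biprod.inr_desc, ← Category.assoc, map_inr_mimoStr,
      Category.assoc, biprod.inr_desc]
    exact c.inr.h
  · refine free_hom_ext ?_
    rw [Endofunctor.Algebra.comp_f, ← Category.assoc, freeη_extend]
    exact biprod.inl_desc _ _
  · exact Endofunctor.Algebra.ext (biprod.inr_desc _ _)
  · refine Endofunctor.Algebra.ext (biprod.hom_ext' _ _ ?_ ?_)
    · have := congrArg (fun t => freeη X L.a ≫ t.f) h₁
      rw [Endofunctor.Algebra.comp_f, ← Category.assoc, freeη_extend] at this
      exact this.trans (biprod.inl_desc _ _).symm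
    · exact (congrArg (fun t => t.f) h₂).trans (biprod.inr_desc _ _).symm

lemma free_map_eq_freeMap {M N : C} (g : M ⟶ N) : (free X).map g = freeMap g :=
  free_hom_ext ((freeη_free_map g).trans (freeη_extend (freeAlgebra X N) _).symm)

theorem MimoChoice.isMimo_mimoAlgebra (c : MimoChoice L) : c.IsMimo (mimoAlgebra L c.e) := by
  refine ⟨extend (mimoAlgebra L c.e) biprod.inl, mimoι L c.e, ?_⟩
  have := isPushout_mimoAlgebra L c.e
  rwa [← free_map_eq_freeMap] at this

theorem MimoChoice.IsMimo.nonempty_iso {c : MimoChoice L} {N : Endofunctor.Algebra X}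
    (h : c.IsMimo N) : Nonempty (N ≅ mimoAlgebra L c.e) := by
  obtain ⟨r, s, h⟩ := h
  obtain ⟨r', s', h'⟩ := c.isMimo_mimoAlgebra
  exact ⟨h.isoIsPushout _ _ h'⟩

variable {e}

/-- The projection `freeπ` kills the structure map of f_!(J), so a kernel element is killed by both
h and e. These are jointly monic by hypothesis. -/
theorem mono_mimo (H : ∀ {T : C} (x : T ⟶ X.obj L.a), x ≫ L.str = 0 → x ≫ e = 0 → x = 0) :
    Mono (mimoStr L e) := by
  have : Mono (freeAlgebra X J).str := mono_freeStr X J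
  refine mono_extensionStr fun x y h₁ h₂ => H x h₁ ?_
  have := congrArg (· ≫ freeπ X J) h₂
  simpa only [Preadditive.add_comp, Category.assoc, freeη_freeπ, Category.comp_id, freeStr_freeπ,
    comp_zero, add_zero, zero_comp] using this

end MimoConstruction

/-! ### Existence of the choices and of reduced lifts -/

section Choices
variable {C : Type u} [Category.{v} C] [Abelian C]

theorem HasInjectiveEnvelopes.exists_extension (hC : HasInjectiveEnvelopes C) {M S : C}
    (h : S ⟶ M) : ∃ (J : C) (j : kernel h ⟶ J) (e : S ⟶ J), IsInjectiveEnvelope j ∧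
      kernel.ι h ≫ e = j := by
  obtain ⟨J, j, hj⟩ := hC (kernel h)
  have := hj.injective
  exact ⟨J, j, Injective.factorThru j (kernel.ι h), hj, Injective.comp_factorThru _ _⟩

/-- An extension of j is monic on the kernel of h, so h and e are jointly monic. -/
lemma eq_zero_of_extension {M S J : C} {h : S ⟶ M} {j : kernel h ⟶ J} [Mono j] {e : S ⟶ J}
    (he : kernel.ι h ≫ e = j) {T : C} (x : T ⟶ S) (h₁ : x ≫ h = 0) (h₂ : x ≫ e = 0) : x = 0 := by
  have h₃ : kernel.lift h x h₁ = 0 := by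
    rw [← cancel_mono j, ← he, kernel.lift_ι_assoc, h₂, zero_comp]
  rw [← kernel.lift_ι h x h₁, h₃, zero_comp]

lemma isIso_of_extension {M S J : C} {h : S ⟶ M} {j : kernel h ⟶ J} (hj : IsInjectiveEnvelope j)
    {e : S ⟶ J} (he : kernel.ι h ≫ e = j) (g : J ⟶ J) (hg : kernel.ι h ≫ e ≫ g = kernel.ι h ≫ e) :
    IsIso g :=
  hj.minimal g (by rwa [← Category.assoc, he] at hg)

/-- Any object is isomorphic in the stable category to an object without injective summands. -/
theorem HasMaximalInjectiveSummands.exists_reduction (hC : HasMaximalInjectiveSummands C) (M : C) :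
    ∃ (M' : C) (s : M' ⟶ M) (p : M ⟶ M'), HasNoInjectiveSummand M' ∧
      (toStable (injectives C)).map s ≫ (toStable (injectives C)).map p = 𝟙 _ ∧
      (toStable (injectives C)).map p ≫ (toStable (injectives C)).map s = 𝟙 _ := by
  obtain ⟨M', I, ⟨e⟩, hI, hM'⟩ := hC M
  obtain ⟨h₁, h₂⟩ := toStable_isIso_of_total (N := M') (p := e.hom ≫ biprod.fst)
    (s := biprod.inl ≫ e.inv) (u := e.hom ≫ biprod.snd) (v := biprod.inr ≫ e.inv) (by simp) (by
      rw [← cancel_epi e.inv, ← cancel_mono e.hom]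
      simp)
  exact ⟨M', _, _, hM', h₁, h₂⟩

end Choices

section Lifts
variable {C : Type u} [Category.{v} C] [Abelian C] {X : C ⥤ C} [X.Additive]
  [X.PreservesInjectiveObjects]

/-- A structure map over an endofunctor satisfies no equations, so any representative in C is one.
It is transported to the reduced summand, which is stably isomorphic to the original object. -/
theorem HasMaximalInjectiveSummands.exists_isReducedLift (hC : HasMaximalInjectiveSummands C)
    (M : Endofunctor.Algebra (stableFunctor X)) :
    ∃ L : Endofunctor.Algebra X, IsReducedLift M L := by
  let T := toStable (injectives C)
  obtain ⟨h, hh⟩ := T.map_surjective (X := X.obj M.a.as) (Y := M.a.as) M.str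
  obtain ⟨M', s, p, hM', h₁, h₂⟩ := hC.exists_reduction M.a.as
  let e : T.obj M' ≅ T.obj M.a.as := ⟨T.map s, T.map p, h₁, h₂⟩
  refine ⟨⟨M', X.map s ≫ h ≫ p⟩, hM', ⟨Endofunctor.Algebra.isoMk e ?_⟩⟩
  change T.map (X.map s) ≫ M.str = T.map (X.map s ≫ h ≫ p) ≫ T.map s
  rw [T.map_comp, T.map_comp, Category.assoc, Category.assoc, h₂, Category.comp_id, hh]

end Lifts

/-! ### The theorem for Mono(X) -/

section MainMono
variable {C : Type u} [Category.{v} C] [Abelian C] {X : C ⥤ C} [X.Additive]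
  [PreservesFiniteLimits X] [PreservesFiniteColimits X] [X.PreservesInjectiveObjects]
  [IsLocallyNilpotent X]

instance : (monoToStable X).Additive where
  map_add := Endofunctor.Algebra.ext ((toStable (injectives C)).map_add)

omit [PreservesFiniteLimits X] [PreservesFiniteColimits X] [IsLocallyNilpotent X] in
lemma monoToStable_map_eq_zero_iff {M N : (monoAlgebras X).FullSubcategory} (f : M ⟶ N) :
    (monoToStable X).map f = 0 ↔
      ∃ (J : C) (_ : Injective J) (u : M.obj.a ⟶ J) (v : J ⟶ N.obj.a), u ≫ v = f.hom.f := by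
  rw [← toStable_map_eq_zero_iff]
  exact ⟨fun h => congrArg (fun t => t.f) h, fun h => Endofunctor.Algebra.ext h⟩

/-- A representative in C respects the structure maps up to a morphism through an injective.
`exists_algebraHom` corrects it by a morphism through f_!(I), which is stably zero. -/
instance : (monoToStable X).Full where
  map_surjective {M N} g := by
    let T := toStable (injectives C)
    have hM : Mono M.obj.str := M.property
    obtain ⟨g₀, hg₀⟩ := T.map_surjective (X := M.obj.a) (Y := N.obj.a) g.f
    have h₁ : T.map (M.obj.str ≫ g₀) = T.map (X.map g₀ ≫ N.obj.str) := by
      rw [T.map_comp, hg₀]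
      refine g.h.symm.trans ?_
      rw [← hg₀]
      exact (T.map_comp _ _).symm
    obtain ⟨I, hI, s, t, hst⟩ := (toStable_map_eq_iff _ _).1 h₁
    obtain ⟨φ, b, hφ⟩ := exists_algebraHom (N' := N.obj) g₀ s t hst.symm
    refine ⟨ObjectProperty.homMk φ, Endofunctor.Algebra.ext ?_⟩
    change T.map φ.f = g.f
    rw [hφ, T.map_sub, toStable_map_comp_eq_zero, sub_zero, hg₀]

theorem HasInjectiveEnvelopes.isStablyEpivalent (hC : HasInjectiveEnvelopes C)
    (hC' : HasMaximalInjectiveSummands C) : IsStablyEpivalent (monoToStable X) fun M N =>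
      ∃ L, IsReducedLift M L ∧ ∃ c : MimoChoice L, c.IsMimo N.obj where
  additive := inferInstance
  full := inferInstance
  isZero_of_injective N hN := by
    rw [IsZero.iff_id_eq_zero, ← CategoryTheory.Functor.map_id, monoToStable_map_eq_zero_iff]
    exact ⟨N.obj.a, hC.injective_of_isExactInjective hN, 𝟙 _, 𝟙 _, Category.comp_id _⟩
  factors {N N' N''} θ θ' h h' := by
    obtain ⟨I, hI, u, v, huv⟩ := (monoToStable_map_eq_zero_iff θ).1 h
    obtain ⟨I', hI', u', v', huv'⟩ := (monoToStable_map_eq_zero_iff θ').1 h'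
    have hN : Mono N.obj.str := N.property
    obtain ⟨a, ha⟩ := exists_factorization θ.hom θ'.hom huv huv'
    refine ⟨⟨freeAlgebra X I', mono_freeStr X I'⟩, isExactInjective_free (Iso.refl _),
      ObjectProperty.homMk a, ObjectProperty.homMk (extend N''.obj v'), ?_⟩
    ext1
    exact ha
  isIso_one_sub N hN J hJ a b := hC.isIso_one_sub_of_isReduced hN hJ a b
  exists_complement J N i r h := exists_complement_of_retract i r h
  isReduced := by
    rintro M N ⟨L, hL, c, hN⟩
    obtain ⟨i⟩ := hN.nonempty_iso
    exact hC.isReduced_extension i hL.1 fun g hg =>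
      isIso_of_extension c.isInjectiveEnvelope c.fac g (hg _ (kernel.condition _))
  nonempty_iso := by
    rintro M N ⟨L, ⟨-, ⟨e⟩⟩, c, hN⟩
    obtain ⟨i⟩ := hN.nonempty_iso
    have := c.isInjectiveEnvelope.injective
    -- In C the projection splits, with kernel the injective object f_!(J).
    have h : IsIso ((toStableAlgebra X).map (mimoπ L c.e)) := by
      have : IsIso ((toStableAlgebra X).map (mimoπ L c.e)).f :=
        isIso_toStable_fst L.a (freeCarrier X c.J)
      exact Endofunctor.Algebra.iso_of_iso _
    exact ⟨(toStableAlgebra X).mapIso i ≪≫ asIso ((toStableAlgebra X).map (mimoπ L c.e)) ≪≫ e⟩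
  exists_rel M := by
    obtain ⟨L, hL⟩ := hC'.exists_isReducedLift M
    obtain ⟨J, j, e, hj, he⟩ := hC.exists_extension L.str
    let c : MimoChoice L := ⟨J, j, hj, e, he⟩
    have := hj.mono
    exact ⟨⟨mimoAlgebra L e, mono_mimo fun x h₁ h₂ => eq_zero_of_extension he x h₁ h₂⟩, L, hL, c,
      c.isMimo_mimoAlgebra⟩

omit [X.PreservesInjectiveObjects] [PreservesFiniteLimits X] [PreservesFiniteColimits X] in
lemma isZero_of_isZero_free {I : C} (h : 𝟙 (freeAlgebra X I) = 0) : IsZero I := by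
  rw [IsZero.iff_id_eq_zero, ← top_id (X := X), h]
  exact (congrArg (freeη X I ≫ ·) zero_comp).trans comp_zero

omit [X.PreservesInjectiveObjects] in
/-- The functor `f_!` preserves indecomposability. -/
theorem isIndecomposable_freeMono {I : C} (hI : IsIndecomposable I) :
    IsIndecomposable ((freeMono X).obj I) := by
  refine isIndecomposable_of_idempotents (fun h => hI.1 (isZero_of_isZero_free (X := X)
    (congrArg (fun t => t.hom) (h.eq_of_src (𝟙 _) 0)))) fun e he => ?_
  -- An idempotent whose degree zero part is the identity is an isomorphism by Nakayama, hence the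
  -- identity. Applied to 1 - e this also settles degree zero part 0.
  have key (e : freeAlgebra X I ⟶ freeAlgebra X I) (he : e ≫ e = e) (h : top e = 𝟙 I) :
      e = 𝟙 _ := by
    have : IsIso (top e) := by rw [h]; infer_instance
    have := isIso_of_isIso_top e
    rw [← cancel_epi e, he, Category.comp_id]
  let e' : freeAlgebra X I ⟶ freeAlgebra X I := e.hom
  have he' : e' ≫ e' = e' := congrArg (fun t => t.hom) he
  rcases hI.idempotent (top e') (by rw [← top_comp, he']) with h | h
  · left
    ext1
    have := key (𝟙 _ - e') (by simp [he']) (by rw [top_sub, top_id, h, sub_zero])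
    rwa [sub_eq_self] at this
  · right
    ext1
    exact key e' he' h

omit [X.PreservesInjectiveObjects] [PreservesFiniteLimits X] [PreservesFiniteColimits X] in
lemma freeMap_comp {M N P : C} (g : M ⟶ N) (h : N ⟶ P) :
    freeMap (X := X) (g ≫ h) = freeMap g ≫ freeMap h := by
  rw [extend_comp, Category.assoc, freeη_extend, freeMap, Category.assoc]

/-- The degree zero part recovers I from f_!(I), which gives injectivity on isomorphism classes;
surjectivity is the classification of exact injectives. -/
theorem HasInjectiveEnvelopes.injective_bijection (hC : HasInjectiveEnvelopes C) :
    Set.BijOn (isoMap (freeMono X))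
      (classes fun I => IsIndecomposable I ∧ Injective I)
      (classes fun N => IsIndecomposable N ∧ IsExactInjective (monoAlgebras X) N) := by
  refine ⟨?_, ?_, ?_⟩
  · rintro _ ⟨I, ⟨hI, hI'⟩, rfl⟩
    exact ⟨(freeMono X).obj I, ⟨isIndecomposable_freeMono hI,
      isExactInjective_free (J := I) (Iso.refl _)⟩, rfl⟩
  · rintro _ ⟨I, -, rfl⟩ _ ⟨I', -, rfl⟩ h
    obtain ⟨e⟩ : Nonempty ((freeMono X).obj I ≅ (freeMono X).obj I') := Quotient.exact h
    let e' : freeAlgebra X I ≅ freeAlgebra X I' := (monoAlgebras X).ι.mapIso e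
    exact Quotient.sound ⟨⟨top e'.hom, top e'.inv, by rw [← top_comp, e'.hom_inv_id, top_id],
      by rw [← top_comp, e'.inv_hom_id, top_id]⟩⟩
  · rintro _ ⟨N, ⟨hN, hN'⟩, rfl⟩
    obtain ⟨I, hI, ⟨e⟩⟩ := hC.exists_iso_free hN'
    let e' : (freeMono X).obj I ≅ N := (monoAlgebras X).isoMk e
    have hN := hN.of_iso e'.symm
    refine ⟨isoClass I, ⟨I, ⟨isIndecomposable_of_idempotents (fun h => hN.1 ?_) fun ρ hρ => ?_, hI⟩,
      rfl⟩, Quotient.sound ⟨e'⟩⟩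
    · rw [IsZero.iff_id_eq_zero]
      ext1
      exact free_hom_ext (h.eq_of_src _ _)
    · rcases hN.idempotent (ObjectProperty.homMk (freeMap ρ)) (by
        ext1
        change freeMap ρ ≫ freeMap ρ = freeMap ρ
        rw [← freeMap_comp, hρ]) with h | h
      · left
        have h' : freeMap (X := X) ρ = 0 := congrArg (fun t => t.hom) h
        rw [← top_freeMap (X := X) ρ, h']
        exact (congrArg (freeη X I ≫ ·) zero_comp).trans comp_zero
      · right
        have h' : freeMap (X := X) ρ = 𝟙 _ := congrArg (fun t => t.hom) h
        rw [← top_freeMap (X := X) ρ, h', top_id]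

theorem indecomposablesOfMono (hC : HasInjectiveEnvelopes C)
    (hC' : HasMaximalInjectiveSummands C) : IndecomposablesOfMono X where
  injective_bijection := hC.injective_bijection
  exists_lift := hC'.exists_isReducedLift
  nonempty_choice L := by
    obtain ⟨J, j, e, hj, he⟩ := hC.exists_extension L.str
    exact ⟨⟨J, j, hj, e, he⟩⟩
  exists_mimo c := ⟨_, c.isMimo_mimoAlgebra⟩
  mimo_mem {L} c N hN := by
    obtain ⟨i⟩ := hN.nonempty_iso
    have := c.isInjectiveEnvelope.mono
    have hm : Mono (mimoAlgebra L c.e).str :=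
      mono_mimo fun x h₁ h₂ => eq_zero_of_extension c.fac x h₁ h₂
    have h : N.str ≫ i.hom.f = X.map i.hom.f ≫ (mimoAlgebra L c.e).str := i.hom.h.symm
    have : IsIso i.hom.f := inferInstanceAs (IsIso ((Endofunctor.Algebra.forget X).map i.hom))
    have : Mono (N.str ≫ i.hom.f) := by rw [h]; exact mono_comp _ _
    exact mono_of_mono N.str i.hom.f
  mimo_bijection := (hC.isStablyEpivalent hC').isInverseOfEpivalence

end MainMono

/-! ### The arrow functor of a quiver: exactness and nilpotence -/

section ArrowFunctor
variable (Q : Type u) [Quiver.{v} Q] [FiniteAcyclic Q] (B : Type u') [Category.{v'} B] [Abelian B]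

/-- The endofunctor of the category of families indexed by the vertices whose algebras are the
representations: at a vertex it is the sum over the arrows with this target. -/
def arrowFunctor : (Discrete Q ⥤ B) ⥤ (Discrete Q ⥤ B) where
  obj F := Discrete.functor fun i => ∐ fun a : (Σ k : Q, (k ⟶ i)) => F.obj ⟨a.1⟩
  map {F G} φ := Discrete.natTrans fun i =>
    Limits.Sigma.map (f := fun a : (Σ k : Q, (k ⟶ i.as)) => F.obj ⟨a.1⟩)
      (g := fun a => G.obj ⟨a.1⟩) fun a => φ.app ⟨a.1⟩
  map_id F := NatTrans.ext (funext fun i => Sigma.hom_ext _ _ fun a => by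
    refine (Sigma.ι_map (fun a : (Σ k : Q, (k ⟶ i.as)) => (𝟙 F : F ⟶ F).app ⟨a.1⟩) a).trans ?_
    exact (Category.id_comp _).trans (Category.comp_id _).symm)
  map_comp {F G H} φ ψ := NatTrans.ext (funext fun i => Sigma.hom_ext _ _ fun a => by
    let f (a : Σ k : Q, (k ⟶ i.as)) := φ.app ⟨a.1⟩
    let g (a : Σ k : Q, (k ⟶ i.as)) := ψ.app ⟨a.1⟩
    have h : Sigma.ι _ a ≫ Limits.Sigma.map (fun a => f a ≫ g a) =
        Sigma.ι _ a ≫ Limits.Sigma.map f ≫ Limits.Sigma.map g := by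
      rw [Sigma.ι_map, Sigma.ι_map_assoc, Sigma.ι_map, Category.assoc]
    exact h)

variable {Q B}

/-- The inclusion of the summand of the arrow functor indexed by an arrow. -/
abbrev arrowι (F : Discrete Q ⥤ B) {k i : Q} (α : k ⟶ i) :
    F.obj ⟨k⟩ ⟶ ((arrowFunctor Q B).obj F).obj ⟨i⟩ :=
  Sigma.ι (fun a : (Σ k : Q, (k ⟶ i)) => F.obj ⟨a.1⟩) ⟨k, α⟩

lemma arrowι_map {F G : Discrete Q ⥤ B} (φ : F ⟶ G) {k i : Q} (α : k ⟶ i) :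
    arrowι F α ≫ ((arrowFunctor Q B).map φ).app ⟨i⟩ = φ.app ⟨k⟩ ≫ arrowι G α :=
  Sigma.ι_map (f := fun a : (Σ k : Q, (k ⟶ i)) => F.obj ⟨a.1⟩) (g := fun a => G.obj ⟨a.1⟩)
    (fun a => φ.app ⟨a.1⟩) ⟨k, α⟩

lemma arrow_hom_ext {F : Discrete Q ⥤ B} {i : Q} {M : B}
    {f g : ((arrowFunctor Q B).obj F).obj ⟨i⟩ ⟶ M}
    (h : ∀ (k : Q) (α : k ⟶ i), arrowι F α ≫ f = arrowι F α ≫ g) : f = g :=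
  Sigma.hom_ext _ _ fun a => h a.1 a.2

instance : (arrowFunctor Q B).Additive where
  map_add {F G φ ψ} := NatTrans.ext (funext fun ⟨i⟩ => arrow_hom_ext fun k α => by
    rw [NatTrans.app_add, Preadditive.comp_add, arrowι_map, arrowι_map, arrowι_map,
      NatTrans.app_add, Preadditive.add_comp])

/-- The value of the arrow functor at a vertex as a colimit. -/
def arrowFunctorIso (F : Discrete Q ⥤ B) (i : Q) : ((arrowFunctor Q B).obj F).obj ⟨i⟩ ≅
    colimit (Discrete.functor (fun a : (Σ k : Q, (k ⟶ i)) => Discrete.mk a.1) ⋙ F) :=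
  HasColimit.isoOfNatIso (F := Discrete.functor fun a : (Σ k : Q, (k ⟶ i)) => F.obj ⟨a.1⟩)
    (Discrete.natIso fun _ => Iso.refl _)

lemma arrowι_arrowFunctorIso (F : Discrete Q ⥤ B) {k i : Q} (α : k ⟶ i) :
    arrowι F α ≫ (arrowFunctorIso F i).hom =
      colimit.ι (Discrete.functor (fun a : (Σ k : Q, (k ⟶ i)) => Discrete.mk a.1) ⋙ F)
        ⟨⟨k, α⟩⟩ :=
  (HasColimit.isoOfNatIso_ι_hom
    (F := Discrete.functor fun a : (Σ k : Q, (k ⟶ i)) => F.obj ⟨a.1⟩) _ ⟨⟨k, α⟩⟩).trans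
      (Category.id_comp _)

variable (Q B) in
/-- The arrow functor at a vertex as a coproduct functor. -/
def arrowFunctorEvaluation (i : Q) : arrowFunctor Q B ⋙ (evaluation (Discrete Q) B).obj ⟨i⟩ ≅
    (Functor.whiskeringLeft (Discrete (Σ k : Q, (k ⟶ i))) (Discrete Q) B).obj
      (Discrete.functor fun a => ⟨a.1⟩) ⋙ colim :=
  NatIso.ofComponents (fun F => arrowFunctorIso F i) fun {F G} φ => arrow_hom_ext fun k α => by
    have h₁ := congrArg (· ≫ (arrowFunctorIso G i).hom) (arrowι_map φ α)
    simp only [Category.assoc, arrowι_arrowFunctorIso] at h₁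
    refine h₁.trans ?_
    have h₂ := congrArg (· ≫ colim.map (Functor.whiskerLeft (Discrete.functor
      (fun a : (Σ k : Q, (k ⟶ i)) => Discrete.mk a.1)) φ)) (arrowι_arrowFunctorIso F α)
    refine Eq.trans ?_ (h₂.symm.trans (Category.assoc _ _ _))
    exact (colimit.ι_map (Functor.whiskerLeft (Discrete.functor
      (fun a : (Σ k : Q, (k ⟶ i)) => Discrete.mk a.1)) φ) ⟨⟨k, α⟩⟩).symm

/-- Limits are computed at the vertices, where the functor is a sum over finitely many arrows;
finite sums are also products. -/
instance : PreservesFiniteLimits (arrowFunctor Q B) :=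
  preservesFiniteLimits_of_evaluation _ fun ⟨i⟩ => by
    have : PreservesFiniteLimits
        (colim (J := Discrete (Σ k : Q, (k ⟶ i))) (C := B)) :=
      have := Abelian.hasFiniteBiproducts (C := B)
      preservesFiniteLimits_of_natIso HasBiproductsOfShape.colimIsoLim.symm
    have : PreservesFiniteLimits ((Functor.whiskeringLeft (Discrete (Σ k : Q, (k ⟶ i)))
      (Discrete Q) B).obj (Discrete.functor fun a => ⟨a.1⟩)) :=
        ⟨fun J _ _ => whiskeringLeft_preservesLimitsOfShape J _⟩
    have := comp_preservesFiniteLimits ((Functor.whiskeringLeft (Discrete (Σ k : Q, (k ⟶ i)))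
      (Discrete Q) B).obj (Discrete.functor fun a => ⟨a.1⟩)) colim
    exact preservesFiniteLimits_of_natIso (arrowFunctorEvaluation Q B i).symm

instance : PreservesFiniteColimits (arrowFunctor Q B) :=
  preservesFiniteColimits_of_evaluation _ fun ⟨i⟩ => by
    have : PreservesFiniteColimits
        (colim (J := Discrete (Σ k : Q, (k ⟶ i))) (C := B)) := inferInstance
    have : PreservesFiniteColimits ((Functor.whiskeringLeft (Discrete (Σ k : Q, (k ⟶ i)))
      (Discrete Q) B).obj (Discrete.functor fun a => ⟨a.1⟩)) :=
        ⟨fun J _ _ => whiskeringLeft_preservesColimitsOfShape J _⟩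
    have := comp_preservesFiniteColimits ((Functor.whiskeringLeft (Discrete (Σ k : Q, (k ⟶ i)))
      (Discrete Q) B).obj (Discrete.functor fun a => ⟨a.1⟩)) colim
    exact preservesFiniteColimits_of_natIso (arrowFunctorEvaluation Q B i).symm

lemma sigma_total {ι : Type*} [Fintype ι] [DecidableEq ι] (f : ι → B) : ∑ i, Sigma.π f i ≫ Sigma.ι f i = 𝟙 (∐ f) := by
  refine Sigma.hom_ext _ _ fun i => ?_
  rw [Preadditive.comp_sum, Finset.sum_eq_single i, Sigma.ι_π_eq_id_assoc, Category.comp_id]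
  · exact fun j _ hj => by rw [Sigma.ι_π_of_ne_assoc _ hj.symm, zero_comp]
  · simp

lemma injective_sigma {ι : Type*} [Finite ι] (f : ι → B) [∀ i, Injective (f i)] :
    Injective (∐ f) where
  factors g m _ := by
    classical
    have := Fintype.ofFinite ι
    refine ⟨∑ i, Injective.factorThru (g ≫ Sigma.π f i) m ≫ Sigma.ι f i, ?_⟩
    simp only [Preadditive.comp_sum, Injective.comp_factorThru_assoc, Category.assoc]
    rw [← Preadditive.comp_sum, sigma_total, Category.comp_id]

lemma isZero_sigma {ι : Type*} [Finite ι] {f : ι → B} (h : ∀ i, IsZero (f i)) : IsZero (∐ f) :=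
  (IsZero.iff_id_eq_zero _).2 (Sigma.hom_ext _ _ fun i => (h i).eq_of_src _ _)

/-- The value of the n-th power at i is an iterated sum over the paths of length n ending at i. The
induction splits off the last arrow. -/
lemma isZero_power_arrowFunctor (F : Discrete Q ⥤ B) (n : ℕ) (i : Q)
    (h : ∀ (k : Q) (p : Quiver.Path k i), p.length ≠ n) :
    IsZero (((power (arrowFunctor Q B) n).obj F).obj ⟨i⟩) := by
  induction n generalizing i with
  | zero => exact absurd rfl (h i Quiver.Path.nil)
  | succ n ih =>
    exact isZero_sigma fun a => ih a.1 fun k p hp => h k (p.cons a.2) (by simp [hp])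

/-- There are only finitely many paths, so some n is not the length of any path. -/
instance : IsLocallyNilpotent (arrowFunctor Q B) where
  exists_isZero F := by
    have := FiniteAcyclic.finite_vertices (Q := Q)
    obtain ⟨n, hn⟩ := (Set.finite_range
      fun p : (Σ j : Q, Σ i : Q, Quiver.Path i j) => p.2.2.length).exists_notMem
    refine ⟨n, Functor.isZero _ fun ⟨i⟩ => isZero_power_arrowFunctor F n i fun k p hp => hn ?_⟩
    exact ⟨⟨i, k, p⟩, hp⟩

end ArrowFunctor

/-! ### Injective families of objects -/

section Families
variable {Q : Type u} {B : Type u'} [Category.{v'} B] [Abelian B]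

lemma injective_of_injective_obj {F : Discrete Q ⥤ B} (h : ∀ i : Q, Injective (F.obj ⟨i⟩)) :
    Injective F where
  factors {A A'} g f _ := by
    have h' (i : Q) : ∃ e : A'.obj ⟨i⟩ ⟶ F.obj ⟨i⟩, f.app ⟨i⟩ ≫ e = g.app ⟨i⟩ :=
      ⟨Injective.factorThru (g.app ⟨i⟩) (f.app ⟨i⟩), Injective.comp_factorThru _ _⟩
    choose e he using h'
    exact ⟨Discrete.natTrans fun i => e i.as, NatTrans.ext (funext fun ⟨i⟩ => he i)⟩

theorem HasInjectiveEnvelopes.families (hB : HasInjectiveEnvelopes B) :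
    HasInjectiveEnvelopes (Discrete Q ⥤ B) := by
  intro F
  choose I j hj using fun i : Q => hB (F.obj ⟨i⟩)
  refine ⟨Discrete.functor I, Discrete.natTrans fun i => j i.as, ?_, ?_, fun g hg => ?_⟩
  · exact (NatTrans.mono_iff_mono_app _).2 fun i => (hj i.as).mono
  · exact injective_of_injective_obj fun i => (hj i).injective
  · have (i : Discrete Q) : IsIso (g.app i) :=
      (hj i.as).minimal _ (congrArg (fun t => t.app i) hg)
    exact NatIso.isIso_of_isIso_app g

/-- An injective family is a retract of the family of envelopes of its objects; evaluate this
retraction at a vertex. -/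
theorem HasInjectiveEnvelopes.injective_obj (hB : HasInjectiveEnvelopes B) (F : Discrete Q ⥤ B)
    [Injective F] (i : Q) : Injective (F.obj ⟨i⟩) := by
  choose I j hj using fun i : Q => hB (F.obj ⟨i⟩)
  let φ : F ⟶ Discrete.functor I := Discrete.natTrans fun i => j i.as
  have : Mono φ := (NatTrans.mono_iff_mono_app _).2 fun i => (hj i.as).mono
  have h := congrArg (fun t => t.app ⟨i⟩) (Injective.comp_factorThru (𝟙 F) φ)
  have : Injective (I i) := (hj i).injective
  exact Retract.injective (X := F.obj ⟨i⟩) (Y := I i) ⟨j i, (Injective.factorThru (𝟙 F) φ).app ⟨i⟩, h⟩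

theorem hasNoInjectiveSummand_of_obj (hB : HasInjectiveEnvelopes B) {F : Discrete Q ⥤ B}
    (h : ∀ i : Q, HasNoInjectiveSummand (F.obj ⟨i⟩)) : HasNoInjectiveSummand F := by
  rintro I N hI ⟨e⟩
  refine Functor.isZero _ fun ⟨i⟩ => ?_
  have := hB.injective_obj I i
  refine (h i).isZero_of_retract ((biprod.inr ≫ e.inv).app ⟨i⟩) ((e.hom ≫ biprod.snd).app ⟨i⟩) ?_
  rw [← NatTrans.comp_app]
  simp

variable [Quiver.{v} Q] [FiniteAcyclic Q]

theorem HasInjectiveEnvelopes.arrowFunctor_preservesInjectiveObjects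
    (hB : HasInjectiveEnvelopes B) : (arrowFunctor Q B).PreservesInjectiveObjects where
  injective_obj {F} hF := injective_of_injective_obj fun i => by
    have := hB.injective_obj F
    exact injective_sigma fun a : (Σ k : Q, (k ⟶ i)) => F.obj ⟨a.1⟩

end Families

/-! ### Transport of exact injectivity along equivalences -/

section Transport
variable {A : Type u} [Category.{v} A] [Preadditive A] {A' : Type u'} [Category.{v'} A']
  [Preadditive A']

lemma IsConflation.map (F : A ⥤ A') [F.IsEquivalence] {L M K : A} {f : L ⟶ M} {g : M ⟶ K}
    (h : IsConflation f g) : IsConflation (F.map f) (F.map g) := by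
  obtain ⟨w, ⟨hf⟩, ⟨hg⟩⟩ := h
  exact ⟨by rw [← F.map_comp, w, F.map_zero], ⟨KernelFork.mapIsLimit _ hf F⟩,
    ⟨CokernelCofork.mapIsColimit _ hg F⟩⟩

/-- An extension problem is carried to the other category by the inverse functor, solved there, and
carried back through the unit and counit. -/
theorem IsExactInjective.of_equivalence (E : A ≌ A') {P : ObjectProperty A}
    {P' : ObjectProperty A'} (hP : ∀ M, P' M → P (E.inverse.obj M)) {N : P.FullSubcategory}
    (hN : IsExactInjective P N) {N' : P'.FullSubcategory} (i : E.functor.obj N.obj ≅ N'.obj) :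
    IsExactInjective P' N' := by
  intro L M K hL hM hK f g hfg u
  obtain ⟨w, hw⟩ := hN (hP _ hL) (hP _ hM) (hP _ hK) _ _ (hfg.map E.inverse)
    (E.inverse.map (u ≫ i.inv) ≫ E.unitInv.app N.obj)
  refine ⟨E.counitInv.app M ≫ E.functor.map w ≫ i.hom, ?_⟩
  have h := congrArg E.functor.map hw
  simp only [Functor.map_comp, Equivalence.fun_inv_map, Category.assoc] at h
  rw [← cancel_epi (E.counit.app L)]
  have h' := congrArg (· ≫ i.hom) h
  simp at h'
  simpa using h'

end Transport

/-! ### Representations as algebras over the arrow functor -/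

section Representations
variable {Q : Type u} [Quiver.{v} Q] {B : Type u'} [Category.{v'} B]

lemma naturality_of_arr {F G : Paths Q ⥤ B} (f : ∀ i : Paths Q, F.obj i ⟶ G.obj i)
    (h : ∀ {i j : Q} (α : i ⟶ j), F.map ((Paths.of Q).map α) ≫ f ((Paths.of Q).obj j) =
      f ((Paths.of Q).obj i) ≫ G.map ((Paths.of Q).map α)) {i j : Paths Q} (p : i ⟶ j) :
    F.map p ≫ f j = f i ≫ G.map p := by
  refine Paths.induction (V := Q) (fun {i j} p => F.map p ≫ f j = f i ≫ G.map p) ?_ ?_ p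
  · intro i
    rw [F.map_id, G.map_id, Category.id_comp, Category.comp_id]
  · intro i j k p α hp
    rw [F.map_comp, G.map_comp, Category.assoc, h α, ← Category.assoc, hp, Category.assoc]

/-- A family of morphisms which is compatible with the arrows is a morphism of representations. -/
def repHom {F G : Paths Q ⥤ B} (f : ∀ i : Q, vertex F i ⟶ vertex G i)
    (h : ∀ {i j : Q} (α : i ⟶ j), arr F α ≫ f j = f i ≫ arr G α) : F ⟶ G where
  app i := f i
  naturality := fun _ _ p => naturality_of_arr (fun i : Paths Q => f i) (fun α => h α) p

lemma rep_hom_ext {F G : Paths Q ⥤ B} {f g : F ⟶ G}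
    (h : ∀ i : Q, f.app ((Paths.of Q).obj i) = g.app ((Paths.of Q).obj i)) : f = g :=
  NatTrans.ext (funext h)

variable [FiniteAcyclic Q] [Abelian B]

/-- The underlying family of objects of a representation. -/
abbrev vertices (F : Paths Q ⥤ B) : Discrete Q ⥤ B := Discrete.functor fun i => vertex F i

/-- The morphism of families underlying a morphism of representations. -/
abbrev verticesMap {F G : Paths Q ⥤ B} (φ : F ⟶ G) : vertices F ⟶ vertices G :=
  Discrete.natTrans fun i => φ.app ((Paths.of Q).obj i.as)

lemma ι_into (F : Paths Q ⥤ B) {k i : Q} (α : k ⟶ i) :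
    arrowι (vertices F) α ≫ into F i = arr F α :=
  Sigma.ι_desc (fun a : (Σ k : Q, (k ⟶ i)) => arr F a.2) ⟨k, α⟩

/-- The structure map given by a representation. -/
def repStr (F : Paths Q ⥤ B) : (arrowFunctor Q B).obj (vertices F) ⟶ vertices F :=
  Discrete.natTrans fun i => into F i.as

lemma arrowι_repStr (F : Paths Q ⥤ B) {k i : Q} (α : k ⟶ i) :
    arrowι (vertices F) α ≫ (repStr F).app ⟨i⟩ = arr F α := ι_into F α

variable (Q B) in
/-- Representations as algebras over the arrow functor. -/
def repAlgebra : (Paths Q ⥤ B) ⥤ Endofunctor.Algebra (arrowFunctor Q B) where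
  obj F := ⟨vertices F, repStr F⟩
  map {F G} φ := ⟨verticesMap φ, NatTrans.ext (funext fun ⟨i⟩ => arrow_hom_ext fun k α => by
    rw [NatTrans.comp_app, NatTrans.comp_app, ← Category.assoc, arrowι_map, Category.assoc,
      arrowι_repStr, ← Category.assoc, arrowι_repStr]
    exact (φ.naturality _).symm)⟩

instance : (repAlgebra Q B).Faithful where
  map_injective {F G _ _} h := rep_hom_ext fun i =>
    congrArg (fun t : (repAlgebra Q B).obj F ⟶ (repAlgebra Q B).obj G => t.f.app ⟨i⟩) h

lemma arr_comp_of_algebraHom {F G : Paths Q ⥤ B} (f : vertices F ⟶ vertices G)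
    (h : (arrowFunctor Q B).map f ≫ repStr G = repStr F ≫ f) {i j : Q} (α : i ⟶ j) :
    arr F α ≫ f.app ⟨j⟩ = f.app ⟨i⟩ ≫ arr G α := by
  rw [← arrowι_repStr, ← arrowι_repStr, Category.assoc, ← NatTrans.comp_app, ← h,
    NatTrans.comp_app, ← Category.assoc, arrowι_map, Category.assoc]

instance : (repAlgebra Q B).Full where
  map_surjective {F G} φ := by
    refine ⟨repHom (fun i => φ.f.app ⟨i⟩) fun {i j} α => ?_, Endofunctor.Algebra.ext rfl⟩
    have h : (arrowFunctor Q B).map φ.f ≫ repStr G = repStr F ≫ φ.f := φ.h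
    exact (arr_comp_of_algebraHom _ h α)

/-- An arrow acts by the restriction of the structure map to its summand. Since Q has no relations,
these actions extend uniquely to paths. -/
instance : (repAlgebra Q B).EssSurj where
  mem_essImage N := by
    let F : Paths Q ⥤ B := Paths.lift
      { obj := fun i => N.a.obj ⟨i⟩
        map := fun {i j} α => arrowι N.a α ≫ N.str.app ⟨j⟩ }
    let e : vertices F ≅ N.a := Discrete.natIso fun i => Iso.refl _
    refine ⟨F, ⟨Endofunctor.Algebra.isoMk e ?_⟩⟩
    refine NatTrans.ext (funext fun ⟨i⟩ => arrow_hom_ext fun k α => ?_)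
    rw [NatTrans.comp_app, ← Category.assoc, arrowι_map]
    have h : arr F α = arrowι N.a α ≫ N.str.app ⟨i⟩ := Paths.lift_toPath _ _
    refine (Category.assoc _ _ _).trans ((Category.id_comp _).trans ?_)
    refine h.symm.trans ((arrowι_repStr F α).symm.trans ?_)
    exact congrArg (arrowι (vertices F) α ≫ ·) (Category.comp_id _).symm

instance : (repAlgebra Q B).IsEquivalence where

lemma monoReps_iff (F : Paths Q ⥤ B) :
    monoReps Q B F ↔ monoAlgebras (arrowFunctor Q B) ((repAlgebra Q B).obj F) :=
  Iff.trans ⟨fun h (i : Discrete Q) => h i.as, fun h i => h ⟨i⟩⟩ (NatTrans.mono_iff_mono_app (repStr F)).symm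

lemma monoAlgebras_of_iso {C : Type u} [Category.{v} C] [Abelian C] {X : C ⥤ C} [X.Additive]
    {M N : Endofunctor.Algebra X} (i : N ≅ M) (hM : monoAlgebras X M) : monoAlgebras X N := by
  have : Mono M.str := hM
  have : IsIso i.hom.f := inferInstanceAs (IsIso ((Endofunctor.Algebra.forget X).map i.hom))
  have : Mono (N.str ≫ i.hom.f) := by rw [← i.hom.h]; exact mono_comp _ _
  exact mono_of_mono N.str i.hom.f

variable (Q B) in
/-- The monomorphism category of representations as a monomorphism category of algebras. -/
def monoRepAlgebra : (monoReps Q B).FullSubcategory ⥤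
    (monoAlgebras (arrowFunctor Q B)).FullSubcategory :=
  (monoAlgebras (arrowFunctor Q B)).lift ((monoReps Q B).ι ⋙ repAlgebra Q B)
    fun F => (monoReps_iff F.obj).1 F.property

instance : (monoRepAlgebra Q B).Faithful := by unfold monoRepAlgebra; infer_instance
instance : (monoRepAlgebra Q B).Full := by unfold monoRepAlgebra; infer_instance

instance : (monoRepAlgebra Q B).EssSurj where
  mem_essImage N := by
    let e := (repAlgebra Q B).objObjPreimageIso N.obj
    refine ⟨⟨(repAlgebra Q B).objPreimage N.obj, (monoReps_iff _).2
      (monoAlgebras_of_iso e N.property)⟩, ⟨(ObjectProperty.fullyFaithfulι _).preimageIso e⟩⟩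

instance : (monoRepAlgebra Q B).IsEquivalence where

lemma isExactInjective_rep_iff (N : (monoReps Q B).FullSubcategory) :
    IsExactInjective (monoReps Q B) N ↔
      IsExactInjective (monoAlgebras (arrowFunctor Q B)) ((monoRepAlgebra Q B).obj N) := by
  let E := (repAlgebra Q B).asEquivalence
  constructor
  · intro h
    exact h.of_equivalence E (fun M hM => (monoReps_iff _).2
      (monoAlgebras_of_iso (E.counitIso.app M) hM)) (Iso.refl _)
  · intro h
    exact h.of_equivalence E.symm (fun M hM => (monoReps_iff _).1 hM) (E.unitIso.app N.obj).symm

instance : IsIdempotentComplete (monoReps Q B).FullSubcategory :=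
  (Idempotents.isIdempotentComplete_iff_of_equivalence (monoRepAlgebra Q B).asEquivalence).2
    inferInstance

instance : HasBinaryBiproducts (monoReps Q B).FullSubcategory := by
  have : HasBinaryProducts (monoReps Q B).FullSubcategory :=
    Adjunction.hasLimitsOfShape_of_equivalence (monoRepAlgebra Q B)
  exact HasBinaryBiproducts.of_hasBinaryProducts

instance : (repAlgebra Q B).Additive where
  map_add := Endofunctor.Algebra.ext rfl

instance : (monoRepAlgebra Q B).Additive where
  map_add := rfl

lemma isReduced_rep {N : (monoReps Q B).FullSubcategory}
    (h : IsReduced (monoAlgebras (arrowFunctor Q B)) ((monoRepAlgebra Q B).obj N)) :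
    IsReduced (monoReps Q B) N := by
  intro J hJ i r hir
  have h₀ := h _ ((isExactInjective_rep_iff J).1 hJ) ((monoRepAlgebra Q B).map i)
    ((monoRepAlgebra Q B).map r) (by rw [← Functor.map_comp, hir, CategoryTheory.Functor.map_id])
  rw [IsZero.iff_id_eq_zero] at h₀ ⊢
  exact (monoRepAlgebra Q B).map_injective (by rw [CategoryTheory.Functor.map_id, h₀, Functor.map_zero])

end Representations

/-! ### A recognition criterion for the Mimo-construction -/

section
variable {C : Type u} [Category.{v} C] [Abelian C] {X : C ⥤ C} [X.Additive] [IsLocallyNilpotent X]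

/-- A direct sum of L and a copy P of f_!(J), with the triangular structure map given by e, is the
Mimo-construction. Allowing P to be only isomorphic to f_!(J) admits the description by paths. -/
theorem nonempty_iso_mimoAlgebra_of_biproduct {L M P : Endofunctor.Algebra X} {J : C}
    {e : X.obj L.a ⟶ J} (θ : freeAlgebra X J ⟶ P) (θ' : P.a ⟶ freeCarrier X J)
    (h₁ : θ.f ≫ θ' = 𝟙 _) (h₂ : θ' ≫ θ.f = 𝟙 _) (i : L.a ⟶ M.a) (j : P.a ⟶ M.a) (p : M.a ⟶ L.a)
    (q : M.a ⟶ P.a) (hip : i ≫ p = 𝟙 _) (hiq : i ≫ q = 0) (hjp : j ≫ p = 0) (hjq : j ≫ q = 𝟙 _)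
    (ht : p ≫ i + q ≫ j = 𝟙 _) (hi : X.map i ≫ M.str = L.str ≫ i + e ≫ freeη X J ≫ θ.f ≫ j)
    (hj : X.map j ≫ M.str = P.str ≫ j) : Nonempty (M ≅ mimoAlgebra L e) := by
  let φ : mimoAlgebra L e ⟶ M := ⟨biprod.desc i (θ.f ≫ j), by
    refine map_biprod_hom_ext ?_ ?_
    · rw [← Functor.map_comp_assoc, biprod.inl_desc, hi, ← Category.assoc (X.map _) (mimoStr L e),
        map_inl_mimoStr, biprod.lift_desc, Category.assoc]
    · rw [← Functor.map_comp_assoc, biprod.inr_desc, Functor.map_comp, Category.assoc, hj,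
        ← Category.assoc (X.map _) (mimoStr L e), map_inr_mimoStr, Category.assoc, biprod.inr_desc,
        ← Category.assoc, ← Category.assoc]
      exact congrArg (· ≫ j) θ.h⟩
  have : IsIso φ.f := by
    refine ⟨biprod.lift p (q ≫ θ'), ?_, ?_⟩
    · refine biprod.hom_ext _ _ ?_ ?_
      · refine biprod.hom_ext' _ _ ?_ ?_ <;> simp [φ, hip, hjp]
      · refine biprod.hom_ext' _ _ ?_ ?_ <;> simp [φ, reassoc_of% hiq, reassoc_of% hjq, h₁]
    · simp [φ, reassoc_of% h₂, ht]
  have := isIso_of_isIso_f φ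
  exact ⟨(asIso φ).symm⟩

end

/-! ### The description of free algebras by paths -/

section PathAlgebra
variable {Q : Type u} [Quiver.{v} Q] [FiniteAcyclic Q] {B : Type u'} [Category.{v'} B] [Abelian B]

/-- The inclusion of the summand indexed by a path. -/
abbrev pathSumι (J : Q → B) {k i : Q} (p : Quiver.Path k i) :
    J k ⟶ ∐ fun p : (Σ k : Q, Quiver.Path k i) => J p.1 :=
  Sigma.ι (fun p : (Σ k : Q, Quiver.Path k i) => J p.1) ⟨k, p⟩

lemma pathSum_hom_ext {J : Q → B} {i : Q} {M : B}
    {f g : (∐ fun p : (Σ k : Q, Quiver.Path k i) => J p.1) ⟶ M}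
    (h : ∀ (k : Q) (p : Quiver.Path k i), pathSumι J p ≫ f = pathSumι J p ≫ g) : f = g :=
  Sigma.hom_ext _ _ fun p => h p.1 p.2

/-- The action of an arrow on the sums over paths. -/
def pathSumMap (J : Q → B) {k i : Q} (α : k ⟶ i) :
    (∐ fun p : (Σ l : Q, Quiver.Path l k) => J p.1) ⟶ ∐ fun p : (Σ l : Q, Quiver.Path l i) => J p.1 :=
  Limits.Sigma.desc fun p => pathSumι J (p.2.cons α)

lemma pathSumι_map (J : Q → B) {l k i : Q} (p : Quiver.Path l k) (α : k ⟶ i) :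
    pathSumι J p ≫ pathSumMap J α = pathSumι J (p.cons α) :=
  Sigma.ι_desc (fun p : (Σ l : Q, Quiver.Path l k) => pathSumι J (p.2.cons α)) ⟨l, p⟩

/-- The family of the sums over paths. -/
abbrev pathFamily (J : Q → B) : Discrete Q ⥤ B :=
  Discrete.functor fun i => ∐ fun p : (Σ l : Q, Quiver.Path l i) => J p.1

/-- The structure map of the family of the sums over paths. -/
def pathStr (J : Q → B) : (arrowFunctor Q B).obj (pathFamily J) ⟶ pathFamily J :=
  Discrete.natTrans fun i => Limits.Sigma.desc
    fun a : (Σ k : Q, (k ⟶ i.as)) => pathSumMap J a.2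

lemma arrowι_pathStr (J : Q → B) {k i : Q} (α : k ⟶ i) :
    arrowι (pathFamily J) α ≫ (pathStr J).app ⟨i⟩ = pathSumMap J α :=
  Sigma.ι_desc (fun a : (Σ k : Q, (k ⟶ i)) => pathSumMap J a.2) ⟨k, α⟩

/-- The path description of the free algebra. -/
abbrev pathAlgebra (J : Q → B) : Endofunctor.Algebra (arrowFunctor Q B) := ⟨pathFamily J, pathStr J⟩

/-- The component of the comparison with the free algebra at a path. -/
def pathComp (J : Q → B) {k : Q} : ∀ {i : Q}, Quiver.Path k i →
    (J k ⟶ (freeCarrier (arrowFunctor Q B) (Discrete.functor J)).obj ⟨i⟩)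
  | _, .nil => (freeη (arrowFunctor Q B) (Discrete.functor J)).app ⟨k⟩
  | i, .cons p α => pathComp J p ≫ arrowι _ α ≫
      (freeStr (arrowFunctor Q B) (Discrete.functor J)).app ⟨i⟩

/-- The comparison from the path description to the free algebra. -/
def pathToFree (J : Q → B) :
    pathFamily J ⟶ freeCarrier (arrowFunctor Q B) (Discrete.functor J) :=
  Discrete.natTrans fun i => Limits.Sigma.desc
    fun p : (Σ l : Q, Quiver.Path l i.as) => pathComp J p.2

lemma pathSumι_pathToFree (J : Q → B) {k i : Q} (p : Quiver.Path k i) :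
    pathSumι J p ≫ (pathToFree J).app ⟨i⟩ = pathComp J p :=
  Sigma.ι_desc (fun p : (Σ l : Q, Quiver.Path l i) => pathComp J p.2) ⟨k, p⟩

lemma pathStr_pathToFree (J : Q → B) : pathStr J ≫ pathToFree J =
    (arrowFunctor Q B).map (pathToFree J) ≫ freeStr (arrowFunctor Q B) (Discrete.functor J) := by
  refine NatTrans.ext (funext fun ⟨i⟩ => arrow_hom_ext fun k α => ?_)
  rw [NatTrans.comp_app, NatTrans.comp_app, ← Category.assoc, arrowι_pathStr, ← Category.assoc,
    arrowι_map]
  refine pathSum_hom_ext fun l p => ?_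
  rw [← Category.assoc, pathSumι_map, pathSumι_pathToFree, Category.assoc, ← Category.assoc,
    pathSumι_pathToFree]
  rfl

/-- The comparison from the free algebra to the path description. -/
def freeToPath (J : Q → B) : freeAlgebra (arrowFunctor Q B) (Discrete.functor J) ⟶ pathAlgebra J :=
  extend (pathAlgebra J) (Discrete.natTrans fun i => pathSumι J (Quiver.Path.nil (a := i.as)))

lemma freeη_freeToPath (J : Q → B) (i : Q) :
    (freeη (arrowFunctor Q B) (Discrete.functor J)).app ⟨i⟩ ≫ (freeToPath J).f.app ⟨i⟩ =
      pathSumι J Quiver.Path.nil := by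
  let g : Discrete.functor J ⟶ pathFamily J :=
    Discrete.natTrans fun i => pathSumι J (Quiver.Path.nil (a := i.as))
  have h : freeη (arrowFunctor Q B) (Discrete.functor J) ≫ (freeToPath J).f = g :=
    freeη_extend (pathAlgebra J) g
  exact congrArg (fun t => t.app ⟨i⟩) h

/-- By induction on the path: the last arrow acts through the structure map, which the algebra
morphism `freeToPath` respects. -/
lemma pathComp_freeToPath (J : Q → B) {k i : Q} (p : Quiver.Path k i) :
    pathComp J p ≫ (freeToPath J).f.app ⟨i⟩ = pathSumι J p := by
  induction p with
  | nil => exact freeη_freeToPath J k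
  | cons p α ih =>
    rename_i l i
    have h : (arrowFunctor Q B).map (freeToPath J).f ≫ pathStr J =
      freeStr (arrowFunctor Q B) (Discrete.functor J) ≫ (freeToPath J).f := (freeToPath J).h
    rw [pathComp, Category.assoc, Category.assoc, ← NatTrans.comp_app, ← h, NatTrans.comp_app,
      ← Category.assoc (arrowι _ _), arrowι_map, Category.assoc, arrowι_pathStr, ← Category.assoc,
      ih, pathSumι_map]

lemma pathToFree_freeToPath (J : Q → B) : pathToFree J ≫ (freeToPath J).f = 𝟙 _ :=
  NatTrans.ext (funext fun ⟨i⟩ => pathSum_hom_ext fun k p => by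
    rw [NatTrans.comp_app, ← Category.assoc, pathSumι_pathToFree, pathComp_freeToPath]
    exact (Category.comp_id _).symm)

/-- An algebra endomorphism of a free algebra is determined on generators, where the composite is
the inclusion of generators. -/
lemma freeToPath_pathToFree (J : Q → B) : (freeToPath J).f ≫ pathToFree J = 𝟙 _ := by
  let φ : pathAlgebra J ⟶ freeAlgebra (arrowFunctor Q B) (Discrete.functor J) :=
    ⟨pathToFree J, (pathStr_pathToFree J).symm⟩
  have h : freeToPath J ≫ φ = 𝟙 _ := free_hom_ext (NatTrans.ext (funext fun ⟨i⟩ => by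
    refine (congrArg (fun t => _ ≫ t) (NatTrans.comp_app (freeToPath J).f (pathToFree J) ⟨i⟩)).trans ?_
    refine (Category.assoc _ _ _).symm.trans ((congrArg (· ≫ _) (freeη_freeToPath J i)).trans ?_)
    exact (pathSumι_pathToFree J Quiver.Path.nil).trans (Category.comp_id _).symm))
  exact congrArg Endofunctor.Algebra.Hom.f h

end PathAlgebra

/-! ### The Mimo-construction of a representation -/

namespace RepMimoChoice
variable {Q : Type u} [Quiver.{v} Q] [FiniteAcyclic Q] {B : Type u'} [Category.{v'} B] [Abelian B]
variable {L : Paths Q ⥤ B} (c : RepMimoChoice L)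

/-- The family of the extensions. -/
def familyE : (arrowFunctor Q B).obj (vertices L) ⟶ Discrete.functor c.J :=
  Discrete.natTrans fun i => c.e i.as

/-- The inclusion of the summand indexed by an arrow. -/
abbrev sourceι (L : Paths Q ⥤ B) {i k : Q} (β : i ⟶ k) : vertex L i ⟶ source L k :=
  Sigma.ι (fun a : (Σ l : Q, (l ⟶ k)) => vertex L a.1) ⟨i, β⟩

lemma inl_arr_mimo {i k : Q} (β : i ⟶ k) :
    (biprod.inl : vertex L i ⟶ vertex L i ⊞ c.pathSum i) ≫ arr c.mimo β =
    (arr L β ≫ biprod.inl + sourceι L β ≫ c.e k ≫ pathSumι c.J Quiver.Path.nil ≫ biprod.inr :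
      vertex L i ⟶ vertex L k ⊞ c.pathSum k) := by
  have h : arr c.mimo β = _ := Paths.lift_toPath _ β
  refine (congrArg (biprod.inl ≫ ·) h).trans ((biprod.inl_desc _ _).trans ?_)
  simp only [Category.assoc]
  rfl

lemma inr_arr_mimo {i k : Q} (β : i ⟶ k) :
    (biprod.inr : c.pathSum i ⟶ vertex L i ⊞ c.pathSum i) ≫ arr c.mimo β =
    (pathSumMap c.J β ≫ biprod.inr : c.pathSum i ⟶ vertex L k ⊞ c.pathSum k) := by
  have h : arr c.mimo β = _ := Paths.lift_toPath _ β
  exact (congrArg (biprod.inr ≫ ·) h).trans (biprod.inr_desc _ _)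

/-- The inclusion of `L`. -/
def familyInl : vertices L ⟶ vertices c.mimo :=
  Discrete.natTrans fun i => (biprod.inl : vertex L i.as ⟶ vertex L i.as ⊞ c.pathSum i.as)

/-- The inclusion of the sums over paths. -/
def familyInr : pathFamily c.J ⟶ vertices c.mimo :=
  Discrete.natTrans fun i => (biprod.inr : c.pathSum i.as ⟶ vertex L i.as ⊞ c.pathSum i.as)

/-- The projection to `L`. -/
def familyFst : vertices c.mimo ⟶ vertices L :=
  Discrete.natTrans fun i => (biprod.fst : vertex L i.as ⊞ c.pathSum i.as ⟶ vertex L i.as)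

/-- The projection to the sums over paths. -/
def familySnd : vertices c.mimo ⟶ pathFamily c.J :=
  Discrete.natTrans fun i => (biprod.snd : vertex L i.as ⊞ c.pathSum i.as ⟶ c.pathSum i.as)

/-- This is the block column of the structure map on L. The trivial path is the generator inclusion
of f_!(J), so the entry e appears in the form required by the recognition criterion. -/
lemma map_familyInl_str : (arrowFunctor Q B).map c.familyInl ≫ repStr c.mimo =
    repStr L ≫ c.familyInl + c.familyE ≫ freeη (arrowFunctor Q B) (Discrete.functor c.J) ≫
      (freeToPath c.J).f ≫ c.familyInr := by
  refine NatTrans.ext (funext fun ⟨k⟩ => arrow_hom_ext fun i β => ?_)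
  rw [NatTrans.comp_app, ← Category.assoc, arrowι_map, Category.assoc, arrowι_repStr]
  refine (c.inl_arr_mimo β).trans ?_
  have h : arrowι (vertices L) β ≫ (repStr L ≫ c.familyInl + c.familyE ≫
      freeη (arrowFunctor Q B) (Discrete.functor c.J) ≫ (freeToPath c.J).f ≫ c.familyInr).app ⟨k⟩ =
      (arrowι (vertices L) β ≫ (repStr L).app ⟨k⟩) ≫ c.familyInl.app ⟨k⟩ +
        arrowι (vertices L) β ≫ c.familyE.app ⟨k⟩ ≫ pathSumι c.J Quiver.Path.nil ≫ c.familyInr.app ⟨k⟩ := by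
    rw [NatTrans.app_add, Preadditive.comp_add, NatTrans.comp_app, ← Category.assoc,
      ← freeη_freeToPath]
    exact congrArg (fun t => _ + arrowι (vertices L) β ≫ c.familyE.app ⟨k⟩ ≫ t)
      (Category.assoc _ _ _).symm
  rw [arrowι_repStr] at h
  exact h.symm

lemma map_familyInr_str : (arrowFunctor Q B).map c.familyInr ≫ repStr c.mimo =
    pathStr c.J ≫ c.familyInr := by
  refine NatTrans.ext (funext fun ⟨k⟩ => arrow_hom_ext fun i β => ?_)
  rw [NatTrans.comp_app, ← Category.assoc, arrowι_map, Category.assoc, arrowι_repStr,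
    NatTrans.comp_app, ← Category.assoc, arrowι_pathStr]
  exact c.inr_arr_mimo β

/-- The two descriptions of the Mimo-construction agree. -/
theorem nonempty_iso_mimoAlgebra : Nonempty ((repAlgebra Q B).obj c.mimo ≅
    mimoAlgebra ((repAlgebra Q B).obj L) c.familyE) :=
  nonempty_iso_mimoAlgebra_of_biproduct (L := (repAlgebra Q B).obj L)
    (M := (repAlgebra Q B).obj c.mimo) (freeToPath c.J) (pathToFree c.J)
    (freeToPath_pathToFree c.J) (pathToFree_freeToPath c.J) c.familyInl c.familyInr c.familyFst
    c.familySnd (NatTrans.ext (funext fun _ => biprod.inl_fst))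
    (NatTrans.ext (funext fun _ => biprod.inl_snd)) (NatTrans.ext (funext fun _ => biprod.inr_fst))
    (NatTrans.ext (funext fun _ => biprod.inr_snd)) (NatTrans.ext (funext fun _ => biprod.total))
    c.map_familyInl_str c.map_familyInr_str

lemma mimo_eq_zero {T : Discrete Q ⥤ B} (x : T ⟶ (arrowFunctor Q B).obj (vertices L))
    (h₁ : x ≫ repStr L = 0) (h₂ : x ≫ c.familyE = 0) : x = 0 :=
  NatTrans.ext (funext fun ⟨i⟩ => by
    have := (c.isInjectiveEnvelope i).mono
    exact eq_zero_of_extension (c.fac i) (x.app ⟨i⟩) (congrArg (fun t => t.app ⟨i⟩) h₁)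
      (congrArg (fun t => t.app ⟨i⟩) h₂))

theorem mimo_mem : monoReps Q B c.mimo := by
  obtain ⟨i⟩ := c.nonempty_iso_mimoAlgebra
  have : Mono (mimoAlgebra ((repAlgebra Q B).obj L) c.familyE).str :=
    mono_mimo fun x h₁ h₂ => c.mimo_eq_zero x h₁ h₂
  exact (monoReps_iff _).2 (monoAlgebras_of_iso i this)

/-- The hypothesis is tested on the family of all kernels of the morphisms `into L i`; minimality
then applies at each vertex. -/
lemma isIso_of_familyE (g : Discrete.functor c.J ⟶ Discrete.functor c.J)
    (hg : ∀ {T : Discrete Q ⥤ B} (x : T ⟶ (arrowFunctor Q B).obj (vertices L)), x ≫ repStr L = 0 →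
      x ≫ c.familyE ≫ g = x ≫ c.familyE) : IsIso g := by
  let x : (Discrete.functor fun i => kernel (into L i)) ⟶ (arrowFunctor Q B).obj (vertices L) :=
    Discrete.natTrans fun i => kernel.ι (into L i.as)
  have hx : x ≫ repStr L = 0 := NatTrans.ext (funext fun i => kernel.condition (into L i.as))
  have h := hg x hx
  have (i : Discrete Q) : IsIso (g.app i) := isIso_of_extension (c.isInjectiveEnvelope i.as)
    (c.fac i.as) _ (congrArg (fun t => t.app i) h)
  exact NatIso.isIso_of_isIso_app g

theorem isReduced_mimo (hB : HasInjectiveEnvelopes B)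
    (hL : ∀ i : Q, HasNoInjectiveSummand (vertex L i)) {N : (monoReps Q B).FullSubcategory}
    (i : c.mimo ≅ N.obj) : IsReduced (monoReps Q B) N := by
  obtain ⟨i'⟩ := c.nonempty_iso_mimoAlgebra
  have := hB.arrowFunctor_preservesInjectiveObjects (Q := Q)
  have h : HasNoInjectiveSummand (vertices L) := hasNoInjectiveSummand_of_obj hB hL
  exact isReduced_rep (HasInjectiveEnvelopes.isReduced_extension hB.families
    (N := (monoRepAlgebra Q B).obj N) (L := (repAlgebra Q B).obj L) (e := c.familyE)
    ((repAlgebra Q B).mapIso i.symm ≪≫ i') h fun g hg => c.isIso_of_familyE g hg)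

/-- The projection from the Mimo-construction. -/
def π : c.mimo ⟶ L := repHom (fun i => (biprod.fst : vertex L i ⊞ c.pathSum i ⟶ vertex L i))
  fun {i j} α => by
    refine biprod.hom_ext' (X := vertex L i) (Y := c.pathSum i) _ _ ?_ ?_
    · refine (Category.assoc _ _ _).symm.trans ((congrArg (· ≫ biprod.fst)
        (c.inl_arr_mimo α)).trans ?_)
      have h : (arr L α ≫ biprod.inl + sourceι L α ≫ c.e j ≫ pathSumι c.J Quiver.Path.nil ≫
          biprod.inr : vertex L i ⟶ vertex L j ⊞ c.pathSum j) ≫ biprod.fst =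
          (biprod.inl : vertex L i ⟶ vertex L i ⊞ c.pathSum i) ≫ biprod.fst ≫ arr L α := by
        simp only [Preadditive.add_comp, Category.assoc, biprod.inl_fst, biprod.inr_fst, comp_zero,
          add_zero, Category.comp_id, biprod.inl_fst_assoc]
      exact h
    · refine (Category.assoc _ _ _).symm.trans ((congrArg (· ≫ biprod.fst)
        (c.inr_arr_mimo α)).trans ?_)
      have h : (pathSumMap c.J α ≫ biprod.inr : c.pathSum i ⟶ vertex L j ⊞ c.pathSum j) ≫
          biprod.fst =
          (biprod.inr : c.pathSum i ⟶ vertex L i ⊞ c.pathSum i) ≫ biprod.fst ≫ arr L α := by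
        simp only [Category.assoc, biprod.inr_fst, comp_zero, zero_comp, biprod.inr_fst_assoc]
      exact h

/-- At each vertex the projection splits off a finite sum of injective objects. -/
theorem nonempty_iso_toStableReps :
    Nonempty ((toStableReps Q B).obj c.mimo ≅ (toStableReps Q B).obj L) := by
  have h (i : Q) : IsIso (((toStableReps Q B).map c.π).app ((Paths.of Q).obj i)) := by
    have (p : Σ k : Q, Quiver.Path k i) : Injective (c.J p.1) := (c.isInjectiveEnvelope p.1).injective
    have : Injective (c.pathSum i) := injective_sigma fun p : (Σ k : Q, Quiver.Path k i) => c.J p.1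
    exact isIso_toStable_fst (vertex L i) (c.pathSum i)
  have (i : Paths Q) : IsIso (((toStableReps Q B).map c.π).app i) := h i
  have := NatIso.isIso_of_isIso_app ((toStableReps Q B).map c.π)
  exact ⟨asIso ((toStableReps Q B).map c.π)⟩

end RepMimoChoice

/-! ### Passage to representations in the stable category -/

section StableReps
variable {Q : Type u} [Quiver.{v} Q] [FiniteAcyclic Q] {B : Type u'} [Category.{v'} B] [Abelian B]

/-- Naturality in the stable category is known arrow by arrow, while the structure map of a
representation starts from the sum over arrows. As the sum is finite, stable vanishing can be tested
on its summands. -/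
lemma toStable_map_sigma_eq_zero {ι : Type*} [Finite ι] {f : ι → B} {M : B} (d : ∐ f ⟶ M)
    (h : ∀ i, (toStable (injectives B)).map (Sigma.ι f i ≫ d) = 0) :
    (toStable (injectives B)).map d = 0 := by
  classical
  have := Fintype.ofFinite ι
  rw [← Category.id_comp d, ← sigma_total, Preadditive.sum_comp, Functor.map_sum]
  exact Finset.sum_eq_zero fun i _ => by rw [Category.assoc, Functor.map_comp, h, comp_zero]

instance : (monoToStableReps Q B).Additive where
  map_add := NatTrans.ext (funext fun _ => (toStable (injectives B)).map_add)

omit [Quiver.{v} Q] [FiniteAcyclic Q] in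
lemma exists_factorization_of_families {F G : Discrete Q ⥤ B} (f : F ⟶ G)
    (h : ∀ i : Q, (toStable (injectives B)).map (f.app ⟨i⟩) = 0) :
    ∃ (J : Discrete Q ⥤ B) (_ : Injective J) (u : F ⟶ J) (v : J ⟶ G), u ≫ v = f := by
  choose J hJ u v h using fun i : Q => (toStable_map_eq_zero_iff _).1 (h i)
  exact ⟨Discrete.functor J, injective_of_injective_obj hJ, Discrete.natTrans fun i => u i.as,
    Discrete.natTrans fun i => v i.as, NatTrans.ext (funext fun i => h i.as)⟩

omit [Quiver.{v} Q] [FiniteAcyclic Q] in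
lemma HasInjectiveEnvelopes.toStable_map_app_eq_zero (hB : HasInjectiveEnvelopes B)
    {F G J : Discrete Q ⥤ B} [Injective J] (u : F ⟶ J) (v : J ⟶ G) (i : Q) :
    (toStable (injectives B)).map ((u ≫ v).app ⟨i⟩) = 0 := by
  have := hB.injective_obj J i
  exact toStable_map_comp_eq_zero (u.app ⟨i⟩) (v.app ⟨i⟩)

lemma monoToStableReps_map_eq_zero_iff {M N : (monoReps Q B).FullSubcategory} (f : M ⟶ N) :
    (monoToStableReps Q B).map f = 0 ↔ ∀ i : Q,
      (toStable (injectives B)).map ((verticesMap f.hom).app ⟨i⟩) = 0 :=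
  ⟨fun h i => congrArg (fun t => t.app ((Paths.of Q).obj i)) h, fun h => NatTrans.ext (funext h)⟩

/-- Representatives are chosen at the vertices. Their failure to commute with the arrows factors
through an injective family, and the correction for algebras applies. -/
theorem HasInjectiveEnvelopes.monoToStableReps_full (hB : HasInjectiveEnvelopes B) :
    (monoToStableReps Q B).Full where
  map_surjective {M N} g := by
    let T := toStable (injectives B)
    have := hB.arrowFunctor_preservesInjectiveObjects (Q := Q)
    have hM : Mono ((repAlgebra Q B).obj M.obj).str := (monoReps_iff _).1 M.property
    have h (i : Q) : ∃ g₀ : vertex M.obj i ⟶ vertex N.obj i,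
        T.map g₀ = g.app ((Paths.of Q).obj i) := T.map_surjective _
    choose g₀ hg₀ using h
    let G : vertices M.obj ⟶ vertices N.obj := Discrete.natTrans fun i => g₀ i.as
    obtain ⟨J, hJ, s, t, hst⟩ := exists_factorization_of_families
      (repStr M.obj ≫ G - (arrowFunctor Q B).map G ≫ repStr N.obj) fun i => by
        refine toStable_map_sigma_eq_zero (f := fun a : (Σ k : Q, (k ⟶ i)) => vertex M.obj a.1) _
          fun a => ?_
        have h : arrowι (vertices M.obj) a.2 ≫ (repStr M.obj ≫ G -
            (arrowFunctor Q B).map G ≫ repStr N.obj).app ⟨i⟩ =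
            (arrowι (vertices M.obj) a.2 ≫ (repStr M.obj).app ⟨i⟩) ≫ G.app ⟨i⟩ -
            G.app ⟨a.1⟩ ≫ arrowι (vertices N.obj) a.2 ≫ (repStr N.obj).app ⟨i⟩ := by
          rw [NatTrans.app_sub, Preadditive.comp_sub, NatTrans.comp_app, NatTrans.comp_app,
            Category.assoc, ← Category.assoc (arrowι _ _) (((arrowFunctor Q B).map G).app _),
            arrowι_map, Category.assoc]
        have h' : (arrowι (vertices M.obj) a.2 ≫ (repStr M.obj).app ⟨i⟩) ≫ G.app ⟨i⟩ -
            G.app ⟨a.1⟩ ≫ arrowι (vertices N.obj) a.2 ≫ (repStr N.obj).app ⟨i⟩ =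
            arr M.obj a.2 ≫ g₀ i - g₀ a.1 ≫ arr N.obj a.2 := by
          rw [arrowι_repStr, arrowι_repStr]
          rfl
        refine (congrArg T.map (h.trans h')).trans ?_
        rw [T.map_sub, T.map_comp, T.map_comp, hg₀, hg₀, sub_eq_zero]
        exact g.naturality ((Paths.of Q).map a.2)
    obtain ⟨φ, b, hφ⟩ := exists_algebraHom (N := (repAlgebra Q B).obj M.obj)
      (N' := (repAlgebra Q B).obj N.obj) G s t hst.symm
    obtain ⟨ψ, hψ⟩ := (repAlgebra Q B).map_surjective φ
    refine ⟨ObjectProperty.homMk ψ, NatTrans.ext (funext fun i : Q => ?_)⟩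
    have h₁ : ψ.app ((Paths.of Q).obj i) = φ.f.app ⟨i⟩ := by rw [← hψ]; rfl
    let w : vertices M.obj ⟶ vertices N.obj := b ≫ (extend ((repAlgebra Q B).obj N.obj) t).f
    have h₂ : φ.f.app ⟨i⟩ = G.app ⟨i⟩ - w.app ⟨i⟩ := by rw [hφ]; rfl
    have hw : T.map (w.app ⟨i⟩) = 0 := hB.toStable_map_app_eq_zero b _ i
    refine (congrArg T.map (h₁.trans h₂)).trans ((T.map_sub ..).trans ?_)
    rw [hw, sub_zero]
    exact hg₀ i

-- The actions of arrows can be lifted independently, since a quiver imposes no relations; they are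
-- then compressed to reduced summands.
omit [FiniteAcyclic Q] in
theorem HasMaximalInjectiveSummands.exists_isReducedRepLift (hB : HasMaximalInjectiveSummands B)
    (M : Paths Q ⥤ Stable B) : ∃ L : Paths Q ⥤ B, IsReducedRepLift M L := by
  let T := toStable (injectives B)
  choose N s p hN h₁ h₂ using fun i : Q => hB.exists_reduction (vertex M i).as
  have h (i j : Q) (α : i ⟶ j) : ∃ f : (vertex M i).as ⟶ (vertex M j).as, T.map f = arr M α :=
    T.map_surjective _
  choose f hf using h
  let L : Paths Q ⥤ B := Paths.lift
    { obj := fun i => N i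
      map := fun {i j} α => s i ≫ f i j α ≫ p j }
  have hL {i j : Q} (α : i ⟶ j) : arr L α = s i ≫ f i j α ≫ p j := Paths.lift_toPath _ _
  let φ : (toStableReps Q B).obj L ⟶ M := repHom (fun i => T.map (s i)) fun {i j} α => by
    have h : T.map (s i ≫ f i j α ≫ p j) ≫ T.map (s j) = T.map (s i) ≫ T.map (f i j α) := by
      rw [T.map_comp, T.map_comp, Category.assoc, Category.assoc, h₂, Category.comp_id]
    exact (congrArg (fun t => T.map t ≫ T.map (s j)) (hL α)).trans
      (h.trans (congrArg (T.map (s i) ≫ ·) (hf i j α)))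
  have h (i : Q) : IsIso (T.map (s i)) := ⟨T.map (p i), h₁ i, h₂ i⟩
  have (i : Paths Q) : IsIso (φ.app i) := h i
  have := NatIso.isIso_of_isIso_app φ
  exact ⟨L, hN, ⟨asIso φ⟩⟩

lemma isReduced_of_isReduced_rep {N : (monoReps Q B).FullSubcategory}
    (h : IsReduced (monoReps Q B) N) :
    IsReduced (monoAlgebras (arrowFunctor Q B)) ((monoRepAlgebra Q B).obj N) := by
  intro J hJ i r hir
  let e := (monoRepAlgebra Q B).objObjPreimageIso J
  have h₀ := h ((monoRepAlgebra Q B).objPreimage J)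
    ((isExactInjective_rep_iff _).2 (hJ.of_retract e.hom e.inv e.hom_inv_id))
    ((monoRepAlgebra Q B).preimage (e.hom ≫ i)) ((monoRepAlgebra Q B).preimage (r ≫ e.inv))
    ((monoRepAlgebra Q B).map_injective (by simp [reassoc_of% hir]))
  exact ((monoRepAlgebra Q B).map_isZero h₀).of_iso e.symm

/-- Stable vanishing is checked at the vertices, so the stable category of families is never
compared with families in the stable category. Reducedness and factorization are transported along
`monoRepAlgebra`. -/
theorem HasInjectiveEnvelopes.isStablyEpivalent_rep (hB : HasInjectiveEnvelopes B)
    (hB' : HasMaximalInjectiveSummands B) : IsStablyEpivalent (monoToStableReps Q B) fun M N =>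
      ∃ L, IsReducedRepLift M L ∧ ∃ c : RepMimoChoice L, Nonempty (c.mimo ≅ N.obj) where
  additive := inferInstance
  full := hB.monoToStableReps_full
  isZero_of_injective N hN := by
    have := hB.arrowFunctor_preservesInjectiveObjects (Q := Q)
    have h := hB.families.injective_of_isExactInjective ((isExactInjective_rep_iff N).1 hN)
    rw [IsZero.iff_id_eq_zero, ← CategoryTheory.Functor.map_id, monoToStableReps_map_eq_zero_iff]
    intro i
    have h' : Injective (vertices N.obj) := h
    exact hB.toStable_map_app_eq_zero (𝟙 (vertices N.obj)) (𝟙 _) i |>.symm ▸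
      congrArg (toStable (injectives B)).map (Category.comp_id _).symm
  factors {N N' N''} θ θ' h h' := by
    have := hB.arrowFunctor_preservesInjectiveObjects (Q := Q)
    obtain ⟨I, hI, u, v, huv⟩ := exists_factorization_of_families (verticesMap θ.hom)
      ((monoToStableReps_map_eq_zero_iff θ).1 h)
    obtain ⟨I', hI', u', v', huv'⟩ := exists_factorization_of_families (verticesMap θ'.hom)
      ((monoToStableReps_map_eq_zero_iff θ').1 h')
    have hN : Mono ((repAlgebra Q B).obj N.obj).str := (monoReps_iff _).1 N.property
    obtain ⟨a, ha⟩ := exists_factorization ((repAlgebra Q B).map θ.hom)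
      ((repAlgebra Q B).map θ'.hom) huv huv'
    let J : (monoAlgebras (arrowFunctor Q B)).FullSubcategory :=
      ⟨freeAlgebra (arrowFunctor Q B) I', mono_freeStr _ I'⟩
    have hJ : IsExactInjective _ J := isExactInjective_free (Iso.refl _)
    let e := (monoRepAlgebra Q B).objObjPreimageIso J
    let a' : (monoRepAlgebra Q B).obj N ⟶ J := ObjectProperty.homMk a
    let b' : J ⟶ (monoRepAlgebra Q B).obj N'' :=
      ObjectProperty.homMk (extend ((repAlgebra Q B).obj N''.obj) v')
    have hab : a' ≫ b' = (monoRepAlgebra Q B).map θ ≫ (monoRepAlgebra Q B).map θ' := by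
      ext1
      exact ha
    refine ⟨(monoRepAlgebra Q B).objPreimage J,
      (isExactInjective_rep_iff _).2 (hJ.of_retract e.hom e.inv e.hom_inv_id),
      (monoRepAlgebra Q B).preimage (a' ≫ e.inv), (monoRepAlgebra Q B).preimage (e.hom ≫ b'),
      (monoRepAlgebra Q B).map_injective ?_⟩
    simp [hab]
  isIso_one_sub N hN J hJ a b := by
    have := hB.arrowFunctor_preservesInjectiveObjects (Q := Q)
    have h := hB.families.isIso_one_sub_of_isReduced (isReduced_of_isReduced_rep hN)
      ((isExactInjective_rep_iff J).1 hJ) ((monoRepAlgebra Q B).map a) ((monoRepAlgebra Q B).map b)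
    have : IsIso ((monoRepAlgebra Q B).map (𝟙 N - a ≫ b)) := by
      rw [Functor.map_sub, CategoryTheory.Functor.map_id, Functor.map_comp]
      exact h
    exact isIso_of_reflects_iso _ (monoRepAlgebra Q B)
  exists_complement J N i r h := exists_complement_of_retract i r h
  isReduced := by
    rintro M N ⟨L, hL, c, ⟨i⟩⟩
    exact c.isReduced_mimo hB hL.1 i
  nonempty_iso := by
    rintro M N ⟨L, ⟨-, ⟨e⟩⟩, c, ⟨i⟩⟩
    obtain ⟨e'⟩ := c.nonempty_iso_toStableReps
    exact ⟨(toStableReps Q B).mapIso i.symm ≪≫ e' ≪≫ e⟩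
  exists_rel M := by
    obtain ⟨L, hL⟩ := hB'.exists_isReducedRepLift M
    choose J j e hj he using fun i : Q => hB.exists_extension (into L i)
    let c : RepMimoChoice L := ⟨J, j, hj, e, he⟩
    exact ⟨⟨c.mimo, c.mimo_mem⟩, L, hL, c, ⟨Iso.refl _⟩⟩

end StableReps

/-! ### Free representations and the indecomposable exact injectives -/

section FreeReps
variable {Q : Type u} [Quiver.{v} Q] [FiniteAcyclic Q] {B : Type u'} [Category.{v'} B] [Abelian B]

/-- The inclusion of the generators of `f_!(I(i))`. -/
abbrev gen (i : Q) (I : B) : I ⟶ vertex ((freeRep i).obj I) i := copiesι I (Quiver.Path.nil (a := i))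

lemma gen_map (i : Q) (I : B) {k : Q} (p : Quiver.Path i k) :
    gen i I ≫ ((freeRep i).obj I).map p = copiesι I p := by
  refine (ι_copiesMap i I p Quiver.Path.nil).trans ?_
  rw [Quiver.Path.nil_comp]

/-- The copy indexed by a path is the image of the generators under that path, so naturality
determines the morphism everywhere. -/
lemma freeRep_hom_ext {i : Q} {I : B} {F : Paths Q ⥤ B} {f g : (freeRep i).obj I ⟶ F}
    (h : gen i I ≫ f.app ((Paths.of Q).obj i) = gen i I ≫ g.app ((Paths.of Q).obj i)) : f = g := by
  refine rep_hom_ext fun k => copies_hom_ext fun p => ?_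
  have key (f : (freeRep i).obj I ⟶ F) : copiesι I p ≫ f.app ((Paths.of Q).obj k) =
      (gen i I ≫ f.app ((Paths.of Q).obj i)) ≫ F.map p := by
    refine (congrArg (· ≫ f.app ((Paths.of Q).obj k)) (gen_map i I p).symm).trans ?_
    refine (Category.assoc _ _ _).trans ((congrArg (gen i I ≫ ·) (f.naturality p)).trans ?_)
    exact (Category.assoc _ _ _).symm
  exact (key f).trans ((congrArg (· ≫ F.map p) h).trans (key g).symm)

/-- The components of the morphism from `f_!(I(i))` given by a morphism from `I`. -/
def freeRepHomApp {i : Q} {I : B} {F : Paths Q ⥤ B} (g : I ⟶ vertex F i) (k : Q) :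
    copies i k I ⟶ vertex F k :=
  Limits.Sigma.desc fun p : Quiver.Path i k => g ≫ F.map p

lemma ι_freeRepHomApp {i : Q} {I : B} {F : Paths Q ⥤ B} (g : I ⟶ vertex F i) {k : Q}
    (p : Quiver.Path i k) : copiesι I p ≫ freeRepHomApp g k = g ≫ F.map p :=
  Sigma.ι_desc (fun p : Quiver.Path i k => g ≫ F.map p) p

/-- The morphism from `f_!(I(i))` given by a morphism from `I`. -/
def freeRepHom {i : Q} {I : B} {F : Paths Q ⥤ B} (g : I ⟶ vertex F i) : (freeRep i).obj I ⟶ F :=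
  repHom (fun k => freeRepHomApp g k) fun {k l} α => copies_hom_ext fun (p : Quiver.Path i k) => by
    have h : copiesι I p ≫ copiesMap i I α.toPath ≫ freeRepHomApp g l =
        copiesι I p ≫ freeRepHomApp g k ≫ arr F α := by
      rw [← Category.assoc, ι_copiesMap, ι_freeRepHomApp, ← Category.assoc, ι_freeRepHomApp]
      exact (congrArg (g ≫ ·) (F.map_comp _ _)).trans (Category.assoc _ _ _).symm
    exact h

lemma gen_freeRepHom {i : Q} {I : B} {F : Paths Q ⥤ B} (g : I ⟶ vertex F i) :
    gen i I ≫ (freeRepHom g).app ((Paths.of Q).obj i) = g :=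
  (ι_freeRepHomApp g Quiver.Path.nil).trans
    ((congrArg (g ≫ ·) (F.map_id _)).trans (Category.comp_id _))

lemma path_eq_nil {i : Q} (p : Quiver.Path i i) : p = Quiver.Path.nil :=
  Quiver.Path.eq_nil_of_length_zero p (FiniteAcyclic.length_eq_zero i p)

/-- The generators are the whole object at the vertex. -/
def genInv (i : Q) (I : B) : copies i i I ⟶ I :=
  Limits.Sigma.desc fun _ : Quiver.Path i i => 𝟙 I

lemma gen_genInv (i : Q) (I : B) : gen i I ≫ genInv i I = 𝟙 I :=
  Sigma.ι_desc (fun _ : Quiver.Path i i => 𝟙 I) Quiver.Path.nil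

lemma genInv_gen (i : Q) (I : B) : genInv i I ≫ gen i I = 𝟙 _ := by
  refine copies_hom_ext fun p => ?_
  obtain rfl := path_eq_nil p
  refine (Category.assoc _ _ _).symm.trans ((congrArg (· ≫ gen i I) (gen_genInv i I)).trans ?_)
  exact (Category.id_comp _).trans (Category.comp_id _).symm

/-- The effect of a morphism on generators. -/
def genMap {i : Q} {I I' : B} (f : (freeRep i).obj I ⟶ (freeRep i).obj I') : I ⟶ I' :=
  gen i I ≫ f.app ((Paths.of Q).obj i) ≫ genInv i I'

lemma genMap_gen {i : Q} {I I' : B} (f : (freeRep i).obj I ⟶ (freeRep i).obj I') :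
    genMap f ≫ gen i I' = gen i I ≫ f.app ((Paths.of Q).obj i) := by
  have h := congrArg (fun t => (gen i I ≫ f.app ((Paths.of Q).obj i)) ≫ t) (genInv_gen i I')
  have h' : (gen i I ≫ f.app ((Paths.of Q).obj i)) ≫ genInv i I' ≫ gen i I' =
      genMap f ≫ gen i I' :=
    (Category.assoc _ _ _).trans
      ((Category.assoc _ _ _).trans (congrArg (gen i I ≫ ·) (Category.assoc _ _ _))).symm
  exact h'.symm.trans (h.trans (Category.comp_id _))

/-- By acyclicity the value of f_!(I(i)) at i is I itself, so morphisms between such representations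
at the same vertex are morphisms of generators. Hence `freeRep i` is fully faithful, and idempotents
agree on both sides. -/
lemma genMap_injective {i : Q} {I I' : B} {f g : (freeRep i).obj I ⟶ (freeRep i).obj I'}
    (h : genMap f = genMap g) : f = g :=
  freeRep_hom_ext (by rw [← genMap_gen, ← genMap_gen, h])

lemma genMap_id (i : Q) (I : B) : genMap (𝟙 ((freeRep i).obj I)) = 𝟙 I :=
  (congrArg (gen i I ≫ ·) (Category.id_comp _)).trans (gen_genInv i I)

lemma genMap_comp {i : Q} {I I' I'' : B} (f : (freeRep i).obj I ⟶ (freeRep i).obj I')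
    (g : (freeRep i).obj I' ⟶ (freeRep i).obj I'') : genMap (f ≫ g) = genMap f ≫ genMap g := by
  have h : genMap f ≫ genMap g = (genMap f ≫ gen i I') ≫ g.app _ ≫ genInv i I'' :=
    (Category.assoc _ _ _).symm
  rw [h, genMap_gen]
  exact (congrArg (gen i I ≫ ·) (Category.assoc _ _ _)).trans (Category.assoc _ _ _).symm

lemma genMap_zero (i : Q) (I I' : B) : genMap (0 : (freeRep i).obj I ⟶ (freeRep i).obj I') = 0 :=
  (congrArg (gen i I ≫ ·) zero_comp).trans comp_zero

lemma genMap_map {i : Q} {I I' : B} (f : I ⟶ I') : genMap ((freeRep i).map f) = f := by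
  have h : gen i I ≫ ((freeRep i).map f).app ((Paths.of Q).obj i) = f ≫ gen i I' :=
    ι_copiesMapHom f _
  refine (Category.assoc _ _ _).symm.trans ((congrArg (· ≫ genInv i I') h).trans ?_)
  exact (Category.assoc _ _ _).trans ((congrArg (f ≫ ·) (gen_genInv i I')).trans
    (Category.comp_id _))

lemma isIndecomposable_freeMonoRep_iff {i : Q} {I : B} :
    IsIndecomposable ((freeMonoRep i).obj I) ↔ IsIndecomposable I := by
  constructor
  · intro h
    refine isIndecomposable_of_idempotents (fun h₀ => h.1 ?_) fun ρ hρ => ?_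
    · rw [IsZero.iff_id_eq_zero]
      ext1
      exact genMap_injective (h₀.eq_of_src _ _)
    · rcases h.idempotent ((freeMonoRep i).map ρ) (by rw [← Functor.map_comp, hρ]) with h | h
      · left
        have h' : (freeRep i).map ρ = 0 := congrArg (fun t => t.hom) h
        rw [← genMap_map (i := i) ρ, h', genMap_zero]
      · right
        have h' : (freeRep i).map ρ = 𝟙 _ := congrArg (fun t => t.hom) h
        rw [← genMap_map (i := i) ρ, h', genMap_id]
  · intro h
    refine isIndecomposable_of_idempotents (fun h₀ => h.1 ?_) fun e he => ?_
    · have h' : 𝟙 ((freeRep i).obj I) = 0 := congrArg (fun t => t.hom) (h₀.eq_of_src (𝟙 _) 0)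
      rw [IsZero.iff_id_eq_zero, ← genMap_id i I, h', genMap_zero]
    · let e' : (freeRep i).obj I ⟶ (freeRep i).obj I := e.hom
      have he' : e' ≫ e' = e' := congrArg (fun t => t.hom) he
      rcases h.idempotent (genMap e') (by rw [← genMap_comp, he']) with h | h
      · left
        ext1
        exact genMap_injective (h.trans (genMap_zero i I I).symm)
      · right
        ext1
        exact genMap_injective (h.trans (genMap_id i I).symm)

/-- The morphism from an object of a family to the representation generated by another one. -/
def deltaComp (I : Discrete Q ⥤ B) (i : Q) : ∀ k : Q, i = k →
    (I.obj ⟨k⟩ ⟶ vertex ((freeRep i).obj (I.obj ⟨i⟩)) k)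
  | _, rfl => gen i (I.obj ⟨i⟩)

open Classical in
/-- The projection from a family to the representation generated by one of its objects. -/
def delta (I : Discrete Q ⥤ B) (i : Q) : I ⟶ vertices ((freeRep i).obj (I.obj ⟨i⟩)) :=
  Discrete.natTrans fun k => if h : i = k.as then deltaComp I i k.as h else 0

lemma delta_app (I : Discrete Q ⥤ B) (i : Q) : (delta I i).app ⟨i⟩ = gen i (I.obj ⟨i⟩) :=
  dif_pos rfl

/-- A free algebra on a family has the representations generated by the objects of the family as
retracts. -/
theorem exists_retract_of_iso_free {I : Discrete Q ⥤ B} {N : (monoReps Q B).FullSubcategory}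
    (e : freeAlgebra (arrowFunctor Q B) I ≅ (repAlgebra Q B).obj N.obj) (i : Q) :
    ∃ (s : (freeMonoRep i).obj (I.obj ⟨i⟩) ⟶ N) (r : N ⟶ (freeMonoRep i).obj (I.obj ⟨i⟩)),
      s ≫ r = 𝟙 _ := by
  let F := (freeRep i).obj (I.obj ⟨i⟩)
  let g : I.obj ⟨i⟩ ⟶ vertex N.obj i := (freeη (arrowFunctor Q B) I).app ⟨i⟩ ≫ e.hom.f.app ⟨i⟩
  -- The retraction extends `delta`, which at the vertex i is the inclusion of generators. Hence the
  -- composite is the identity on generators.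
  obtain ⟨r, hr⟩ := (repAlgebra Q B).map_surjective
    (e.inv ≫ extend ((repAlgebra Q B).obj F) (delta I i))
  refine ⟨ObjectProperty.homMk (freeRepHom g), ObjectProperty.homMk r, ?_⟩
  ext1
  refine freeRep_hom_ext ?_
  have h₁ : r.app ((Paths.of Q).obj i) =
      e.inv.f.app ⟨i⟩ ≫ (extend ((repAlgebra Q B).obj F) (delta I i)).f.app ⟨i⟩ := by
    change ((repAlgebra Q B).map r).f.app ⟨i⟩ = _
    rw [hr]
    rfl
  have h₂ : e.hom.f.app ⟨i⟩ ≫ e.inv.f.app ⟨i⟩ = 𝟙 _ :=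
    congrArg (fun t => t.f.app ⟨i⟩) e.hom_inv_id
  have h₃ : (freeη (arrowFunctor Q B) I).app ⟨i⟩ ≫
      (extend ((repAlgebra Q B).obj F) (delta I i)).f.app ⟨i⟩ = gen i (I.obj ⟨i⟩) :=
    (congrArg (fun t : I ⟶ vertices F => t.app ⟨i⟩)
      (freeη_extend ((repAlgebra Q B).obj F) (delta I i))).trans (delta_app I i)
  have h₄ : gen i (I.obj ⟨i⟩) ≫ (freeRepHom g).app ((Paths.of Q).obj i) ≫
      r.app ((Paths.of Q).obj i) = gen i (I.obj ⟨i⟩) := by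
    refine (Category.assoc _ _ _).symm.trans ((congrArg (· ≫ _) (gen_freeRepHom g)).trans ?_)
    rw [h₁]
    refine (Category.assoc _ _ _).trans ((congrArg (_ ≫ ·) ?_).trans h₃)
    exact (Category.assoc _ _ _).symm.trans ((congrArg (· ≫ _) h₂).trans (Category.id_comp _))
  exact h₄.trans (Category.comp_id _).symm

/-- It is a retract of the free algebra on the constant family with value I. -/
theorem HasInjectiveEnvelopes.isExactInjective_freeMonoRep (hB : HasInjectiveEnvelopes B) (i : Q)
    (I : B) [Injective I] : IsExactInjective (monoReps Q B) ((freeMonoRep i).obj I) := by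
  have := hB.arrowFunctor_preservesInjectiveObjects (Q := Q)
  let J : Discrete Q ⥤ B := Discrete.functor fun _ => I
  have : Injective J := injective_of_injective_obj fun i => (inferInstance : Injective I)
  let N : (monoAlgebras (arrowFunctor Q B)).FullSubcategory :=
    ⟨freeAlgebra (arrowFunctor Q B) J, mono_freeStr _ J⟩
  have hN : IsExactInjective _ N := isExactInjective_free (Iso.refl _)
  let e := (monoRepAlgebra Q B).objObjPreimageIso N
  have hN' := (isExactInjective_rep_iff _).2 (hN.of_retract e.hom e.inv e.hom_inv_id)
  obtain ⟨s, r, h⟩ := exists_retract_of_iso_free (I := J)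
    (N := (monoRepAlgebra Q B).objPreimage N) ((monoAlgebras _).ι.mapIso e.symm) i
  exact hN'.of_retract s r h

lemma nonempty_path_of_ne_zero {i i' : Q} {I I' : B} (f : (freeRep i).obj I ⟶ (freeRep i').obj I')
    (h : f ≠ 0) : Nonempty (Quiver.Path i' i) := by
  by_contra h₀
  have h₀ : IsEmpty (Quiver.Path i' i) := not_nonempty_iff.1 h₀
  have hz : IsZero (copies i' i I') := isZero_sigma fun p => (h₀.false p).elim
  exact h (freeRep_hom_ext (hz.eq_of_tgt _ _))

theorem HasInjectiveEnvelopes.injective_bijection_rep (hB : HasInjectiveEnvelopes B) :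
    Set.BijOn (fun x : IsoClasses B × Q => isoMap (freeMonoRep x.2) x.1)
      ((classes fun I => IsIndecomposable I ∧ Injective I) ×ˢ Set.univ)
      (classes fun N => IsIndecomposable N ∧ IsExactInjective (monoReps Q B) N) := by
  refine ⟨?_, ?_, ?_⟩
  · rintro ⟨_, i⟩ ⟨⟨I, ⟨hI, hI'⟩, rfl⟩, -⟩
    exact ⟨(freeMonoRep i).obj I, ⟨isIndecomposable_freeMonoRep_iff.2 hI,
      hB.isExactInjective_freeMonoRep i I⟩, rfl⟩
  · rintro ⟨_, i⟩ ⟨⟨I, ⟨hI, -⟩, rfl⟩, -⟩ ⟨_, i'⟩ ⟨⟨I', ⟨hI', -⟩, rfl⟩, -⟩ h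
    obtain ⟨e⟩ : Nonempty ((freeMonoRep i).obj I ≅ (freeMonoRep i').obj I') := Quotient.exact h
    let e' : (freeRep i).obj I ≅ (freeRep i').obj I' := (monoReps Q B).ι.mapIso e
    have h₁ : 𝟙 ((freeRep i).obj I) ≠ 0 := fun h => hI.1 <| by
      rw [IsZero.iff_id_eq_zero, ← genMap_id i I, h, genMap_zero]
    -- Nonzero morphisms in both directions give paths in both directions. By acyclicity these are
    -- trivial, so the vertices coincide.
    obtain ⟨p⟩ := nonempty_path_of_ne_zero e'.hom fun h => h₁ (by
      rw [← e'.hom_inv_id, h, zero_comp])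
    obtain ⟨q⟩ := nonempty_path_of_ne_zero e'.inv fun h => h₁ (by
      rw [← e'.hom_inv_id, h, comp_zero])
    have hp : p.length = 0 := by
      have := FiniteAcyclic.length_eq_zero i' (p.comp q)
      rw [Quiver.Path.length_comp] at this
      omega
    obtain rfl := Quiver.Path.eq_of_length_zero p hp
    refine Prod.ext (Quotient.sound ⟨⟨genMap e'.hom, genMap e'.inv, ?_, ?_⟩⟩) rfl
    · rw [← genMap_comp, e'.hom_inv_id, genMap_id]
    · rw [← genMap_comp, e'.inv_hom_id, genMap_id]
  · rintro _ ⟨N, ⟨hN, hN'⟩, rfl⟩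
    have := hB.arrowFunctor_preservesInjectiveObjects (Q := Q)
    obtain ⟨I, hI, ⟨e⟩⟩ := hB.families.exists_iso_free ((isExactInjective_rep_iff N).1 hN')
    change freeAlgebra _ I ≅ (repAlgebra Q B).obj N.obj at e
    -- The injective N is free on a nonzero family. At a vertex with nonzero value the corresponding
    -- f_!(I(i)) is a nonzero retract of N, hence all of N by indecomposability.
    have h : ∃ i : Q, ¬ IsZero (I.obj ⟨i⟩) := by
      by_contra! h
      have h₀ : IsZero I := Functor.isZero _ fun i => h i.as
      have h₁ : 𝟙 (freeAlgebra (arrowFunctor Q B) I) = 0 := free_hom_ext (h₀.eq_of_src _ _)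
      have h₂ : 𝟙 ((repAlgebra Q B).obj N.obj) = 0 := by
        rw [← e.inv_hom_id, ← Category.id_comp e.hom, h₁, zero_comp, comp_zero]
      refine hN.1 ((IsZero.iff_id_eq_zero _).2 ?_)
      ext1
      exact (repAlgebra Q B).map_injective
        (((repAlgebra Q B).map_id _).trans (h₂.trans ((repAlgebra Q B).map_zero _ _).symm))
    obtain ⟨i, hi⟩ := h
    obtain ⟨s, r, hsr⟩ := exists_retract_of_iso_free e i
    have : IsIso s := hN.isIso_of_retract (fun h => hi (by
      have h' : 𝟙 ((freeRep i).obj (I.obj ⟨i⟩)) = 0 :=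
        congrArg (fun t => t.hom) (h.eq_of_src (𝟙 _) 0)
      rw [IsZero.iff_id_eq_zero, ← genMap_id i, h', genMap_zero]))
      (exists_complement_of_retract s r hsr)
    exact ⟨(isoClass (I.obj ⟨i⟩), i), ⟨⟨_, ⟨isIndecomposable_freeMonoRep_iff.1
      (hN.of_iso (asIso s).symm), hB.injective_obj I i⟩, rfl⟩, trivial⟩, Quotient.sound ⟨asIso s⟩⟩

theorem indecomposablesOfMonoReps (hB : HasInjectiveEnvelopes B)
    (hB' : HasMaximalInjectiveSummands B) : IndecomposablesOfMonoReps Q B where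
  injective_bijection := hB.injective_bijection_rep
  exists_lift := hB'.exists_isReducedRepLift
  nonempty_choice L := by
    choose J j e hj he using fun i : Q => hB.exists_extension (into L i)
    exact ⟨⟨J, j, hj, e, he⟩⟩
  mimo_mem c := c.mimo_mem
  mimo_bijection := (hB.isStablyEpivalent_rep hB').isInverseOfEpivalence

end FreeReps

/-! ### Essential submodules of injective modules -/

section Essential
variable {R : Type u} [Ring R]

lemma exists_maximal_disjoint {I : Type*} [AddCommGroup I] [Module R I] (A B : Submodule R I)
    (h : Disjoint A B) : ∃ C, A ≤ C ∧ Disjoint C B ∧ ∀ D, C ≤ D → Disjoint D B → D = C := by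
  obtain ⟨C, hAC, hC⟩ := zorn_le_nonempty₀ {C : Submodule R I | Disjoint C B} (fun c hc hchain y hy =>
    ⟨sSup c, Submodule.disjoint_def.2 fun x hx hxB => by
      obtain ⟨S, hS, hxS⟩ := (Submodule.mem_sSup_of_directed ⟨y, hy⟩ hchain.directedOn).1 hx
      exact Submodule.disjoint_def.1 (hc hS) x hxS hxB, fun z hz => le_sSup hz⟩) A h
  exact ⟨C, hAC, hC.prop, fun D hCD hD => (hC.eq_of_le hD hCD).symm⟩

/-- A submodule of an injective module is essential in a retract. -/
theorem exists_essential_retract {I : Type u} [AddCommGroup I] [Module R I] [Module.Injective R I]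
    (M : Submodule R I) : ∃ e : I →ₗ[R] I, (∀ x, e (e x) = e x) ∧ (∀ m ∈ M, e m = m) ∧
      ∀ T ≤ LinearMap.range e, Disjoint T M → T = ⊥ := by
  -- K is maximal disjoint from M, and N ⊇ M is maximal disjoint from K. Then N embeds in I/K, and
  -- extending the inclusion of N to I/K gives an endomorphism e that fixes N and kills K.
  obtain ⟨K, -, hKM, hK⟩ := exists_maximal_disjoint ⊥ M disjoint_bot_left
  obtain ⟨N, hMN, hNK, hN⟩ := exists_maximal_disjoint M K hKM.symm
  have hg : Function.Injective (K.mkQ ∘ₗ N.subtype) := by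
    rw [← LinearMap.ker_eq_bot, LinearMap.ker_eq_bot']
    intro x hx
    have hx' : (x : I) ∈ K := (Submodule.Quotient.mk_eq_zero K).1 hx
    exact Subtype.ext (Submodule.disjoint_def.1 hNK x x.2 hx')
  obtain ⟨f, hf⟩ := Module.Injective.out (K.mkQ ∘ₗ N.subtype) hg N.subtype
  let e : I →ₗ[R] I := f ∘ₗ K.mkQ
  have heN (n : I) (hn : n ∈ N) : e n = n := hf ⟨n, hn⟩
  have heK (x : I) (hx : x ∈ K) : e x = 0 := by
    have : K.mkQ x = 0 := (Submodule.Quotient.mk_eq_zero K).2 hx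
    simp [e, this]
  -- The preimage of K still meets M trivially, so maximality of K applies. Hence the range of e is
  -- disjoint from K, and maximality of N identifies it with N.
  have hD : K.comap e = K := by
    refine hK _ (fun x hx => ?_) ?_
    · rw [Submodule.mem_comap, heK x hx]
      exact K.zero_mem
    · rw [Submodule.disjoint_def]
      intro m hm hmM
      rw [Submodule.mem_comap, heN m (hMN hmM)] at hm
      exact Submodule.disjoint_def.1 hKM m hm hmM
  have hrange : LinearMap.range e = N := by
    refine hN _ (fun n hn => ⟨n, heN n hn⟩) ?_
    rw [Submodule.disjoint_def]
    rintro _ ⟨y, rfl⟩ hy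
    have : y ∈ K.comap e := hy
    rw [hD] at this
    exact heK y this
  refine ⟨e, fun x => heN _ (hrange ▸ ⟨x, rfl⟩), fun m hm => heN m (hMN hm), fun T hT hTM => ?_⟩
  rw [hrange] at hT
  -- If T ≤ N is disjoint from M, then so is K + T, because N ∩ K = 0. Maximality gives T ≤ K, hence
  -- T = 0.
  have h : K ⊔ T = K := by
    refine hK _ le_sup_left ?_
    rw [Submodule.disjoint_def]
    intro m hm hmM
    obtain ⟨k, hk, t, ht, rfl⟩ := Submodule.mem_sup.1 hm
    have hkN : k ∈ N := by
      have := N.sub_mem (hMN hmM) (hT ht)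
      rwa [add_sub_cancel_right] at this
    obtain rfl := Submodule.disjoint_def.1 hNK k hkN hk
    rw [zero_add] at hmM ⊢
    exact Submodule.disjoint_def.1 hTM t ht hmM
  exact (hNK.mono hT (sup_eq_left.1 h)).eq_bot_of_self

/-- The kernel of g misses an essential submodule, so g is injective and has a left inverse r by
injectivity of N. The same argument makes r injective, so g is surjective. -/
theorem bijective_of_essential {N : Type u} [AddCommGroup N] [Module R N] [Module.Injective R N]
    (M : Submodule R N) (hM : ∀ T : Submodule R N, Disjoint T M → T = ⊥) (g : N →ₗ[R] N)
    (hg : ∀ m ∈ M, g m = m) : Function.Bijective g := by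
  have hinj : Function.Injective g := by
    rw [← LinearMap.ker_eq_bot]
    refine hM _ (Submodule.disjoint_def.2 fun x hx hxM => ?_)
    rw [← hg x hxM]
    exact hx
  obtain ⟨r, hr⟩ := Module.Injective.out g hinj LinearMap.id
  have hr' : Function.Injective r := by
    rw [← LinearMap.ker_eq_bot]
    refine hM _ (Submodule.disjoint_def.2 fun x hx hxM => ?_)
    have h : r (g x) = x := hr x
    rw [hg x hxM] at h
    exact h.symm.trans hx
  exact ⟨hinj, fun x => ⟨r x, hr' (hr (r x))⟩⟩

end Essential

/-! ### Finiteness of essential extensions over Artin algebras -/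

section Finite
/-- An essential extension of a finitely generated module over an Artin algebra is finitely
generated. -/
theorem finite_of_essential (k : Type*) [CommRing k] [IsArtinianRing k] {R : Type u} [Ring R]
    [Algebra k R] [Module.Finite k R] {N : Type*} [AddCommGroup N] [Module R N]
    (S : Submodule R N) [Module.Finite R S]
    (hS : ∀ T : Submodule R N, Disjoint T S → T = ⊥) : Module.Finite R N := by
  let _ : Module k N := Module.compHom N (algebraMap k R)
  have : IsScalarTower k R N := ⟨fun a r x => by
    rw [Algebra.smul_def, mul_smul]
    rfl⟩
  have : SMulCommClass k R N := ⟨fun a r x => by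
    rw [← algebraMap_smul R a x, ← algebraMap_smul R a (r • x), ← mul_smul, ← mul_smul,
      Algebra.commutes]⟩
  have : IsArtinianRing R := isArtinian_of_tower k inferInstance
  have : IsNoetherianRing R := isNoetherian_of_tower k inferInstance
  let J := Ring.jacobson R
  -- A n is the annihilator of J^n in N, the n-th layer of the socle filtration. Each layer is shown
  -- to be noetherian over k.
  let A (n : ℕ) : Submodule k N :=
    { carrier := {x | ∀ a ∈ J ^ n, a • x = 0}
      add_mem' := fun hx hy a ha => by rw [smul_add, hx a ha, hy a ha, add_zero]
      zero_mem' := fun a _ => smul_zero a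
      smul_mem' := fun c x hx a ha => by rw [smul_comm, hx a ha, smul_zero] }
  let T : Submodule R N :=
    { carrier := {x | ∀ a ∈ J, a • x = 0}
      add_mem' := fun hx hy a ha => by rw [smul_add, hx a ha, hy a ha, add_zero]
      zero_mem' := fun a _ => smul_zero a
      smul_mem' := fun c x hx a ha => by
        rw [← mul_smul]
        exact hx _ (Ideal.IsTwoSided.mul_mem_of_left _ ha) }
  have hT : Module.IsTorsionBySet R T J := fun x a => Subtype.ext (x.2 a a.2)
  -- T is semisimple because J annihilates it. A complement of S ∩ T in T is disjoint from the
  -- essential submodule S, hence zero.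
  have hTS : T ≤ S := by
    let _ := hT.module
    have : IsSemisimpleModule R T := hT.isSemisimpleModule_iff.1 inferInstance
    obtain ⟨T', hT'⟩ := exists_isCompl (S.comap T.subtype)
    have h : T'.map T.subtype = ⊥ := by
      refine hS _ (Submodule.disjoint_def.2 ?_)
      rintro _ ⟨x, hx, rfl⟩ hxS
      rw [Submodule.disjoint_def.1 hT'.disjoint x hxS hx, map_zero]
    have h' : T' = ⊥ := (Submodule.map_injective_of_injective T.subtype_injective)
      (h.trans (Submodule.map_bot _).symm)
    intro x hx
    have hx' : (⟨x, hx⟩ : T) ∈ S.comap T.subtype := by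
      rw [h'] at hT'
      rw [eq_top_of_isCompl_bot hT']
      trivial
    exact hx'
  have hSk : IsNoetherian k S := by
    have : Module.Finite k S := Module.Finite.trans R S
    infer_instance
  have h₁ : IsNoetherian k (A 1) := by
    have h : A 1 ≤ S.restrictScalars k := fun x hx =>
      hTS fun a ha => hx a (by rwa [Submodule.pow_one])
    have : IsNoetherian k (S.restrictScalars k) := hSk
    exact isNoetherian_of_le h
  have hA (n : ℕ) : IsNoetherian k (A n) := by
    induction n with
    | zero =>
      have h : A 0 = ⊥ := eq_bot_iff.2 fun x hx => by
        have := hx 1 (by rw [Submodule.pow_zero, Ideal.one_eq_top]; trivial)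
        rwa [one_smul] at this
      rw [h]
      infer_instance
    | succ n ih =>
      obtain ⟨s, hs⟩ : J.FG := IsNoetherian.noetherian J
      have hsJ (a : s) : (a : R) ∈ J := hs ▸ Submodule.subset_span a.2
      -- Multiplication by finitely many generators of J maps A (n + 1) into a finite power of A n,
      -- with kernel inside A 1.
      let f : A (n + 1) →ₗ[k] (s → A n) :=
        { toFun := fun x a => ⟨(a : R) • (x : N), fun b hb => by
            rw [← mul_smul]
            exact x.2 _ (by
              rw [Ideal.IsTwoSided.pow_add, Submodule.pow_one]
              exact Ideal.mul_mem_mul hb (hsJ a))⟩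
          map_add' := fun x y => funext fun a => Subtype.ext (smul_add _ _ _)
          map_smul' := fun c x => funext fun a => Subtype.ext (smul_comm _ _ _) }
      have hker : IsNoetherian k (LinearMap.ker f) := by
        have h : (LinearMap.ker f).map (A (n + 1)).subtype ≤ A 1 := by
          rintro _ ⟨x, hx, rfl⟩ a ha
          rw [Submodule.pow_one, ← hs] at ha
          induction ha using Submodule.span_induction with
          | mem a ha => exact congrArg Subtype.val (congrFun hx ⟨a, ha⟩)
          | zero => exact zero_smul _ _
          | add a b _ _ ha hb => rw [add_smul, ha, hb, add_zero]
          | smul c a _ ha => rw [smul_eq_mul, mul_smul, ha, smul_zero]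
        have := isNoetherian_of_le h
        exact isNoetherian_of_linearEquiv
          (Submodule.equivMapOfInjective _ (Submodule.subtype_injective _) _).symm
      exact isNoetherian_of_range_eq_ker (LinearMap.ker f).subtype f (Submodule.range_subtype _)
  -- The radical is nilpotent, so the filtration reaches N after finitely many steps.
  obtain ⟨n, hn⟩ := IsSemiprimaryRing.isNilpotent (R := R)
  have htop : A n = ⊤ := eq_top_iff.2 fun x _ a ha => by
    have ha' : a ∈ (Ring.jacobson R) ^ n := ha
    rw [hn] at ha'
    obtain rfl : a = 0 := ha'
    exact zero_smul _ _
  have hN : IsNoetherian k N := by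
    have := hA n
    rw [htop] at this
    exact isNoetherian_of_linearEquiv (Submodule.topEquiv (R := k) (M := N))
  have : Module.Finite k N := inferInstance
  exact Module.Finite.of_restrictScalars_finite k R N

end Finite

/-! ### Maximal injective submodules and summands -/

section Chains
variable {R : Type u} [Ring R] [IsNoetherianRing R]

/-- Over a noetherian ring any module has a maximal injective submodule. -/
theorem exists_maximal_injective {M : Type u} [AddCommGroup M] [Module R M] :
    ∃ S : Submodule R M, Maximal (fun S : Submodule R M => Module.Injective R S) S := by
  have hchain (c : Set (Submodule R M)) (hc : c ⊆ {S | Module.Injective R S})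
      (hchain : IsChain (· ≤ ·) c) (y : Submodule R M) (hy : y ∈ c) :
      Module.Injective R (sSup c : Submodule R M) := by
    -- By Baer's criterion it suffices to extend from left ideals. These are finitely generated, so
    -- the image of g lies in one member of the chain, where the extension exists.
    refine Module.Baer.injective fun a g => ?_
    let g' : a →ₗ[R] M := (sSup c).subtype ∘ₗ g
    have hfg : (LinearMap.range g').FG := by
      rw [LinearMap.range_eq_map]
      exact (IsNoetherian.noetherian (⊤ : Submodule R a)).map g'
    have hle : LinearMap.range g' ≤ sSup c := by
      rintro _ ⟨x, rfl⟩
      exact (g x).2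
    obtain ⟨S, hS, hle'⟩ := (CompleteLattice.isCompactElement_iff_le_of_directed_sSup_le _ _).1
      ((Submodule.fg_iff_compact _).1 hfg) c ⟨y, hy⟩ hchain.directedOn hle
    have : Module.Injective R S := hc hS
    obtain ⟨h, hh⟩ := Module.Baer.of_injective this a
      (g'.codRestrict S fun x => hle' ⟨x, rfl⟩)
    refine ⟨Submodule.inclusion (le_sSup hS) ∘ₗ h, fun x hx => Subtype.ext ?_⟩
    exact congrArg (fun t : S => (t : M)) (hh x hx)
  have hbot : Module.Injective R (⊥ : Submodule R M) :=
    ⟨fun X Y _ _ _ _ f _ g => ⟨0, fun x => Subsingleton.elim _ _⟩⟩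
  obtain ⟨S, -, hS⟩ := zorn_le_nonempty₀ {S : Submodule R M | Module.Injective R S}
    (fun c hc hc' y hy => ⟨sSup c, hchain c hc hc' y hy, fun z hz => le_sSup hz⟩) ⊥ hbot
  exact ⟨S, hS⟩

end Chains

section Maximal
variable {D : Type*} [Category* D] [Abelian D]

/-- An injective subobject of `M` which is maximal among the injective subobjects yields a maximal
injective summand. -/
theorem hasMaximalInjectiveSummands_of_maximal
    (h : ∀ M : D, ∃ (I : D) (i : I ⟶ M), Mono i ∧ Injective I ∧
      ∀ (I' : D) (k : I ⟶ I') (i' : I' ⟶ M), Mono i' → Injective I' → k ≫ i' = i → IsIso k) :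
    HasMaximalInjectiveSummands D := by
  intro M
  obtain ⟨I, i, _, _, hmax⟩ := h M
  let S := ShortComplex.mk i (cokernel.π i) (cokernel.condition i)
  have hS : S.Exact := ShortComplex.exact_of_g_is_cokernel _ (cokernelIsCokernel i)
  have : Mono S.f := ‹Mono i›
  have : Epi S.g := inferInstanceAs (Epi (cokernel.π i))
  let σ : S.Splitting := ShortComplex.Splitting.ofExactOfRetraction S hS
    (Injective.factorThru (𝟙 I) i) (Injective.comp_factorThru (𝟙 I) i) inferInstance
  refine ⟨cokernel i, I, ⟨σ.isoBinaryBiproduct ≪≫ biprod.braiding _ _⟩, inferInstance, ?_⟩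
  rintro J N _ ⟨φ⟩
  -- An injective summand J of the complement would give a larger injective subobject J ⊞ I.
  -- Maximality makes I → J ⊞ I invertible, so J = 0.
  let i' : J ⊞ I ⟶ M := biprod.desc (biprod.inr ≫ φ.inv ≫ σ.s) i
  have hi' : i' = biprod.map (biprod.inr ≫ φ.inv) (𝟙 I) ≫
      (σ.isoBinaryBiproduct ≪≫ biprod.braiding _ _).inv := by
    ext <;> simp [i', ShortComplex.Splitting.isoBinaryBiproduct, S]
  have hmono : Mono i' := by
    rw [hi']
    infer_instance
  have hiso : IsIso (biprod.inr : I ⟶ J ⊞ I) :=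
    hmax _ biprod.inr i' hmono inferInstance (biprod.inr_desc _ _)
  have hfst : (biprod.fst : J ⊞ I ⟶ J) = 0 := by
    rw [← cancel_epi (biprod.inr : I ⟶ J ⊞ I), biprod.inr_fst, comp_zero]
  rw [IsZero.iff_id_eq_zero, ← biprod.inl_fst (X := J) (Y := I), hfst, comp_zero]

end Maximal

/-! ### Comparison of module theory with full subcategories of modules -/

section Modules
variable {R : Type u} [Ring R]

/-- Any module is an essential submodule of an injective module. -/
theorem exists_essential_injective (M : Type u) [AddCommGroup M] [Module R M] :
    ∃ (N : ModuleCat.{u} R) (i : M →ₗ[R] N), Function.Injective i ∧ Module.Injective R N ∧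
      ∀ T : Submodule R N, Disjoint T (LinearMap.range i) → T = ⊥ := by
  let I := Injective.under (ModuleCat.of R M)
  have hI : Injective I := inferInstanceAs (Injective (Injective.under (ModuleCat.of R M)))
  let i := (Injective.ι (ModuleCat.of R M)).hom
  have hi : Function.Injective i := (ModuleCat.mono_iff_injective _).1 inferInstance
  have : Module.Injective R I :=
    Module.injective_module_of_injective_object R I (inj := hI)
  obtain ⟨e, he, hiM, hess⟩ := exists_essential_retract (LinearMap.range i)
  have hle (x : M) : i x ∈ LinearMap.range e := ⟨i x, hiM _ ⟨x, rfl⟩⟩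
  refine ⟨ModuleCat.of R (LinearMap.range e), i.codRestrict _ hle,
    fun x y hxy => hi (congrArg Subtype.val hxy), ⟨fun X Y _ _ _ _ f hf g => ?_⟩, fun T hT => ?_⟩
  · obtain ⟨h, hh⟩ := Module.Injective.out f hf ((LinearMap.range e).subtype ∘ₗ g)
    refine ⟨e.rangeRestrict ∘ₗ h, fun x => Subtype.ext ?_⟩
    obtain ⟨y, hy⟩ := (g x).2
    have h₁ : h (f x) = g x := hh x
    have h₂ : e (h (f x)) = g x := by rw [h₁, ← hy, he]
    exact h₂
  · refine Submodule.map_injective_of_injective (LinearMap.range e).subtype_injective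
      ((hess _ (Submodule.map_subtype_le _ T) ?_).trans (Submodule.map_bot _).symm)
    rw [Submodule.disjoint_def]
    rintro _ ⟨y, hy, rfl⟩ ⟨x, hx⟩
    have := Submodule.disjoint_def.1 hT y hy ⟨x, Subtype.ext hx⟩
    rw [this, map_zero]

variable {D : Type*} [Category* D] [Abelian D] (F : D ⥤ ModuleCat.{u} R) [F.Full] [F.Faithful]
  [F.PreservesMonomorphisms]

-- A fully faithful functor that preserves monomorphisms reflects injectivity, and minimality is
-- bijectivity on an essential extension. The functor F covers all modules and finitely generated
-- modules at once.
omit [Abelian D] in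
theorem isInjectiveEnvelope_of_essential {M N : D} (i : M ⟶ N)
    (hi : Function.Injective (F.map i).hom) (hN : Module.Injective R (F.obj N))
    (h : ∀ T : Submodule R (F.obj N), Disjoint T (LinearMap.range (F.map i).hom) → T = ⊥) :
    IsInjectiveEnvelope i where
  mono := F.mono_of_mono_map ((ModuleCat.mono_iff_injective _).2 hi)
  injective := by
    have := Module.injective_object_of_injective_module R (F.obj N)
    exact F.injective_of_map_injective this
  minimal g hg := by
    have hbij : Function.Bijective (F.map g).hom := by
      refine bijective_of_essential _ h _ ?_
      rintro _ ⟨x, rfl⟩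
      have hg' := congrArg (fun t => (F.map t).hom x) hg
      simpa using hg'
    have : IsIso (F.map g) := (ConcreteCategory.isIso_iff_bijective _).2 hbij
    exact isIso_of_reflects_iso g F

/-- Maximality of the image among submodules gives maximality among subobjects: monomorphisms with
the same image differ by an isomorphism, which F reflects. -/
theorem hasMaximalInjectiveSummands_of_range
    (h : ∀ M : D, ∃ S : Submodule R (F.obj M), Maximal (fun S => ∃ (I : D) (i : I ⟶ M),
      Mono i ∧ Injective I ∧ LinearMap.range (F.map i).hom = S) S) :
    HasMaximalInjectiveSummands D := by
  refine hasMaximalInjectiveSummands_of_maximal fun M => ?_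
  obtain ⟨_, ⟨I, i, hi, hI, rfl⟩, hmax⟩ := h M
  refine ⟨I, i, hi, hI, fun I' k i' hi' hI' hk => ?_⟩
  have hki (x : F.obj I) : (F.map i').hom ((F.map k).hom x) = (F.map i).hom x := by
    rw [← hk, F.map_comp]
    rfl
  have hle : LinearMap.range (F.map i').hom ≤ LinearMap.range (F.map i).hom := by
    refine hmax ⟨I', i', hi', hI', rfl⟩ ?_
    rintro _ ⟨x, rfl⟩
    exact ⟨_, hki x⟩
  have hinj : Function.Injective (F.map i').hom :=
    (ModuleCat.mono_iff_injective _).1 (inferInstanceAs (Mono (F.map i')))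
  have hinj' : Function.Injective (F.map i).hom :=
    (ModuleCat.mono_iff_injective _).1 (inferInstanceAs (Mono (F.map i)))
  have hbij : Function.Bijective (F.map k).hom := by
    refine ⟨fun x y hxy => hinj' ?_, fun y => ?_⟩
    · rw [← hki, ← hki, hxy]
    · obtain ⟨x, hx⟩ := hle ⟨y, rfl⟩
      exact ⟨x, hinj ((hki x).trans hx)⟩
  have : IsIso (F.map k) := (ConcreteCategory.isIso_iff_bijective _).2 hbij
  exact isIso_of_reflects_iso k F

end Modules

/-! ### Envelopes and maximal injective summands in the two module categories -/

section Categories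

theorem hasInjectiveEnvelopes_moduleCat (R : Type u) [Ring R] :
    HasInjectiveEnvelopes (ModuleCat.{u} R) := by
  intro M
  obtain ⟨N, i, hi, hN, h⟩ := exists_essential_injective (R := R) M
  exact ⟨N, ModuleCat.ofHom i, isInjectiveEnvelope_of_essential (𝟭 _) (ModuleCat.ofHom i) hi hN h⟩

theorem hasMaximalInjectiveSummands_moduleCat (R : Type u) [Ring R] [IsNoetherianRing R] :
    HasMaximalInjectiveSummands (ModuleCat.{u} R) := by
  refine hasMaximalInjectiveSummands_of_range (𝟭 _) fun M => ?_
  obtain ⟨S, hS, hmax⟩ := exists_maximal_injective (R := R) (M := M)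
  refine ⟨S, ⟨ModuleCat.of R S, ModuleCat.ofHom S.subtype,
    (ModuleCat.mono_iff_injective _).2 S.subtype_injective, ?_, Submodule.range_subtype S⟩, ?_⟩
  · exact Module.injective_object_of_injective_module R S
  · rintro _ ⟨I, i, hi, hI, rfl⟩ hle
    refine hmax ?_ hle
    have := Module.injective_module_of_injective_object R I
    let e : I ≃ₗ[R] LinearMap.range i.hom :=
      LinearEquiv.ofInjective i.hom ((ModuleCat.mono_iff_injective _).1 hi)
    exact Module.Baer.injective (Module.Baer.of_equiv e (Module.Baer.of_injective this))

theorem hasInjectiveEnvelopes_fgModuleCat (k : Type*) [CommRing k] [IsArtinianRing k]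
    (R : Type u) [Ring R] [Algebra k R] [Module.Finite k R] [IsNoetherianRing R] :
    HasInjectiveEnvelopes (FGModuleCat.{u} R) := by
  intro M
  obtain ⟨N, i, hi, hN, h⟩ := exists_essential_injective (R := R) M
  have : Module.Finite R N := finite_of_essential k (LinearMap.range i) h
  exact ⟨FGModuleCat.of R N, FGModuleCat.ofHom i,
    isInjectiveEnvelope_of_essential (forget₂ (FGModuleCat.{u} R) (ModuleCat.{u} R))
      (FGModuleCat.ofHom i) hi hN h⟩

/-- The ascending chain condition yields a maximal image of an injective subobject; the zero object
shows that such images exist. -/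
theorem hasMaximalInjectiveSummands_fgModuleCat (R : Type u) [Ring R] [IsNoetherianRing R] :
    HasMaximalInjectiveSummands (FGModuleCat.{u} R) := by
  refine hasMaximalInjectiveSummands_of_range
    (forget₂ (FGModuleCat.{u} R) (ModuleCat.{u} R)) fun M => ?_
  have : IsNoetherian R ((forget₂ (FGModuleCat.{u} R) (ModuleCat.{u} R)).obj M) :=
    inferInstanceAs (IsNoetherian R M)
  exact exists_maximal_of_wellFoundedGT _ ⟨_, 0, 0, inferInstance, inferInstance, rfl⟩

end Categories

end

end Mimo

/-! ### The three parts of the theorem combined -/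

theorem mainTheorem2 :
    (∀ (C : Type*) [Category* C] [Abelian C] (X : C ⥤ C) [X.Additive]
      [PreservesFiniteLimits X] [PreservesFiniteColimits X] [X.PreservesInjectiveObjects]
      [Mimo.IsLocallyNilpotent X],
      Mimo.HasInjectiveEnvelopes C → Mimo.HasMaximalInjectiveSummands C →
        Mimo.IndecomposablesOfMono X) ∧
    (∀ (Q : Type*) [Quiver Q] [Mimo.FiniteAcyclic Q] (B : Type*) [Category* B] [Abelian B],
      Mimo.HasInjectiveEnvelopes B → Mimo.HasMaximalInjectiveSummands B →
        Mimo.IndecomposablesOfMonoReps Q B) ∧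
    (∀ (k : Type*) [CommRing k] [IsArtinianRing k] (Λ : Type u) [Ring Λ] [Algebra k Λ]
      [Module.Finite k Λ],
      haveI : IsNoetherianRing Λᵐᵒᵖ := Mimo.isNoetherianRing_op k Λ
      Mimo.HasInjectiveEnvelopes (ModuleCat.{u} Λᵐᵒᵖ) ∧
      Mimo.HasMaximalInjectiveSummands (ModuleCat.{u} Λᵐᵒᵖ) ∧
      Mimo.HasInjectiveEnvelopes (FGModuleCat.{u} Λᵐᵒᵖ) ∧
      Mimo.HasMaximalInjectiveSummands (FGModuleCat.{u} Λᵐᵒᵖ) ∧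
      ∀ (Q : Type*) [Quiver Q] [Mimo.FiniteAcyclic Q],
        Mimo.IndecomposablesOfMonoReps Q (ModuleCat.{u} Λᵐᵒᵖ) ∧
        Mimo.IndecomposablesOfMonoReps Q (FGModuleCat.{u} Λᵐᵒᵖ)) := by
  refine ⟨fun C _ _ X _ _ _ _ _ hC hC' => Mimo.indecomposablesOfMono hC hC', ?_, ?_⟩
  · exact fun Q _ _ B _ _ hB hB' => Mimo.indecomposablesOfMonoReps hB hB'
  · intro k _ _ Λ _ _ _
    have := Mimo.isNoetherianRing_op k Λ
    have h₁ := Mimo.hasInjectiveEnvelopes_moduleCat Λᵐᵒᵖ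
    have h₂ := Mimo.hasMaximalInjectiveSummands_moduleCat Λᵐᵒᵖ
    have h₃ := Mimo.hasInjectiveEnvelopes_fgModuleCat k Λᵐᵒᵖ
    have h₄ := Mimo.hasMaximalInjectiveSummands_fgModuleCat Λᵐᵒᵖ
    exact ⟨h₁, h₂, h₃, h₄, fun Q _ _ => ⟨Mimo.indecomposablesOfMonoReps h₁ h₂,
      Mimo.indecomposablesOfMonoReps h₃ h₄⟩⟩
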